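/- **Setting.** Let $\mathcal S,\mathcal A$ be finite non-empty sets, $\mathcal P(\cdot\mid s,a)$ a transition law, $r$ a reward with $|r(s,a,s')|\le R_{\max}$, $\gamma\in[0,1)$, and $\beta$ a behaviour policy such that the Markov chain on $\mathcal S\times\mathcal A$ given by $s'\sim\mathcal P(\cdot\mid s,a)$, $a'\sim\beta(\cdot\mid s')$ is irreducible, with stationary distribution $d$; let $D=\mathrm{diag}(d)$. Let $\Phi\in\mathbb R^{|\mathcal S||\mathcal A|\times h}$ have rows $\phi(s,a)^\top$ with $\|\phi(s,a)\|_2\le1$, and let $\eta>0$. For $Q\in\mathbb R^{|\mathcal S||\mathcal A|}$ put $(\mathcal TQ)(s,a)=\sum_{s'}\mathcal P(s'\mid s,a)\big(r(s,a,s')+\gamma\max_uQ(s',u)\big)$, and define $$L_\eta(\theta,\theta')=\tfrac12\sum_{s,a}d(s,a)\big((\mathcal T\Phi\theta')(s,a)-\phi(s,a)^\top\theta\big)^2+\tfrac\eta2\|\theta\|_2^2,\qquad \theta^*(\theta')=(\Phi^\top D\Phi+\eta I)^{-1}\Phi^\top D\,\mathcal T\Phi\theta',$$ so that $\theta^*(\theta')$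 minimizes $L_\eta(\cdot,\theta')$. Let $\theta^*_\eta\in\mathbb R^h$ satisfy $\theta^*_\eta=\theta^*(\theta^*_\eta)$ (for $\Phi$ of full column rank this is the regularized projected Bellman equation $\Phi\theta=\Phi(\Phi^\top D\Phi+\eta I)^{-1}\Phi^\top D\,\mathcal T\Phi\theta$). **Algorithm.** Let $(s_n,a_n)_{n\ge0}$ be a trajectory of the chain with respect to a filtration $(\mathcal F_n)$, with arbitrary initial law, and let the initial parameter $\theta_{0,K}$ be $\mathcal F_0$-measurable and square-integrable. With $$g(\theta,\theta';s,a,s')=-\big(r(s,a,s')+\gamma\max_u\phi(s',u)^\top\theta'-\phi(s,a)^\top\theta\big)\phi(s,a)+\eta\theta,$$ for $t\ge1$ set $\theta_{t,0}=\theta_{t-1,K}$ and, for $0\le k<K$, $\theta_{t,k+1}=\theta_{t,k}-\alpha\,g(\theta_{t,k},\theta_{t-1,K};s_n,a_n,s_{n+1})$ with $n=(t-1)K+k$. **Constants.** Fix a pair $(\tilde s,\tilde a)$, let $\tau=\inf\{n\ge1:(s_n,a_n)=(\tilde s,\tilde a)\}$ and $\tau_{\max}=\max_{s,a}\mathbb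 E[\tau\mid (s_0,a_0)=(s,a)]$. Let $\mu_\eta=\lambda_{\min}(\Phi^\top D\Phi)+\eta$, $l_\eta=\lambda_{\max}(\Phi^\top D\Phi)+\eta$, $\kappa=l_\eta/\mu_\eta$, and $$l_{V_1}=2\tau_{\max}(1+\eta),\quad l_{V_2}=\max\{2\tau_{\max}\gamma,1\},\quad l_{V_3}=\tau_{\max}\big(R_{\max}+(1+\gamma+\eta)\|\theta^*_\eta\|_2\big),$$ $$D_1=l_\eta(6l_{V_1}+l_{V_3})+\kappa l_{V_1}\gamma,\quad D_2=4\kappa l_{V_1}(1+l_\eta),\quad D_3=\kappa l_{V_1}+l_\eta l_{V_2},$$ $$g_{1,\eta}=16+16\eta,\quad g_{2,\eta}=(42+32\eta)\gamma^2,\quad g_{3,\eta}=32(1+\eta)\gamma^2\|\Phi\theta^*_\eta\|_\infty^2+(16+16\eta)R_{\max}^2+8\sigma_\eta^2,$$ $$\sigma_\eta^2=\max_{s,a}\sum_{s'}\mathcal P(s'\mid s,a)\Big\|\big(r(s,a,s')+\gamma\max_u\phi(s',u)^\top\theta^*_\eta-(\mathcal T\Phi\theta^*_\eta)(s,a)\big)\phi(s,a)\Big\|_2^2,$$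 $$\mathcal E_1=\big(D_1+\tfrac{l_\eta}2\big)g_{2,\eta}+D_3,\qquad \mathcal E_2=\big(D_1+\tfrac{l_\eta}2\big)g_{3,\eta}+2l_\eta l_{V_3},$$ $$\bar\alpha_1=\frac{\mu_\eta}{(D_1+\frac{l_\eta}2)g_{1,\eta}+2D_2},\qquad \bar\alpha_2=\frac{\mu_\eta}{16l_\eta(6l_{V_1}+l_{V_3})(1+\eta)+24\kappa l_{V_1}(1+\eta)}.$$ **Proposition.** If $0<\alpha\le\min\{\bar\alpha_1,\bar\alpha_2\}$, then for all $t\ge1$ and $0\le k\le K$ the expectations below are finite and $$\begin{aligned}\mathbb E\big[L_\eta(\theta_{t,k},\theta_{t-1,K})-L_\eta(\theta^*(\theta_{t-1,K}),\theta_{t-1,K})\big]\le{}&2\Big(1-\frac{\mu_\eta}2\alpha\Big)^k\,\mathbb E\big[L_\eta(\theta_{t,0},\theta_{t-1,K})-L_\eta(\theta^*(\theta_{t-1,K}),\theta_{t-1,K})\big]\\&+2\alpha\Big(\Big(\frac2{\mu_\eta}\mathcal E_1+4(l_{V_1}\gamma\kappa+l_\eta l_{V_2})\Big)\mathbb E\big[\|\Phi(\theta_{t-1,K}-\theta^*_\eta)\|_\infty^2\big]+\frac2{\mu_\eta}\mathcal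 E_2+6l_\eta l_{V_3}\Big).\end{aligned}$$ -/

import Mathlib

open MeasureTheory ProbabilityTheory
open scoped Matrix ENNReal

noncomputable section

/-- A finite Markov decision process with transition law `P`, reward `r` and discount `γ`, together
with a behaviour policy `β`, a feature matrix `Φ` whose row with index `(s, a)` is the feature vector
of `(s, a)`, a regularization weight `η`, and a weighting distribution `d` on state-action pairs. -/
structure RegQ (S A : Type*) (h : ℕ) where
  P : S → A → PMF S
  r : S → A → S → ℝ
  γ : ℝ
  β : S → PMF A
  Φ : Matrix (S × A) (Fin h) ℝ
  η : ℝ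
  d : PMF (S × A)

namespace RegQ

variable {S A : Type*} {h : ℕ}

/-! ### The state-action Markov chain -/

/-- Transition law of the state-action chain: `s' ∼ P(· | s, a)`, then `a' ∼ β(· | s')`. -/
def step (M : RegQ S A h) (z : S × A) : PMF (S × A) :=
  (M.P z.1 z.2).bind fun s' => (M.β s').map fun a' => (s', a')

/-- Transition matrix of the state-action chain. -/
def stepMatrix (M : RegQ S A h) : Matrix (S × A) (S × A) ℝ :=
  Matrix.of fun z z' => (M.step z z').toReal

/-- `d` is a stationary distribution of the state-action chain. -/
def IsStationary (M : RegQ S A h) : Prop := M.d.bind M.step = M.d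

section Law

variable [Fintype S] [Fintype A] [MeasurableSpace S] [MeasurableSpace A]
  [DiscreteMeasurableSpace S] [DiscreteMeasurableSpace A]

/-- The transition law as a Markov kernel. -/
def stepKernel (M : RegQ S A h) : Kernel (S × A) (S × A) where
  toFun z := (M.step z).toMeasure
  measurable' := measurable_of_finite _

instance (M : RegQ S A h) : IsMarkovKernel M.stepKernel :=
  ⟨fun z => inferInstanceAs (IsProbabilityMeasure (M.step z).toMeasure)⟩

/-- The next-step kernel of the chain as a function of the whole past. -/
def pastKernel (M : RegQ S A h) (n : ℕ) :
    Kernel (Π _ : Finset.Iic n, S × A) (S × A) :=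
  M.stepKernel.comap (fun x => x ⟨n, Finset.mem_Iic.2 le_rfl⟩) (measurable_pi_apply _)

instance (M : RegQ S A h) (n : ℕ) : IsMarkovKernel (M.pastKernel n) := by
  unfold pastKernel; infer_instance

/-- Law on path space of the state-action chain started at `z`. -/
def chainLaw (M : RegQ S A h) (z : S × A) : Measure (ℕ → S × A) :=
  Kernel.trajMeasure (X := fun _ => S × A) (Measure.dirac z) M.pastKernel

/-- `τ = inf {n ≥ 1 : (S_n, A_n) = w}`. -/
def hitTime (w : S × A) (x : ℕ → S × A) : ℕ∞ :=
  hittingAfter (fun (n : ℕ) (x : ℕ → S × A) => x n) {w} 1 x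

/-- `τ_max`: the largest expected hitting time of the reference pair `w`, over all starting pairs. -/
def tauMax (M : RegQ S A h) (w : S × A) : ℝ :=
  (⨆ z, ∫⁻ x, (hitTime w x : ℝ≥0∞) ∂(M.chainLaw z)).toReal

/-- `Z` is a trajectory of the state-action chain with respect to the filtration `ℱ`, with arbitrary
initial law. -/
structure IsTrajectory (M : RegQ S A h) {Ω : Type*} {mΩ : MeasurableSpace Ω} (ρ : Measure Ω)
    (ℱ : Filtration ℕ mΩ) (Z : ℕ → Ω → S × A) : Prop where
  adapted : ∀ n, Measurable[ℱ n] (Z n)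
  markov : ∀ n z', ρ[(Z (n + 1) ⁻¹' {z'}).indicator (fun _ => (1 : ℝ)) | ℱ n]
    =ᵐ[ρ] fun ω => (M.step (Z n ω) z').toReal

end Law

/-! ### Value functions and the regularized inner-loop loss -/

/-- The feature vector of a state-action pair, in Euclidean space. -/
def feat (M : RegQ S A h) (z : S × A) : EuclideanSpace ℝ (Fin h) := WithLp.toLp 2 (M.Φ z)

/-- `Φ θ`; its norm as a function on `S × A` is the supremum norm. -/
def val (M : RegQ S A h) (θ : EuclideanSpace ℝ (Fin h)) : S × A → ℝ := M.Φ *ᵥ θ.ofLp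

section Gram

variable [Fintype S] [Fintype A] [DecidableEq S] [DecidableEq A]

/-- `D`. -/
def weight (M : RegQ S A h) : Matrix (S × A) (S × A) ℝ :=
  Matrix.diagonal fun z => (M.d z).toReal

/-- `Φᵀ D Φ`. -/
def gram (M : RegQ S A h) : Matrix (Fin h) (Fin h) ℝ := M.Φᵀ * M.weight * M.Φ

theorem gram_isHermitian (M : RegQ S A h) : M.gram.IsHermitian := by
  simp [gram, weight, Matrix.IsHermitian, Matrix.conjTranspose_eq_transpose_of_trivial,
    Matrix.transpose_mul, Matrix.mul_assoc]

end Gram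

section Loss

variable [Fintype S] [Fintype A] [Nonempty A]

/-- `max_u Q(s, u)`. -/
def maxQ (Q : S × A → ℝ) (s : S) : ℝ :=
  Finset.univ.sup' Finset.univ_nonempty fun u => Q (s, u)

/-- The Bellman optimality operator `𝒯 Q = R + γ P Π_Q Q`. -/
def bellman (M : RegQ S A h) (Q : S × A → ℝ) (z : S × A) : ℝ :=
  ∑ s', (M.P z.1 z.2 s').toReal * (M.r z.1 z.2 s' + M.γ * maxQ Q s')

/-- `L_η(θ, θ') = ½ ‖𝒯 Φ θ' - Φ θ‖_D² + (η / 2) ‖θ‖₂²`. -/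
def loss (M : RegQ S A h) (θ θ' : EuclideanSpace ℝ (Fin h)) : ℝ :=
  1 / 2 * ∑ z, (M.d z).toReal * (M.bellman (M.val θ') z - M.val θ z) ^ 2
    + M.η / 2 * ‖θ‖ ^ 2

/-- The semi-gradient
`g(θ, θ'; s, a, s') = (r(s,a,s') + γ max_u φ(s',u)ᵀ θ' - φ(s,a)ᵀ θ) (-φ(s,a)) + η θ`. -/
def grad (M : RegQ S A h) (θ θ' : EuclideanSpace ℝ (Fin h)) (z : S × A) (s' : S) :
    EuclideanSpace ℝ (Fin h) :=
  (M.r z.1 z.2 s' + M.γ * maxQ (M.val θ') s' - M.val θ z) • (-M.feat z) + M.η • θ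

variable [DecidableEq S] [DecidableEq A]

/-- `μ_η = λ_min(Φᵀ D Φ) + η`. -/
def muEta (M : RegQ S A h) : ℝ := (⨅ i, M.gram_isHermitian.eigenvalues i) + M.η

/-- `l_η = λ_max(Φᵀ D Φ) + η`. -/
def lEta (M : RegQ S A h) : ℝ := (⨆ i, M.gram_isHermitian.eigenvalues i) + M.η

/-- The condition number `κ = l_η / μ_η`. -/
def kappa (M : RegQ S A h) : ℝ := M.lEta / M.muEta

/-- `θ*(θ') = (Φᵀ D Φ + η I)⁻¹ Φᵀ D 𝒯 Φ θ'`, the minimizer of `L_η(·, θ')`. -/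
def innerMin (M : RegQ S A h) (θ' : EuclideanSpace ℝ (Fin h)) : EuclideanSpace ℝ (Fin h) :=
  WithLp.toLp 2 (((M.gram + M.η • (1 : Matrix (Fin h) (Fin h) ℝ))⁻¹ * M.Φᵀ * M.weight) *ᵥ
    M.bellman (M.val θ'))

/-- The regularized projection `Γ_η = Φ (Φᵀ D Φ + η I)⁻¹ Φᵀ D`. -/
def regProj (M : RegQ S A h) : Matrix (S × A) (S × A) ℝ :=
  M.Φ * ((M.gram + M.η • (1 : Matrix (Fin h) (Fin h) ℝ))⁻¹ * M.Φᵀ * M.weight)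

/-- `θ` solves the regularized projected Bellman equation, in parameter form. When `Φ` has full
column rank this is the equation `Φ θ = Γ_η 𝒯 Φ θ`, see `isSolution_iff`. -/
def IsSolution (M : RegQ S A h) (θ : EuclideanSpace ℝ (Fin h)) : Prop := M.innerMin θ = θ

theorem isSolution_iff (M : RegQ S A h) (hΦ : Function.Injective M.Φ.mulVec)
    (θ : EuclideanSpace ℝ (Fin h)) :
    M.IsSolution θ ↔ M.regProj *ᵥ M.bellman (M.val θ) = M.val θ := by
  have h1 : M.regProj *ᵥ M.bellman (M.val θ) = M.Φ *ᵥ (M.innerMin θ).ofLp := by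
    simp only [regProj, innerMin, Matrix.mulVec_mulVec]
  rw [h1]
  refine ⟨fun e => by rw [show M.innerMin θ = θ from e]; rfl, fun e => ?_⟩
  exact (WithLp.ofLp_injective 2) (hΦ e)

/-- `σ_η²`: the largest conditional variance of the sampled target direction at `θ*_η`. -/
def sigmaSq (M : RegQ S A h) (θs : EuclideanSpace ℝ (Fin h)) : ℝ :=
  ⨆ z : S × A, ∑ s', (M.P z.1 z.2 s').toReal *
    ‖(M.r z.1 z.2 s' + M.γ * maxQ (M.val θs) s' - M.bellman (M.val θs) z) • M.feat z‖ ^ 2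

/-! ### Constants. Here `τ` is `τ_max`, `R` is `R_max` and `θs` is `θ*_η`. -/

def lV1 (M : RegQ S A h) (τ : ℝ) : ℝ := 2 * τ * (1 + M.η)

def lV2 (M : RegQ S A h) (τ : ℝ) : ℝ := max (2 * τ * M.γ) 1

def lV3 (M : RegQ S A h) (τ R : ℝ) (θs : EuclideanSpace ℝ (Fin h)) : ℝ :=
  τ * (R + (1 + M.γ + M.η) * ‖θs‖)

def D1 (M : RegQ S A h) (τ R : ℝ) (θs : EuclideanSpace ℝ (Fin h)) : ℝ :=
  M.lEta * (6 * M.lV1 τ + M.lV3 τ R θs) + M.kappa * M.lV1 τ * M.γ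

def D2 (M : RegQ S A h) (τ : ℝ) : ℝ := M.kappa * (4 * M.lV1 τ * (1 + M.lEta))

def D3 (M : RegQ S A h) (τ : ℝ) : ℝ := M.kappa * M.lV1 τ + M.lEta * M.lV2 τ

def g1 (M : RegQ S A h) : ℝ := 16 + 16 * M.η

def g2 (M : RegQ S A h) : ℝ := (42 + 32 * M.η) * M.γ ^ 2

def g3 (M : RegQ S A h) (R : ℝ) (θs : EuclideanSpace ℝ (Fin h)) : ℝ :=
  32 * (1 + M.η) * M.γ ^ 2 * ‖M.val θs‖ ^ 2 + (16 + 16 * M.η) * R ^ 2 + 8 * M.sigmaSq θs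

def E1 (M : RegQ S A h) (τ R : ℝ) (θs : EuclideanSpace ℝ (Fin h)) : ℝ :=
  (M.D1 τ R θs + M.lEta / 2) * M.g2 + M.D3 τ

def E2 (M : RegQ S A h) (τ R : ℝ) (θs : EuclideanSpace ℝ (Fin h)) : ℝ :=
  (M.D1 τ R θs + M.lEta / 2) * M.g3 R θs + 2 * M.lEta * M.lV3 τ R θs

def alpha1 (M : RegQ S A h) (τ R : ℝ) (θs : EuclideanSpace ℝ (Fin h)) : ℝ :=
  M.muEta / ((M.D1 τ R θs + M.lEta / 2) * M.g1 + 2 * M.D2 τ)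

def alpha2 (M : RegQ S A h) (τ R : ℝ) (θs : EuclideanSpace ℝ (Fin h)) : ℝ :=
  M.muEta / (16 * M.lEta * (6 * M.lV1 τ + M.lV3 τ R θs) * (1 + M.η)
    + 24 * M.kappa * M.lV1 τ * (1 + M.η))

end Loss

/-! ### The double-loop algorithm along a trajectory `z` of state-action pairs -/

section Algorithm

variable [Fintype A] [Nonempty A]

/-- Inner loop: `k` steps of step size `α` started at the frozen target `θ'`, where step `j` uses the
observation `(s, a, s')` made of `z (n + j)` and the state of `z (n + j + 1)`. -/
def inner (M : RegQ S A h) (α : ℝ) (z : ℕ → S × A) (n : ℕ) (θ' : EuclideanSpace ℝ (Fin h)) :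
    ℕ → EuclideanSpace ℝ (Fin h)
  | 0 => θ'
  | k + 1 => inner M α z n θ' k
      - α • M.grad (inner M α z n θ' k) θ' (z (n + k)) (z (n + k + 1)).1

/-- `outer t` is the target parameter `θ_{t,K}` after `t` outer iterations of `K` inner steps each;
`outer 0` is the initial parameter. -/
def outer (M : RegQ S A h) (α : ℝ) (K : ℕ) (z : ℕ → S × A) (θ0 : EuclideanSpace ℝ (Fin h)) :
    ℕ → EuclideanSpace ℝ (Fin h)
  | 0 => θ0
  | t + 1 => M.inner α z (t * K) (outer M α K z θ0 t) K

/-- The inner iterate `θ_{t,k}` for `t ≥ 1`. -/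
def iter (M : RegQ S A h) (α : ℝ) (K : ℕ) (z : ℕ → S × A) (θ0 : EuclideanSpace ℝ (Fin h))
    (t k : ℕ) : EuclideanSpace ℝ (Fin h) :=
  M.inner α z ((t - 1) * K) (M.outer α K z θ0 (t - 1)) k

end Algorithm

/-- The inner-loop loss gap `L_η(θ_{t,k}, θ_{t-1,K}) - L_η(θ*(θ_{t-1,K}), θ_{t-1,K})`. -/
def gap [Fintype S] [Fintype A] [Nonempty A] [DecidableEq S] [DecidableEq A]
    (M : RegQ S A h) (α : ℝ) (K : ℕ) (z : ℕ → S × A) (θ0 : EuclideanSpace ℝ (Fin h))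
    (t k : ℕ) : ℝ :=
  M.loss (M.iter α K z θ0 t k) (M.outer α K z θ0 (t - 1))
    - M.loss (M.innerMin (M.outer α K z θ0 (t - 1))) (M.outer α K z θ0 (t - 1))

end RegQ

end

/-!
For a frozen target `θ'` the inner loop is a linear recursion for the deviation `x = θ - innerMin
θ'`: by `grad_eq_add`, `x` is replaced by `x - α (A_z x + b)`, where `A_z = φ φᵀ + η I` has
stationary mean `H = Φᵀ D Φ + η I` (`meanHess`) and the additive noise `b`, the semi-gradient at
the inner minimizer, is centred under the stationary law by the normal equations. The loss gap
equals `½ ⟪H x, x⟫` (`loss_sub_loss_innerMin`), so with independent sampling from `d` it would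
contract by the Polyak-Łojasiewicz inequality `muEta_mul_inner_le`.

The samples are Markovian instead. The remedy is to add to the gap correctors that solve Poisson
equations of the chain. A Poisson kernel is given by the expected numbers of visits before the
chain hits `w` (`exists_isPoissonKernel`); it is nonnegative with row sums `𝔼 τ ≤ tauMax`
(`tsum_survival_le_tauMax`), which is how `tauMax` controls every corrector. The corrected energy
`LinearSA.lyap` has a corrector of first order in `α`, which centres the noise `A_z - H` and `b`,
and two of second order. The latter replace the squared noise and the interaction of `A_z` with
the first corrector by their stationary means. This matters for the constants: pointwise, `b` is
only bounded with a factor `1 / muEta` (`norm_grad_innerMin_le`), while its stationary second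
moment is at most `3 / 8 * (g2 ‖Φ (θ' - θs)‖² + g3)` without that factor
(`sum_sum_norm_grad_innerMin_sq_le`).

`LinearSA.Valid.sum_lyap_next_le` computes the drift of the corrected energy,
`StepBounds.drift_le` and `StepBounds.corrector_le` absorb the error terms by the step-size
conditions, and `sum_corrGap_le` and `abs_corrGap_sub_le` state the outcome: the corrected gap
contracts by `1 - μ α / 2` in conditional mean up to `O(α²)`, and it differs from the gap by at
most a quarter of the gap plus `O(α)`. Taking expectations along the trajectory and summing the
geometric series gives the bound, with the prefactor `(4 / 3) (5 / 4) = 5 / 3 ≤ 2` coming from the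
comparison at the two ends.
-/

noncomputable section

open scoped InnerProductSpace

/-! ### Taboo probabilities and the Poisson equation of a finite Markov chain -/

section Taboo

variable {ι : Type*} [DecidableEq ι] {P : Matrix ι ι ℝ} {w : ι}

/-- The transition matrix `P` killed on arrival at `w`: the column of `w` is replaced by zero. -/
def tabooMatrix (P : Matrix ι ι ℝ) (w : ι) : Matrix ι ι ℝ :=
  Matrix.of fun z y => if y = w then 0 else P z y

theorem tabooMatrix_nonneg (h0 : ∀ z y, 0 ≤ P z y) (z y : ι) : 0 ≤ tabooMatrix P w z y := by
  simp only [tabooMatrix, Matrix.of_apply]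
  split_ifs
  · exact le_rfl
  · exact h0 z y

theorem tabooMatrix_le (h0 : ∀ z y, 0 ≤ P z y) (z y : ι) : tabooMatrix P w z y ≤ P z y := by
  simp only [tabooMatrix, Matrix.of_apply]
  split_ifs
  · exact h0 z y
  · exact le_rfl

variable [Fintype ι]

/-- `survival P w n z` is the probability that the chain with transition matrix `P` started at `z`
does not visit `w` at any of the times `1, …, n`. -/
def survival (P : Matrix ι ι ℝ) (w : ι) (n : ℕ) : ι → ℝ :=
  (tabooMatrix P w ^ n) *ᵥ 1

theorem survival_zero (z : ι) : survival P w 0 z = 1 := by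
  simp [survival]

theorem survival_succ (n : ℕ) (z : ι) :
    survival P w (n + 1) z = ∑ y, tabooMatrix P w z y * survival P w n y := by
  simp only [survival, pow_succ', ← Matrix.mulVec_mulVec]
  rfl

theorem survival_eq_sum (n : ℕ) (z : ι) :
    survival P w n z = ∑ y, (tabooMatrix P w ^ n) z y := by
  simp [survival, Matrix.mulVec, dotProduct]

theorem survival_nonneg (h0 : ∀ z y, 0 ≤ P z y) (n : ℕ) (z : ι) : 0 ≤ survival P w n z := by
  induction n generalizing z with
  | zero => simp [survival_zero]
  | succ n ih =>
    rw [survival_succ]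
    exact Finset.sum_nonneg fun y _ => mul_nonneg (tabooMatrix_nonneg h0 z y) (ih y)

theorem survival_le_one (h0 : ∀ z y, 0 ≤ P z y) (h1 : ∀ z, ∑ y, P z y = 1) (n : ℕ) (z : ι) :
    survival P w n z ≤ 1 := by
  induction n generalizing z with
  | zero => simp [survival_zero]
  | succ n ih =>
    rw [survival_succ, ← h1 z]
    refine Finset.sum_le_sum fun y _ => ?_
    calc tabooMatrix P w z y * survival P w n y ≤ tabooMatrix P w z y * 1 :=
          mul_le_mul_of_nonneg_left (ih y) (tabooMatrix_nonneg h0 z y)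
      _ ≤ P z y := by rw [mul_one]; exact tabooMatrix_le h0 z y

theorem survival_succ_le (h0 : ∀ z y, 0 ≤ P z y) (h1 : ∀ z, ∑ y, P z y = 1) (n : ℕ) (z : ι) :
    survival P w (n + 1) z ≤ survival P w n z := by
  induction n generalizing z with
  | zero => rw [survival_zero]; exact survival_le_one h0 h1 _ z
  | succ n ih =>
    rw [survival_succ (n + 1), survival_succ n]
    exact Finset.sum_le_sum fun y _ =>
      mul_le_mul_of_nonneg_left (ih y) (tabooMatrix_nonneg h0 z y)

theorem survival_succ_le_one_sub (h0 : ∀ z y, 0 ≤ P z y) (h1 : ∀ z, ∑ y, P z y = 1) (n : ℕ)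
    (z : ι) : survival P w (n + 1) z ≤ 1 - (P ^ (n + 1)) z w := by
  induction n generalizing z with
  | zero =>
    rw [survival_succ, ← h1 z, le_sub_iff_add_le]
    simp only [survival_zero, mul_one, zero_add, pow_one]
    rw [← Finset.sum_erase_add _ _ (Finset.mem_univ w),
      ← Finset.sum_erase_add _ (fun y => P z y) (Finset.mem_univ w)]
    have : tabooMatrix P w z w = 0 := by simp [tabooMatrix]
    rw [this, add_zero]
    exact add_le_add_left (Finset.sum_le_sum fun y _ => tabooMatrix_le h0 z y) _
  | succ n ih =>
    rw [survival_succ]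
    have e : 1 - (P ^ (n + 1 + 1)) z w = ∑ y, P z y * (1 - (P ^ (n + 1)) y w) := by
      rw [pow_succ' P (n + 1), Matrix.mul_apply]
      simp only [mul_sub, mul_one, Finset.sum_sub_distrib, h1]
    rw [e]
    refine Finset.sum_le_sum fun y _ => ?_
    exact mul_le_mul (tabooMatrix_le h0 z y) (ih y) (survival_nonneg h0 _ _) (h0 z y)

theorem survival_add (m n : ℕ) (z : ι) :
    survival P w (n + m) z = ∑ y, (tabooMatrix P w ^ n) z y * survival P w m y := by
  simp only [survival, pow_add, ← Matrix.mulVec_mulVec]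
  rfl

theorem tabooMatrix_pow_nonneg (h0 : ∀ z y, 0 ≤ P z y) (n : ℕ) (z y : ι) :
    0 ≤ (tabooMatrix P w ^ n) z y :=
  Matrix.pow_apply_nonneg (tabooMatrix_nonneg h0) n z y

/-- For an irreducible chain the expected hitting time `∑ₙ ℙ(τ > n)` is finite: the survival
probability after some fixed number of steps is uniformly smaller than one. -/
theorem summable_survival (h1 : ∀ z, ∑ y, P z y = 1) (hP : P.IsIrreducible) (z : ι) :
    Summable fun n => survival P w n z := by
  have h0 := hP.nonneg
  have hanti : ∀ z, Antitone fun n => survival P w n z := fun z =>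
    antitone_nat_of_succ_le fun n => survival_succ_le h0 h1 n z
  obtain ⟨m, hm⟩ : ∃ m, ∀ z, survival P w m z < 1 := by
    choose k hk0 hk using fun z => (Matrix.isIrreducible_iff_exists_pow_pos h0).1 hP z w
    refine ⟨∑ z, k z, fun z => ?_⟩
    refine lt_of_le_of_lt (hanti z (Finset.single_le_sum (fun _ _ => Nat.zero_le _)
      (Finset.mem_univ z))) ?_
    obtain ⟨j, hj⟩ := Nat.exists_eq_succ_of_ne_zero (hk0 z).ne'
    have := survival_succ_le_one_sub (w := w) h0 h1 j z
    have h2 := hk z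
    rw [hj] at h2 ⊢
    simp only [Nat.succ_eq_add_one] at *
    linarith
  have : Nonempty ι := ⟨z⟩
  obtain ⟨z₁, -, hz₁⟩ := Finset.exists_max_image Finset.univ (survival P w m) Finset.univ_nonempty
  set c := survival P w m z₁ with hc
  have hc1 : c < 1 := hm z₁
  have hshift : ∀ n, survival P w (n + m) z ≤ c * survival P w n z := by
    intro n
    rw [survival_add, survival_eq_sum n, Finset.mul_sum]
    refine Finset.sum_le_sum fun y _ => ?_
    rw [mul_comm]
    exact mul_le_mul_of_nonneg_right (hz₁ y (Finset.mem_univ y)) (tabooMatrix_pow_nonneg h0 n z y)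
  refine summable_of_sum_range_le (c := m / (1 - c)) (fun n => survival_nonneg h0 n z) fun n => ?_
  rw [le_div_iff₀ (by linarith)]
  have e1 : ∑ i ∈ Finset.range n, survival P w i z
      ≤ ∑ i ∈ Finset.range (m + n), survival P w i z :=
    Finset.sum_le_sum_of_subset_of_nonneg
      (Finset.range_mono (by omega)) fun i _ _ => survival_nonneg h0 i z
  have e2 : ∑ i ∈ Finset.range m, survival P w i z ≤ m := by
    calc _ ≤ ∑ i ∈ Finset.range m, (1 : ℝ) :=
          Finset.sum_le_sum fun i _ => survival_le_one h0 h1 i z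
      _ = m := by simp
  have e3 : ∑ i ∈ Finset.range n, survival P w (m + i) z
      ≤ c * ∑ i ∈ Finset.range n, survival P w i z := by
    rw [Finset.mul_sum]
    exact Finset.sum_le_sum fun i _ => by rw [add_comm]; exact hshift i
  rw [Finset.sum_range_add] at e1
  linarith

end Taboo

section Poisson

variable {ι : Type*} [Fintype ι] [DecidableEq ι]

/-- `N` is a nonnegative kernel with row sums at most `τ` that solves the Poisson equation of the
chain with transition probabilities `p` and stationary law `d`:
`N - p N` is the identity up to a matrix of the form `c dᵀ`, which kills centred functions. -/
structure IsPoissonKernel (p : ι → ι → ℝ) (d : ι → ℝ) (τ : ℝ) (N : ι → ι → ℝ) : Prop where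
  nonneg : ∀ z y, 0 ≤ N z y
  row_sum_le : ∀ z, ∑ y, N z y ≤ τ
  exists_eq : ∃ c : ι → ℝ, ∀ z y,
    N z y = (if z = y then 1 else 0) + ∑ z', p z z' * N z' y - c z * d y

/-- The expected numbers of visits before the first return to `w`, `N = ∑ₙ (tabooMatrix P w) ^ n`,
form a Poisson kernel. Its row sums are the expected hitting times of `w`. -/
theorem exists_isPoissonKernel {P : Matrix ι ι ℝ} {d : ι → ℝ} {τ : ℝ} (w : ι)
    (h1 : ∀ z, ∑ y, P z y = 1) (hP : P.IsIrreducible)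
    (hd : ∀ y, ∑ z, d z * P z y = d y) (hdw : d w ≠ 0)
    (hτ : ∀ z, ∑' n, survival P w n z ≤ τ) : ∃ N, IsPoissonKernel P d τ N := by
  have h0 := hP.nonneg
  set Q := tabooMatrix P w with hQ
  have hs : ∀ z y, Summable fun n => (Q ^ n) z y := fun z y =>
    Summable.of_nonneg_of_le (fun n => tabooMatrix_pow_nonneg h0 n z y)
      (fun n => by
        rw [survival_eq_sum]
        exact Finset.single_le_sum (fun y _ => tabooMatrix_pow_nonneg h0 n z y)
          (Finset.mem_univ y))
      (summable_survival (w := w) h1 hP z)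
  set N : ι → ι → ℝ := fun z y => ∑' n, (Q ^ n) z y with hN
  have hrec : ∀ z y, N z y = (if z = y then 1 else 0) + ∑ z', Q z z' * N z' y := by
    intro z y
    simp only [hN]
    rw [(hs z y).tsum_eq_zero_add]
    have e : (Q ^ 0) z y = if z = y then 1 else 0 := by simp [Matrix.one_apply]
    rw [e]
    congr 1
    simp_rw [pow_succ', Matrix.mul_apply, ← tsum_mul_left]
    exact Summable.tsum_finsetSum fun z' _ => (hs z' y).mul_left _
  have hQP : ∀ z y, ∑ z', Q z z' * N z' y = ∑ z', P z z' * N z' y - P z w * N w y := by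
    intro z y
    rw [← Finset.sum_erase_add _ _ (Finset.mem_univ w),
      ← Finset.sum_erase_add _ (fun z' => P z z' * N z' y) (Finset.mem_univ w),
      add_sub_cancel_right]
    have : Q z w = 0 := by simp [hQ, tabooMatrix]
    rw [this, zero_mul, add_zero]
    refine Finset.sum_congr rfl fun z' hz' => ?_
    have : Q z z' = P z z' := by simp [hQ, tabooMatrix, Finset.ne_of_mem_erase hz']
    rw [this]
  -- Integrating the recursion against `d` gives the cycle formula `d w * N w y = d y`.
  have hcyc : ∀ y, d w * N w y = d y := by
    intro y
    have e : ∑ z, d z * N z y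
        = d y + ∑ z, d z * N z y - d w * N w y := by
      calc ∑ z, d z * N z y
          = ∑ z, (d z * (if z = y then 1 else 0) + ∑ z', d z * P z z' * N z' y
              - d z * P z w * N w y) := by
            refine Finset.sum_congr rfl fun z _ => ?_
            conv_lhs => rw [hrec z y, hQP z y]
            simp only [mul_assoc, ← Finset.mul_sum]
            ring
        _ = d y + ∑ z, d z * N z y - d w * N w y := by
            rw [Finset.sum_sub_distrib, Finset.sum_add_distrib, Finset.sum_comm]
            simp only [← Finset.sum_mul, hd]
            simp
    linarith
  refine ⟨N, fun z y => tsum_nonneg fun n => tabooMatrix_pow_nonneg h0 n z y, fun z => ?_,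
    fun z => P z w / d w, fun z y => ?_⟩
  · refine le_trans (le_of_eq ?_) (hτ z)
    simp only [hN, survival_eq_sum]
    exact (Summable.tsum_finsetSum fun y _ => hs z y).symm
  · rw [hrec z y, hQP z y, ← hcyc y]
    field_simp
    ring

/-- The action of a kernel on vector-valued functions. -/
def applyKernel {E : Type*} [AddCommGroup E] [Module ℝ E] (N : ι → ι → ℝ) (h : ι → E) (z : ι) :
    E := ∑ y, N z y • h y

namespace IsPoissonKernel

variable {p : ι → ι → ℝ} {d : ι → ℝ} {τ : ℝ} {N : ι → ι → ℝ}
  {E : Type*} [NormedAddCommGroup E] [NormedSpace ℝ E]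

theorem norm_applyKernel_le (hN : IsPoissonKernel p d τ N) {h : ι → E} {C : ℝ} (hC : 0 ≤ C)
    (hh : ∀ y, ‖h y‖ ≤ C) (z : ι) : ‖applyKernel N h z‖ ≤ τ * C := by
  calc ‖applyKernel N h z‖ ≤ ∑ y, ‖N z y • h y‖ := norm_sum_le _ _
    _ ≤ ∑ y, N z y * C := by
        refine Finset.sum_le_sum fun y _ => ?_
        rw [norm_smul, Real.norm_of_nonneg (hN.nonneg z y)]
        exact mul_le_mul_of_nonneg_left (hh y) (hN.nonneg z y)
    _ ≤ τ * C := by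
        rw [← Finset.sum_mul]
        exact mul_le_mul_of_nonneg_right (hN.row_sum_le z) hC

theorem applyKernel_eq {E : Type*} [AddCommGroup E] [Module ℝ E] (hN : IsPoissonKernel p d τ N)
    {h : ι → E} (hh : ∑ y, d y • h y = 0)
    (z : ι) : applyKernel N h z = h z + ∑ z', p z z' • applyKernel N h z' := by
  obtain ⟨c, hc⟩ := hN.exists_eq
  have : applyKernel N h z = ∑ y, ((if z = y then 1 else 0 : ℝ) • h y
      + ∑ z', (p z z' * N z' y) • h y - c z • d y • h y) := by
    refine Finset.sum_congr rfl fun y _ => ?_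
    rw [hc z y, sub_smul, add_smul, Finset.sum_smul, mul_smul]
  rw [this, Finset.sum_sub_distrib, Finset.sum_add_distrib, Finset.sum_comm, ← Finset.smul_sum, hh]
  simp [applyKernel, Finset.smul_sum, mul_smul]

end IsPoissonKernel

end Poisson

/-! ### Expected hitting times of the state-action chain -/

theorem ENat.toENNReal_eq_tsum_lt (m : ℕ∞) :
    (m : ℝ≥0∞) = ∑' n : ℕ, if (n : ℕ∞) < m then 1 else 0 := by
  induction m using ENat.recTopCoe with
  | top => simp
  | coe k =>
    rw [tsum_eq_sum (s := Finset.range k) (fun n hn => by simpa using hn),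
      Finset.sum_congr rfl (g := fun _ => (1 : ℝ≥0∞))
        (fun n hn => by simpa using Finset.mem_range.1 hn)]
    simp

namespace RegQ

variable {S A : Type*} {h : ℕ}

theorem step_apply (M : RegQ S A h) (z : S × A) (s' : S) (a' : A) :
    M.step z (s', a') = M.P z.1 z.2 s' * M.β s' a' := by
  classical
  rw [step, PMF.bind_apply, tsum_eq_single s']
  · rw [PMF.map_apply, tsum_eq_single a']
    · simp
    · intro b hb; simp [hb.symm]
  · intro s hs
    rw [PMF.map_apply]
    simp [hs.symm]

theorem stepMatrix_nonneg (M : RegQ S A h) (z z' : S × A) : 0 ≤ M.stepMatrix z z' :=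
  ENNReal.toReal_nonneg

/-- The set of paths that avoid `w` at the times `1, …, n`. -/
def avoidSet (w : S × A) (n : ℕ) : Set (ℕ → S × A) := {x | ∀ j ∈ Finset.Icc 1 n, x j ≠ w}

theorem mem_avoidSet_succ {w : S × A} {n : ℕ} {x : ℕ → S × A} :
    x ∈ avoidSet w (n + 1) ↔ x ∈ avoidSet w n ∧ x (n + 1) ≠ w := by
  refine ⟨fun hc => ⟨fun j hj => hc j (Finset.Icc_subset_Icc_right (Nat.le_succ n) hj),
    hc (n + 1) (by simp)⟩, fun hc j hj => ?_⟩
  rcases Nat.lt_or_ge j (n + 1) with h2 | h2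
  · exact hc.1 j (Finset.mem_Icc.2 ⟨(Finset.mem_Icc.1 hj).1, Nat.lt_succ_iff.1 h2⟩)
  · rw [le_antisymm (Finset.mem_Icc.1 hj).2 h2]
    exact hc.2

theorem lt_hitTime_iff (w : S × A) (x : ℕ → S × A) (n : ℕ) :
    (n : ℕ∞) < hitTime w x ↔ x ∈ avoidSet w n := by
  have key : hitTime w x ≤ (n : ℕ∞) ↔ ∃ j ∈ Set.Icc 1 n, x j ∈ ({w} : Set (S × A)) :=
    hittingAfter_le_iff (u := fun (n : ℕ) (x : ℕ → S × A) => x n) (s := {w}) (n := 1)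
      (ω := x) (i := n)
  rw [← not_le, key]
  simp [avoidSet]

section

variable [Fintype S] [Fintype A]

theorem sum_toReal_eq_one {ι : Type*} [Fintype ι] (q : PMF ι) : ∑ i, (q i).toReal = 1 := by
  have := q.tsum_coe
  rw [tsum_fintype] at this
  rw [← ENNReal.toReal_sum fun i _ => q.apply_ne_top i, this, ENNReal.toReal_one]

theorem sum_stepMatrix (M : RegQ S A h) (z : S × A) : ∑ z', M.stepMatrix z z' = 1 :=
  sum_toReal_eq_one _

/-- A function of the next state only is averaged by the transition law of the decision process. -/
theorem sum_stepMatrix_mul (M : RegQ S A h) (z : S × A) (f : S → ℝ) :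
    ∑ z', M.stepMatrix z z' * f z'.1 = ∑ s', (M.P z.1 z.2 s').toReal * f s' := by
  rw [Fintype.sum_prod_type]
  refine Finset.sum_congr rfl fun s' _ => ?_
  simp only [stepMatrix, Matrix.of_apply, step_apply, ENNReal.toReal_mul]
  rw [← Finset.sum_mul, ← Finset.mul_sum, sum_toReal_eq_one, mul_one]

theorem IsStationary.sum_mul_stepMatrix {M : RegQ S A h} (hd : M.IsStationary) (y : S × A) :
    ∑ z, (M.d z).toReal * M.stepMatrix z y = (M.d y).toReal := by
  have e : M.d y = ∑ z, M.d z * M.step z y := by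
    conv_lhs => rw [← show M.d.bind M.step = M.d from hd]
    rw [PMF.bind_apply, tsum_fintype]
  rw [e, ENNReal.toReal_sum fun z _ => ENNReal.mul_ne_top (PMF.apply_ne_top _ _)
    (PMF.apply_ne_top _ _)]
  simp [stepMatrix, ENNReal.toReal_mul]

theorem IsStationary.pos [DecidableEq S] [DecidableEq A] {M : RegQ S A h} (hd : M.IsStationary)
    (hirr : M.stepMatrix.IsIrreducible) (w : S × A) : 0 < (M.d w).toReal := by
  obtain ⟨z, hz⟩ : ∃ z, 0 < (M.d z).toReal := by
    by_contra! hcon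
    have h1 := sum_toReal_eq_one M.d
    have h2 : ∑ i, (M.d i).toReal ≤ 0 := Finset.sum_nonpos fun i _ => hcon i
    linarith
  obtain ⟨k, -, hk⟩ := (Matrix.isIrreducible_iff_exists_pow_pos M.stepMatrix_nonneg).1 hirr z w
  have hpow : ∀ k y, ∑ z, (M.d z).toReal * (M.stepMatrix ^ k) z y = (M.d y).toReal := by
    intro k
    induction k with
    | zero => intro y; simp [Matrix.one_apply]
    | succ k ih =>
      intro y
      simp only [pow_succ, Matrix.mul_apply, Finset.mul_sum]
      rw [Finset.sum_comm]
      simp only [← mul_assoc, ← Finset.sum_mul, ih, hd.sum_mul_stepMatrix]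
  rw [← hpow k w]
  exact Finset.sum_pos' (fun i _ => mul_nonneg ENNReal.toReal_nonneg
    (Matrix.pow_apply_nonneg M.stepMatrix_nonneg k i w)) ⟨z, Finset.mem_univ z, mul_pos hz hk⟩

end

section Law

variable [Fintype S] [Fintype A]
  [MeasurableSpace S] [MeasurableSpace A]
  [DiscreteMeasurableSpace S] [DiscreteMeasurableSpace A]

theorem lintegral_stepKernel (M : RegQ S A h) (z : S × A) (f : S × A → ℝ) (hf : ∀ y, 0 ≤ f y) :
    ∫⁻ y, ENNReal.ofReal (f y) ∂(M.stepKernel z)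
      = ENNReal.ofReal (∑ y, M.stepMatrix z y * f y) := by
  rw [lintegral_fintype, ENNReal.ofReal_sum_of_nonneg
    fun y _ => mul_nonneg (M.stepMatrix_nonneg z y) (hf y)]
  refine Finset.sum_congr rfl fun y _ => ?_
  have e : M.stepKernel z {y} = M.step z y :=
    PMF.toMeasure_apply_singleton _ _ (measurableSet_singleton y)
  rw [e, ENNReal.ofReal_mul (M.stepMatrix_nonneg z y), mul_comm]
  congr 1
  simp [stepMatrix, ENNReal.ofReal_toReal (PMF.apply_ne_top _ _)]

/-- The Markov property of the path law, for a functional of the past and the next state. -/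
theorem lintegral_chainLaw_succ (M : RegQ S A h) (z : S × A) (n : ℕ)
    (F : (Π _ : Finset.Iic n, S × A) × (S × A) → ℝ≥0∞) (hF : Measurable F) :
    ∫⁻ x, F (Preorder.frestrictLe n x, x (n + 1)) ∂(M.chainLaw z)
      = ∫⁻ x, ∫⁻ y, F (Preorder.frestrictLe n x, y) ∂(M.stepKernel (x n)) ∂(M.chainLaw z) := by
  have key := Kernel.map_frestrictLe_trajMeasure_compProd_eq_map_trajMeasure
    (X := fun _ => S × A) (μ₀ := Measure.dirac z) (κ := M.pastKernel) (a := n)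
  have e1 : ∫⁻ x, F (Preorder.frestrictLe n x, x (n + 1)) ∂(M.chainLaw z)
      = ∫⁻ u, F u ∂((M.chainLaw z).map
        (fun x : ℕ → S × A => (Preorder.frestrictLe n x, x (n + 1)))) := by
    rw [lintegral_map hF (by fun_prop)]
  rw [e1, chainLaw, ← key, Measure.lintegral_compProd hF, lintegral_map _ (by fun_prop)]
  · rfl
  · exact Measurable.lintegral_kernel_prod_right' hF

theorem lintegral_chainLaw_zero (M : RegQ S A h) (z : S × A) (f : S × A → ℝ≥0∞) :
    ∫⁻ x, f (x 0) ∂(M.chainLaw z) = f z := by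
  have hf : Measurable f := measurable_of_finite f
  have e : (M.chainLaw z).map (fun x : ℕ → S × A => x 0) = Measure.dirac z := by
    have h1 : (fun x : ℕ → S × A => x 0)
        = (fun y : (Π _ : Finset.Iic 0, S × A) => y ⟨0, Finset.mem_Iic.2 le_rfl⟩)
          ∘ Preorder.frestrictLe (π := fun _ => S × A) 0 := rfl
    rw [h1, ← Measure.map_map (by fun_prop) (by fun_prop), chainLaw, Kernel.trajMeasure,
      Measure.map_comp _ _ (by fun_prop), Kernel.traj_map_frestrictLe, Kernel.partialTraj_self,
      Measure.id_comp, Measure.map_map (by fun_prop) (by fun_prop)]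
    exact Measure.map_id
  have := lintegral_map (μ := M.chainLaw z) hf (measurable_pi_apply 0)
  rw [← this, e, lintegral_dirac' _ hf]

theorem measurableSet_avoidSet (w : S × A) (n : ℕ) : MeasurableSet (avoidSet w n) := by
  have : avoidSet w n = ⋂ j ∈ Finset.Icc 1 n, (fun x : ℕ → S × A => x j) ⁻¹' {w}ᶜ := by
    ext x; simp [avoidSet]
  rw [this]
  exact Finset.measurableSet_biInter _ fun j _ =>
    (measurable_pi_apply j) (measurableSet_singleton w).compl

variable [DecidableEq S] [DecidableEq A]

/-- `w` is avoided at the times `1, …, n` with the probability `survival`. -/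
theorem lintegral_avoidSet (M : RegQ S A h) (z w : S × A) (n : ℕ) (f : S × A → ℝ)
    (hf : ∀ y, 0 ≤ f y) :
    ∫⁻ x, (avoidSet w n).indicator (fun x => ENNReal.ofReal (f (x n))) x ∂(M.chainLaw z)
      = ENNReal.ofReal (((tabooMatrix M.stepMatrix w ^ n) *ᵥ f) z) := by
  induction n generalizing f with
  | zero =>
    have : avoidSet w 0 = Set.univ := by ext x; simp [avoidSet]
    simp only [this, Set.indicator_univ, pow_zero, Matrix.one_mulVec]
    exact M.lintegral_chainLaw_zero z fun y => ENNReal.ofReal (f y)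
  | succ n ih =>
    set Q := tabooMatrix M.stepMatrix w with hQ
    have hQ0 : ∀ y, 0 ≤ (Q *ᵥ f) y := fun y => Finset.sum_nonneg fun i _ =>
      mul_nonneg (tabooMatrix_nonneg M.stepMatrix_nonneg y i) (hf i)
    rw [pow_succ, ← Matrix.mulVec_mulVec, ← ih (Q *ᵥ f) hQ0]
    let past : Set (Π _ : Finset.Iic n, S × A) := {u | ∀ j : Finset.Iic n, 1 ≤ (j : ℕ) → u j ≠ w}
    have hpast : ∀ x : ℕ → S × A,
        Preorder.frestrictLe (π := fun _ => S × A) n x ∈ past ↔ x ∈ avoidSet w n := by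
      intro x
      constructor
      · intro hx j hj
        exact hx ⟨j, Finset.mem_Iic.2 (Finset.mem_Icc.1 hj).2⟩ (Finset.mem_Icc.1 hj).1
      · intro hx j hj
        exact hx j (Finset.mem_Icc.2 ⟨hj, Finset.mem_Iic.1 j.2⟩)
    let F : (Π _ : Finset.Iic n, S × A) × (S × A) → ℝ≥0∞ := fun u =>
      past.indicator (fun _ => ENNReal.ofReal (if u.2 = w then 0 else f u.2)) u.1
    have hF : Measurable F := measurable_of_finite F
    have e1 : ∀ x : ℕ → S × A,
        (avoidSet w (n + 1)).indicator (fun x => ENNReal.ofReal (f (x (n + 1)))) x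
          = F (Preorder.frestrictLe n x, x (n + 1)) := by
      intro x
      by_cases h1 : x ∈ avoidSet w n <;> by_cases h2 : x (n + 1) = w <;>
        simp [F, Set.indicator, hpast, mem_avoidSet_succ, h1, h2]
    simp_rw [e1]
    rw [M.lintegral_chainLaw_succ z n F hF]
    refine lintegral_congr fun x => ?_
    by_cases hx : x ∈ avoidSet w n
    · simp only [F, Set.indicator_of_mem hx, Set.indicator_of_mem ((hpast x).2 hx)]
      rw [M.lintegral_stepKernel (x n) (fun y => if y = w then 0 else f y)
        (fun y => by split_ifs; exacts [le_rfl, hf y])]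
      congr 1
      refine Finset.sum_congr rfl fun y _ => ?_
      simp only [hQ, tabooMatrix, Matrix.of_apply]
      split_ifs <;> simp
    · simp [F, Set.indicator, hx, hpast]

theorem lintegral_hitTime (M : RegQ S A h) (z w : S × A) :
    ∫⁻ x, (hitTime w x : ℝ≥0∞) ∂(M.chainLaw z)
      = ∑' n, ENNReal.ofReal (survival M.stepMatrix w n z) := by
  have e : ∀ x, (hitTime w x : ℝ≥0∞) = ∑' n, (avoidSet w n).indicator 1 x := fun x => by
    rw [ENat.toENNReal_eq_tsum_lt]
    refine tsum_congr fun n => ?_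
    by_cases hx : x ∈ avoidSet w n <;> simp [hx, lt_hitTime_iff]
  simp_rw [e]
  rw [lintegral_tsum fun n =>
    (measurable_one.indicator (measurableSet_avoidSet w n)).aemeasurable]
  refine tsum_congr fun n => ?_
  have := M.lintegral_avoidSet z w n 1 fun _ => zero_le_one
  simp only [Pi.one_apply, ENNReal.ofReal_one] at this
  exact this

/-- `tauMax` bounds the expected hitting times of `w`, written as sums of survival
probabilities. Irreducibility makes the supremum in `tauMax` finite. -/
theorem tsum_survival_le_tauMax (M : RegQ S A h) (hirr : M.stepMatrix.IsIrreducible)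
    (z w : S × A) : ∑' n, survival M.stepMatrix w n z ≤ M.tauMax w := by
  have hs := fun z => summable_survival (w := w) M.sum_stepMatrix hirr z
  have e : ∀ z, ∫⁻ x, (hitTime w x : ℝ≥0∞) ∂(M.chainLaw z)
      = ENNReal.ofReal (∑' n, survival M.stepMatrix w n z) := fun z => by
    rw [lintegral_hitTime, ENNReal.ofReal_tsum_of_nonneg
      (fun n => survival_nonneg M.stepMatrix_nonneg n z) (hs z)]
  have hfin : (⨆ z, ∫⁻ x, (hitTime w x : ℝ≥0∞) ∂(M.chainLaw z)) ≠ ⊤ := by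
    simp_rw [e]
    refine (lt_of_le_of_lt (iSup_le fun z => ?_)
      (ENNReal.sum_lt_top (s := Finset.univ)
        (f := fun z => ENNReal.ofReal (∑' n, survival M.stepMatrix w n z)).2
        fun z _ => ENNReal.ofReal_lt_top)).ne
    exact Finset.single_le_sum (f := fun z => ENNReal.ofReal (∑' n, survival M.stepMatrix w n z))
      (fun _ _ => zero_le) (Finset.mem_univ z)
  have h1 : ENNReal.ofReal (∑' n, survival M.stepMatrix w n z)
      ≤ ⨆ z, ∫⁻ x, (hitTime w x : ℝ≥0∞) ∂(M.chainLaw z) := by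
    rw [← e z]
    exact le_iSup (fun z => ∫⁻ x, (hitTime w x : ℝ≥0∞) ∂(M.chainLaw z)) z
  rw [tauMax]
  exact (ENNReal.ofReal_le_iff_le_toReal hfin).1 h1

theorem one_le_tauMax (M : RegQ S A h) (hirr : M.stepMatrix.IsIrreducible) (w : S × A) :
    1 ≤ M.tauMax w := by
  refine le_trans ?_ (M.tsum_survival_le_tauMax hirr w w)
  rw [← survival_zero (P := M.stepMatrix) (w := w) w]
  exact (summable_survival (w := w) M.sum_stepMatrix hirr w).le_tsum 0
    fun n _ => survival_nonneg M.stepMatrix_nonneg n w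

end Law

end RegQ

/-! ### Drift of the corrected energy for linear stochastic approximation -/

section Drift

/-- Data of a linear stochastic approximation recursion `x ↦ x - α (A z x + b z z')` driven by a
finite Markov chain with transition probabilities `p`, stationary law `d` and Poisson kernel `N`.
The numbers `τ`, `a`, `l`, `B` are bounds on `N`, `A`, the mean of `A`, and `b`. -/
structure LinearSA (ι E : Type*) [NormedAddCommGroup E] [InnerProductSpace ℝ E] where
  p : ι → ι → ℝ
  d : ι → ℝ
  N : ι → ι → ℝ
  A : ι → E →ₗ[ℝ] E
  b : ι → ι → E
  τ : ℝ
  a : ℝ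
  l : ℝ
  B : ℝ
  α : ℝ

namespace LinearSA

variable {ι E : Type*} [Fintype ι] [NormedAddCommGroup E] [InnerProductSpace ℝ E]

/-- The stationary mean of `A`. -/
def hess (m : LinearSA ι E) : E →ₗ[ℝ] E := ∑ z, m.d z • m.A z

/-- The conditional mean of the additive noise `b`. -/
def bias (m : LinearSA ι E) (z : ι) : E := applyKernel m.p (m.b z) z

/-- Poisson solution for the multiplicative noise `A - hess`. -/
def mulCorr (m : LinearSA ι E) (z : ι) : E →ₗ[ℝ] E := applyKernel m.N (fun y => m.A y - m.hess) z

/-- Poisson solution for the additive noise. -/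
def addCorr (m : LinearSA ι E) (z : ι) : E := applyKernel m.N m.bias z

/-- Coefficient of the second-order interaction of the multiplicative noise with `addCorr`. -/
def cross (m : LinearSA ι E) (z : ι) : E := m.A z (m.hess (applyKernel m.p m.addCorr z))

/-- The stationary mean of `cross`. -/
def crossMean (m : LinearSA ι E) : E := ∑ z, m.d z • m.cross z

/-- Poisson solution for `cross`. -/
def crossCorr (m : LinearSA ι E) (z : ι) : E :=
  applyKernel m.N (fun y => m.cross y - m.crossMean) z

/-- Upper bound for the second-order contribution of the additive noise to one step; the numerical
constants are those that `Valid.second_order_le` produces. -/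
def noise (m : LinearSA ι E) (z z' : ι) : ℝ :=
  9 / 8 * (m.l * m.τ * m.B) * ‖m.b z z'‖ + 7 / 2 * (m.l * m.τ) * ‖m.b z z'‖ ^ 2

/-- Conditional mean of `noise`. -/
def noiseAvg (m : LinearSA ι E) (z : ι) : ℝ := applyKernel m.p (m.noise z) z

/-- Stationary mean of `noise`. -/
def noiseMean (m : LinearSA ι E) : ℝ := ∑ z, m.d z • m.noiseAvg z

/-- Poisson solution for `noise`. -/
def noiseCorr (m : LinearSA ι E) (z : ι) : ℝ :=
  applyKernel m.N (fun y => m.noiseAvg y - m.noiseMean) z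

/-- The energy `½ ⟪hess x, x⟫` with a first-order corrector, which makes the Markovian noise
centred, and two second-order correctors, which replace the second-order noise terms by their
stationary means. -/
def lyap (m : LinearSA ι E) (x : E) (z : ι) : ℝ :=
  1 / 2 * ⟪m.hess x, x⟫_ℝ - m.α * ⟪m.hess x, m.mulCorr z x + m.addCorr z⟫_ℝ
    + m.α ^ 2 * ⟪x, m.crossCorr z⟫_ℝ + m.α ^ 2 * m.noiseCorr z

/-- One step of the recursion. -/
def next (m : LinearSA ι E) (x : E) (z z' : ι) : E := x - m.α • (m.A z x + m.b z z')

/-- The standing assumptions on the data of `LinearSA`. -/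
structure Valid [DecidableEq ι] (m : LinearSA ι E) : Prop where
  p_nonneg : ∀ z z', 0 ≤ m.p z z'
  p_sum : ∀ z, ∑ z', m.p z z' = 1
  d_nonneg : ∀ z, 0 ≤ m.d z
  d_sum : ∑ z, m.d z = 1
  poisson : IsPoissonKernel m.p m.d m.τ m.N
  symm : ∀ z x y, ⟪m.A z x, y⟫_ℝ = ⟪x, m.A z y⟫_ℝ
  norm_A : ∀ z x, ‖m.A z x‖ ≤ m.a * ‖x‖
  norm_A_sub : ∀ z x, ‖m.A z x - m.hess x‖ ≤ 2 * ‖x‖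
  norm_hess : ∀ x, ‖m.hess x‖ ≤ m.l * ‖x‖
  sq_norm_A : ∀ x, ∑ z, m.d z * ‖m.A z x‖ ^ 2 ≤ m.a * ⟪m.hess x, x⟫_ℝ
  norm_b : ∀ z z', ‖m.b z z'‖ ≤ m.B
  bias_mean : ∑ z, m.d z • m.bias z = 0
  one_le_τ : 1 ≤ m.τ
  one_le_a : 1 ≤ m.a
  l_pos : 0 < m.l
  B_nonneg : 0 ≤ m.B
  α_pos : 0 < m.α
  α_a : m.α * m.a ≤ 1 / 8
  α_τ_a : m.α * m.τ * m.a ≤ 1 / 16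

theorem norm_sum_smul_le {F : Type*} [SeminormedAddCommGroup F] [NormedSpace ℝ F] {q : ι → ℝ}
    {f : ι → F} {C : ℝ} (hq : ∀ y, 0 ≤ q y) (h1 : ∑ y, q y = 1) (hf : ∀ y, ‖f y‖ ≤ C) :
    ‖∑ y, q y • f y‖ ≤ C := by
  calc ‖∑ y, q y • f y‖ ≤ ∑ y, ‖q y • f y‖ := norm_sum_le _ _
    _ ≤ ∑ y, q y * C := by
        refine Finset.sum_le_sum fun y _ => ?_
        rw [norm_smul, Real.norm_of_nonneg (hq y)]
        exact mul_le_mul_of_nonneg_left (hf y) (hq y)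
    _ = C := by rw [← Finset.sum_mul, h1, one_mul]

theorem sum_smul_sub_mean {F : Type*} [AddCommGroup F] [Module ℝ F] {q : ι → ℝ}
    (h1 : ∑ y, q y = 1) (f : ι → F) : ∑ y, q y • (f y - ∑ z, q z • f z) = 0 := by
  simp only [smul_sub, Finset.sum_sub_distrib, ← Finset.sum_smul, h1, one_smul, sub_self]

theorem inner_applyKernel (p : ι → ι → ℝ) (f : ι → E) (v : E) (z : ι) :
    ⟪v, applyKernel p f z⟫_ℝ = ∑ y, p z y * ⟪v, f y⟫_ℝ := by
  simp [applyKernel, inner_sum, inner_smul_right]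

theorem mulCorr_apply (m : LinearSA ι E) (z : ι) (x : E) :
    m.mulCorr z x = applyKernel m.N (fun y => m.A y x - m.hess x) z := by
  simp [mulCorr, applyKernel]

namespace Valid

variable [DecidableEq ι] {m : LinearSA ι E}

theorem hess_symm (hm : m.Valid) (x y : E) : ⟪m.hess x, y⟫_ℝ = ⟪x, m.hess y⟫_ℝ := by
  simp [hess, sum_inner, inner_sum, inner_smul_left, inner_smul_right, hm.symm]

theorem norm_bias (hm : m.Valid) (z : ι) : ‖m.bias z‖ ≤ m.B :=
  norm_sum_smul_le (hm.p_nonneg z) (hm.p_sum z) (hm.norm_b z)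

theorem norm_mulCorr (hm : m.Valid) (z : ι) (x : E) : ‖m.mulCorr z x‖ ≤ 2 * m.τ * ‖x‖ := by
  rw [mulCorr_apply]
  have := hm.poisson.norm_applyKernel_le (h := fun y => m.A y x - m.hess x) (C := 2 * ‖x‖)
    (by positivity) (fun y => hm.norm_A_sub y x) z
  linarith

theorem norm_addCorr (hm : m.Valid) (z : ι) : ‖m.addCorr z‖ ≤ m.τ * m.B :=
  hm.poisson.norm_applyKernel_le hm.B_nonneg hm.norm_bias z

theorem norm_hess_next (hm : m.Valid) (z : ι) :
    ‖m.hess (applyKernel m.p m.addCorr z)‖ ≤ m.l * (m.τ * m.B) :=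
  (hm.norm_hess _).trans (mul_le_mul_of_nonneg_left
    (norm_sum_smul_le (hm.p_nonneg z) (hm.p_sum z) hm.norm_addCorr) hm.l_pos.le)

theorem norm_cross (hm : m.Valid) (z : ι) : ‖m.cross z‖ ≤ m.a * (m.l * (m.τ * m.B)) :=
  (hm.norm_A _ _).trans (mul_le_mul_of_nonneg_left (hm.norm_hess_next z)
    (zero_le_one.trans hm.one_le_a))

theorem norm_crossCorr (hm : m.Valid) (z : ι) :
    ‖m.crossCorr z‖ ≤ 2 * m.a * m.τ ^ 2 * m.l * m.B := by
  have h1 : ‖m.crossMean‖ ≤ m.a * (m.l * (m.τ * m.B)) :=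
    norm_sum_smul_le hm.d_nonneg hm.d_sum hm.norm_cross
  have h2 := hm.poisson.norm_applyKernel_le (h := fun y => m.cross y - m.crossMean)
    (C := 2 * (m.a * (m.l * (m.τ * m.B)))) (by linarith [norm_nonneg m.crossMean])
    (fun y => (norm_sub_le _ _).trans (by linarith [hm.norm_cross y])) z
  calc _ ≤ _ := h2
    _ = _ := by ring

theorem noise_nonneg (hm : m.Valid) (z z' : ι) : 0 ≤ m.noise z z' := by
  have := hm.l_pos; have := hm.one_le_τ; have := hm.B_nonneg
  unfold noise
  positivity

theorem noise_le (hm : m.Valid) (z z' : ι) :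
    m.noise z z' ≤ 37 / 8 * (m.l * m.τ * m.B ^ 2) := by
  have h1 := hm.l_pos; have h2 := hm.one_le_τ; have h3 := hm.B_nonneg
  have h4 := hm.norm_b z z'
  have h5 : 0 ≤ m.l * m.τ := by positivity
  calc m.noise z z' ≤ 9 / 8 * (m.l * m.τ * m.B) * m.B + 7 / 2 * (m.l * m.τ) * m.B ^ 2 := by
        unfold noise; gcongr
    _ = _ := by ring

theorem noiseAvg_nonneg (hm : m.Valid) (z : ι) : 0 ≤ m.noiseAvg z :=
  Finset.sum_nonneg fun y _ => mul_nonneg (hm.p_nonneg z y) (hm.noise_nonneg z y)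

theorem noiseAvg_le (hm : m.Valid) (z : ι) :
    m.noiseAvg z ≤ 37 / 8 * (m.l * m.τ * m.B ^ 2) := by
  refine (Real.le_norm_self _).trans (norm_sum_smul_le (hm.p_nonneg z) (hm.p_sum z) fun y => ?_)
  rw [Real.norm_of_nonneg (hm.noise_nonneg z y)]
  exact hm.noise_le z y

theorem abs_noiseCorr (hm : m.Valid) (z : ι) :
    |m.noiseCorr z| ≤ m.τ * (37 / 8 * (m.l * m.τ * m.B ^ 2)) := by
  have h0 := (hm.noiseAvg_nonneg z).trans (hm.noiseAvg_le z)
  have h1 : m.noiseMean ≤ 37 / 8 * (m.l * m.τ * m.B ^ 2) := by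
    refine (Real.le_norm_self _).trans (norm_sum_smul_le hm.d_nonneg hm.d_sum fun y => ?_)
    rw [Real.norm_of_nonneg (hm.noiseAvg_nonneg y)]
    exact hm.noiseAvg_le y
  have h2 : 0 ≤ m.noiseMean :=
    Finset.sum_nonneg fun y _ => mul_nonneg (hm.d_nonneg y) (hm.noiseAvg_nonneg y)
  rw [← Real.norm_eq_abs]
  refine hm.poisson.norm_applyKernel_le h0 (fun y => ?_) z
  have h3 := hm.noiseAvg_le y
  have h4 := hm.noiseAvg_nonneg y
  rw [Real.norm_eq_abs, abs_le]
  constructor <;> linarith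

/-- The correctors perturb the energy only by terms of first order in the step size. -/
theorem abs_lyap_sub_le (hm : m.Valid) (x : E) (z : ι) :
    |m.lyap x z - 1 / 2 * ⟪m.hess x, x⟫_ℝ| ≤ 2 * m.α * m.l * m.τ * ‖x‖ ^ 2
      + 9 / 8 * (m.α * m.l * m.τ * m.B * ‖x‖)
      + m.α ^ 2 * (37 / 8 * (m.l * m.τ ^ 2 * m.B ^ 2)) := by
  have hl := hm.l_pos; have hτ := hm.one_le_τ; have hB := hm.B_nonneg; have hα := hm.α_pos
  have h1 : |⟪m.hess x, m.mulCorr z x⟫_ℝ| ≤ (m.l * ‖x‖) * (2 * m.τ * ‖x‖) :=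
    (abs_real_inner_le_norm _ _).trans (mul_le_mul (hm.norm_hess x) (hm.norm_mulCorr z x)
      (norm_nonneg _) (by positivity))
  have h2 : |⟪m.hess x, m.addCorr z⟫_ℝ| ≤ (m.l * ‖x‖) * (m.τ * m.B) :=
    (abs_real_inner_le_norm _ _).trans (mul_le_mul (hm.norm_hess x) (hm.norm_addCorr z)
      (norm_nonneg _) (by positivity))
  have h3 : |⟪x, m.crossCorr z⟫_ℝ| ≤ ‖x‖ * (2 * m.a * m.τ ^ 2 * m.l * m.B) :=
    (abs_real_inner_le_norm _ _).trans (mul_le_mul_of_nonneg_left (hm.norm_crossCorr z)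
      (norm_nonneg _))
  have h4 := hm.abs_noiseCorr z
  have h5 : m.α ^ 2 * (‖x‖ * (2 * m.a * m.τ ^ 2 * m.l * m.B))
      ≤ 1 / 8 * (m.α * m.l * m.τ * m.B * ‖x‖) := by
    have : m.α ^ 2 * (‖x‖ * (2 * m.a * m.τ ^ 2 * m.l * m.B))
        = 2 * (m.α * m.τ * m.a) * (m.α * m.l * m.τ * m.B * ‖x‖) := by ring
    rw [this]
    refine mul_le_mul_of_nonneg_right ?_ (by positivity)
    linarith [hm.α_τ_a]
  have e : m.lyap x z - 1 / 2 * ⟪m.hess x, x⟫_ℝ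
      = -(m.α * ⟪m.hess x, m.mulCorr z x⟫_ℝ) - m.α * ⟪m.hess x, m.addCorr z⟫_ℝ
        + m.α ^ 2 * ⟪x, m.crossCorr z⟫_ℝ + m.α ^ 2 * m.noiseCorr z := by
    rw [lyap, inner_add_right]; ring
  have hα2 : 0 ≤ m.α ^ 2 := by positivity
  have k1 := mul_le_mul_of_nonneg_left h1 hα.le
  have k2 := mul_le_mul_of_nonneg_left h2 hα.le
  have k3 := mul_le_mul_of_nonneg_left h3 hα2
  have k4 := mul_le_mul_of_nonneg_left h4 hα2
  rw [← abs_of_pos hα, ← abs_mul, abs_of_pos hα] at k1 k2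
  rw [← abs_of_nonneg hα2, ← abs_mul, abs_of_nonneg hα2] at k3 k4
  rw [e, abs_le]
  obtain ⟨k11, k12⟩ := abs_le.1 k1
  obtain ⟨k21, k22⟩ := abs_le.1 k2
  obtain ⟨k31, k32⟩ := abs_le.1 k3
  obtain ⟨k41, k42⟩ := abs_le.1 k4
  constructor <;> linarith

/-- The second-order terms of one step other than `⟪hess (A z x), addCorr z'⟫`, which
`crossCorr` replaces by its stationary mean. Products of `x` with the additive noise are split by
Young's inequality, so that the noise enters through `noise` alone, apart from a term carrying an
extra factor `α`. -/
theorem second_order_le (hm : m.Valid) (x : E) (z z' : ι) :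
    1 / 2 * ⟪m.hess (m.A z x + m.b z z'), m.A z x + m.b z z'⟫_ℝ
      + ⟪m.hess x, m.mulCorr z' (m.A z x + m.b z z')⟫_ℝ
      + ⟪m.hess (m.A z x + m.b z z'), m.mulCorr z' (m.next x z z')⟫_ℝ
      + ⟪m.hess (m.b z z'), m.addCorr z'⟫_ℝ
      - m.α * ⟪m.A z x + m.b z z', m.crossCorr z'⟫_ℝ
    ≤ 15 / 2 * (m.l * m.τ * m.a ^ 2 * ‖x‖ ^ 2)
      + 2 * m.α * m.a ^ 2 * m.τ ^ 2 * m.l * m.B * ‖x‖ + m.noise z z' := by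
  have hl := hm.l_pos; have hτ := hm.one_le_τ; have hB := hm.B_nonneg; have hα := hm.α_pos
  have ha := hm.one_le_a
  set g := m.A z x + m.b z z' with hg
  set X := ‖x‖ with hX
  set β := ‖m.b z z'‖ with hβ
  have hX0 : 0 ≤ X := norm_nonneg _
  have hβ0 : 0 ≤ β := norm_nonneg _
  have hgn : ‖g‖ ≤ m.a * X + β := (norm_add_le _ _).trans (by linarith [hm.norm_A z x])
  have hα8 : m.α ≤ 1 / 8 := (le_mul_of_one_le_right hα.le ha).trans hm.α_a
  have hxn : ‖m.next x z z'‖ ≤ 9 / 8 * X + m.α * β := by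
    have h1 : ‖m.next x z z'‖ ≤ X + m.α * (m.a * X + β) := by
      refine (norm_sub_le _ _).trans ?_
      rw [norm_smul, Real.norm_of_nonneg hα.le]
      gcongr
    have h2 := mul_le_mul_of_nonneg_right hm.α_a hX0
    linarith
  have hlt : 0 ≤ m.l * m.τ := by positivity
  have t1 : ⟪m.hess g, g⟫_ℝ ≤ m.l * (m.a * X + β) ^ 2 := by
    calc ⟪m.hess g, g⟫_ℝ ≤ ‖m.hess g‖ * ‖g‖ := real_inner_le_norm _ _
      _ ≤ (m.l * (m.a * X + β)) * (m.a * X + β) := by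
          refine mul_le_mul ((hm.norm_hess g).trans ?_) hgn (norm_nonneg _) (by positivity)
          gcongr
      _ = _ := by ring
  have t2 : ⟪m.hess x, m.mulCorr z' g⟫_ℝ ≤ (m.l * X) * (2 * m.τ * (m.a * X + β)) := by
    refine (real_inner_le_norm _ _).trans (mul_le_mul (hm.norm_hess x)
      ((hm.norm_mulCorr z' g).trans ?_) (norm_nonneg _) (by positivity))
    gcongr
  have t3 : ⟪m.hess g, m.mulCorr z' (m.next x z z')⟫_ℝ
      ≤ (m.l * (m.a * X + β)) * (2 * m.τ * (9 / 8 * X + m.α * β)) := by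
    refine (real_inner_le_norm _ _).trans (mul_le_mul ((hm.norm_hess g).trans ?_)
      ((hm.norm_mulCorr z' _).trans ?_) (norm_nonneg _) (by positivity))
    · gcongr
    · gcongr
  have t4 : ⟪m.hess (m.b z z'), m.addCorr z'⟫_ℝ ≤ (m.l * β) * (m.τ * m.B) :=
    (real_inner_le_norm _ _).trans (mul_le_mul (hm.norm_hess _) (hm.norm_addCorr z')
      (norm_nonneg _) (by positivity))
  have t5 : -(m.α * ⟪g, m.crossCorr z'⟫_ℝ)
      ≤ m.α * ((m.a * X + β) * (2 * m.a * m.τ ^ 2 * m.l * m.B)) := by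
    rw [← mul_neg]
    refine mul_le_mul_of_nonneg_left ?_ hα.le
    refine (neg_le_abs _).trans ((abs_real_inner_le_norm _ _).trans ?_)
    exact mul_le_mul hgn (hm.norm_crossCorr z') (norm_nonneg _) (by positivity)
  have t6 : m.α * (β * (2 * m.a * m.τ ^ 2 * m.l * m.B)) ≤ 1 / 8 * (m.l * m.τ * m.B) * β := by
    have : m.α * (β * (2 * m.a * m.τ ^ 2 * m.l * m.B))
        = 2 * (m.α * m.τ * m.a) * ((m.l * m.τ * m.B) * β) := by ring
    rw [this, mul_assoc (1 / 8 : ℝ)]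
    refine mul_le_mul_of_nonneg_right ?_ (by positivity)
    linarith [hm.α_τ_a]
  have q : 1 / 2 * (m.l * (m.a * X + β) ^ 2) + (m.l * X) * (2 * m.τ * (m.a * X + β))
      + (m.l * (m.a * X + β)) * (2 * m.τ * (9 / 8 * X + m.α * β))
      ≤ (m.l * m.τ) * (15 / 2 * (m.a ^ 2 * X ^ 2) + 7 / 2 * β ^ 2) := by
    have e1 : 1 / 2 * (m.l * (m.a * X + β) ^ 2)
        ≤ (m.l * m.τ) * (1 / 2 * (m.a * X + β) ^ 2) := by
      have : m.l * (1 / 2 * (m.a * X + β) ^ 2) * 1 ≤ m.l * (1 / 2 * (m.a * X + β) ^ 2) * m.τ :=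
        mul_le_mul_of_nonneg_left hτ (by positivity)
      linarith
    have e2 : 1 / 2 * (m.a * X + β) ^ 2 + 2 * X * (m.a * X + β)
        + 2 * (m.a * X + β) * (9 / 8 * X + m.α * β)
        ≤ 15 / 2 * (m.a ^ 2 * X ^ 2) + 7 / 2 * β ^ 2 := by
      have hXa : X ≤ m.a * X := le_mul_of_one_le_left hX0 ha
      set u := m.a * X with hu
      have hu0 : 0 ≤ u := hX0.trans hXa
      have f1 : m.α * β ≤ 1 / 8 * β := by gcongr
      have f2 : 2 * X * (u + β) ≤ 2 * u * (u + β) := by gcongr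
      have f3 : 2 * (u + β) * (9 / 8 * X + m.α * β) ≤ 2 * (u + β) * (9 / 8 * u + 1 / 8 * β) := by
        gcongr
      have f4 : m.a ^ 2 * X ^ 2 = u ^ 2 := by rw [hu]; ring
      rw [f4]
      nlinarith [sq_nonneg (u - β), sq_nonneg u, sq_nonneg β]
    have e3 := mul_le_mul_of_nonneg_left e2 hlt
    linarith
  unfold noise
  rw [← hβ]
  linarith

/-- By the Cauchy-Schwarz inequality under `d`, the stationary mean of the cross term costs only
the square root of the energy. -/
theorem inner_crossMean_le (hm : m.Valid) (x : E) :
    ⟪x, m.crossMean⟫_ℝ ≤ m.l * m.τ * m.B * √(m.a * ⟪m.hess x, x⟫_ℝ) := by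
  have hl := hm.l_pos; have hτ := hm.one_le_τ; have hB := hm.B_nonneg
  have h1 : ⟪x, m.crossMean⟫_ℝ
      = ∑ z, m.d z * ⟪m.A z x, m.hess (applyKernel m.p m.addCorr z)⟫_ℝ := by
    simp only [crossMean, inner_sum, inner_smul_right, cross, hm.symm]
  have h2 : ⟪x, m.crossMean⟫_ℝ ≤ (∑ z, m.d z * ‖m.A z x‖) * (m.l * (m.τ * m.B)) := by
    rw [h1, Finset.sum_mul]
    refine Finset.sum_le_sum fun z _ => ?_
    rw [mul_assoc]
    refine mul_le_mul_of_nonneg_left ((real_inner_le_norm _ _).trans ?_) (hm.d_nonneg z)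
    exact mul_le_mul_of_nonneg_left (hm.norm_hess_next z) (norm_nonneg _)
  have h3 : ∑ z, m.d z * ‖m.A z x‖ ≤ √(m.a * ⟪m.hess x, x⟫_ℝ) := by
    refine Real.le_sqrt_of_sq_le (le_trans ?_ (hm.sq_norm_A x))
    have cs := Finset.sum_sq_le_sum_mul_sum_of_sq_le_mul Finset.univ
      (r := fun z => m.d z * ‖m.A z x‖) (f := m.d) (g := fun z => m.d z * ‖m.A z x‖ ^ 2)
      (fun z _ => hm.d_nonneg z) (fun z _ => mul_nonneg (hm.d_nonneg z) (sq_nonneg _))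
      (fun z _ => le_of_eq (by ring))
    rwa [hm.d_sum, one_mul] at cs
  calc _ ≤ _ := h2
    _ ≤ √(m.a * ⟪m.hess x, x⟫_ℝ) * (m.l * (m.τ * m.B)) :=
        mul_le_mul_of_nonneg_right h3 (by positivity)
    _ = _ := by ring

/-- The one-step drift of the corrected energy: pure descent `-α ‖hess x‖ ^ 2` up to second-order
terms, in which the additive noise appears only through its stationary mean `noiseMean`. -/
theorem sum_lyap_next_le (hm : m.Valid) (x : E) (z : ι) :
    ∑ z', m.p z z' * m.lyap (m.next x z z') z' ≤ m.lyap x z - m.α * ‖m.hess x‖ ^ 2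
      + m.α ^ 2 * (15 / 2 * (m.l * m.τ * m.a ^ 2 * ‖x‖ ^ 2)
        + 2 * m.α * m.a ^ 2 * m.τ ^ 2 * m.l * m.B * ‖x‖
        + m.l * m.τ * m.B * √(m.a * ⟪m.hess x, x⟫_ℝ) + m.noiseMean) := by
  set C : ℝ := 15 / 2 * (m.l * m.τ * m.a ^ 2 * ‖x‖ ^ 2)
        + 2 * m.α * m.a ^ 2 * m.τ ^ 2 * m.l * m.B * ‖x‖ with hC
  have hα2 : 0 ≤ m.α ^ 2 := sq_nonneg _
  have hpt : ∀ z', m.lyap (m.next x z z') z' ≤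
      (1 / 2 * ⟪m.hess x, x⟫_ℝ - m.α * ⟪m.hess x, m.A z x⟫_ℝ + m.α ^ 2 * C)
      - m.α * ⟪m.hess x, m.b z z'⟫_ℝ - m.α * ⟪m.hess x, m.mulCorr z' x⟫_ℝ
      - m.α * ⟪m.hess x, m.addCorr z'⟫_ℝ + m.α ^ 2 * ⟪m.hess (m.A z x), m.addCorr z'⟫_ℝ
      + m.α ^ 2 * ⟪x, m.crossCorr z'⟫_ℝ + m.α ^ 2 * m.noiseCorr z' + m.α ^ 2 * m.noise z z' := by
    intro z'
    have h1 := mul_le_mul_of_nonneg_left (hm.second_order_le x z z') hα2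
    rw [← hC] at h1
    have hs : ⟪m.hess (m.A z x + m.b z z'), x⟫_ℝ = ⟪m.hess x, m.A z x + m.b z z'⟫_ℝ := by
      rw [hm.hess_symm, real_inner_comm]
    have e : m.lyap (m.next x z z') z' =
        (1 / 2 * ⟪m.hess x, x⟫_ℝ - m.α * ⟪m.hess x, m.A z x⟫_ℝ)
        - m.α * ⟪m.hess x, m.b z z'⟫_ℝ - m.α * ⟪m.hess x, m.mulCorr z' x⟫_ℝ
        - m.α * ⟪m.hess x, m.addCorr z'⟫_ℝ + m.α ^ 2 * ⟪m.hess (m.A z x), m.addCorr z'⟫_ℝ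
        + m.α ^ 2 * ⟪x, m.crossCorr z'⟫_ℝ + m.α ^ 2 * m.noiseCorr z'
        + m.α ^ 2 * (1 / 2 * ⟪m.hess (m.A z x + m.b z z'), m.A z x + m.b z z'⟫_ℝ
          + ⟪m.hess x, m.mulCorr z' (m.A z x + m.b z z')⟫_ℝ
          + ⟪m.hess (m.A z x + m.b z z'), m.mulCorr z' (m.next x z z')⟫_ℝ
          + ⟪m.hess (m.b z z'), m.addCorr z'⟫_ℝ
          - m.α * ⟪m.A z x + m.b z z', m.crossCorr z'⟫_ℝ) := by
      have e0 : ⟪m.hess x, m.A z x + m.b z z'⟫_ℝ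
          = ⟪m.hess x, m.A z x⟫_ℝ + ⟪m.hess x, m.b z z'⟫_ℝ := inner_add_right _ _ _
      have e1 : ⟪m.hess (m.A z x + m.b z z'), m.addCorr z'⟫_ℝ
          = ⟪m.hess (m.A z x), m.addCorr z'⟫_ℝ + ⟪m.hess (m.b z z'), m.addCorr z'⟫_ℝ := by
        rw [map_add, inner_add_left]
      rw [lyap]
      generalize hgdef : m.A z x + m.b z z' = g at *
      have en : m.next x z z' = x - m.α • g := by rw [next, hgdef]
      have e2 : ⟪m.hess (m.next x z z'), m.next x z z'⟫_ℝ
          = ⟪m.hess x, x⟫_ℝ - 2 * m.α * ⟪m.hess x, g⟫_ℝ + m.α ^ 2 * ⟪m.hess g, g⟫_ℝ := by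
        rw [en]
        simp only [map_sub, map_smul, inner_sub_left, inner_sub_right, inner_smul_left,
          inner_smul_right, hs, RCLike.conj_to_real]
        ring
      have e3 : ⟪m.hess (m.next x z z'), m.mulCorr z' (m.next x z z')⟫_ℝ
          = ⟪m.hess x, m.mulCorr z' x⟫_ℝ - m.α * ⟪m.hess x, m.mulCorr z' g⟫_ℝ
            - m.α * ⟪m.hess g, m.mulCorr z' (m.next x z z')⟫_ℝ := by
        rw [en]
        simp only [map_sub, map_smul, inner_sub_left, inner_sub_right, inner_smul_left,
          inner_smul_right, RCLike.conj_to_real]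
        ring
      have e4 : ⟪m.hess (m.next x z z'), m.addCorr z'⟫_ℝ
          = ⟪m.hess x, m.addCorr z'⟫_ℝ - m.α * ⟪m.hess g, m.addCorr z'⟫_ℝ := by
        rw [en]
        simp only [map_sub, map_smul, inner_sub_left, inner_smul_left, RCLike.conj_to_real]
      have e5 : ⟪m.next x z z', m.crossCorr z'⟫_ℝ
          = ⟪x, m.crossCorr z'⟫_ℝ - m.α * ⟪g, m.crossCorr z'⟫_ℝ := by
        rw [en]
        simp only [inner_sub_left, inner_smul_left, RCLike.conj_to_real]
      rw [inner_add_right, e2, e3, e4, e5, e0, e1]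
      ring
    rw [e]
    linarith
  have havg : ∑ z', m.p z z' * m.lyap (m.next x z z') z' ≤
      (1 / 2 * ⟪m.hess x, x⟫_ℝ - m.α * ⟪m.hess x, m.A z x⟫_ℝ + m.α ^ 2 * C)
      - m.α * ⟪m.hess x, m.bias z⟫_ℝ
      - m.α * ⟪m.hess x, applyKernel m.p (fun y => m.mulCorr y x) z⟫_ℝ
      - m.α * ⟪m.hess x, applyKernel m.p m.addCorr z⟫_ℝ
      + m.α ^ 2 * ⟪m.hess (m.A z x), applyKernel m.p m.addCorr z⟫_ℝ
      + m.α ^ 2 * ⟪x, applyKernel m.p m.crossCorr z⟫_ℝ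
      + m.α ^ 2 * applyKernel m.p m.noiseCorr z + m.α ^ 2 * m.noiseAvg z := by
    refine (Finset.sum_le_sum fun z' _ =>
      mul_le_mul_of_nonneg_left (hpt z') (hm.p_nonneg z z')).trans (le_of_eq ?_)
    simp only [bias, inner_applyKernel, noiseAvg]
    simp only [applyKernel, smul_eq_mul, mul_add, mul_sub, Finset.sum_add_distrib,
      Finset.sum_sub_distrib, Finset.mul_sum, ← Finset.sum_mul, hm.p_sum, one_mul]
    simp only [mul_left_comm (m.p z _)]
  -- The Poisson equations trade each averaged corrector for the corrector at the present state.
  have p1 : m.mulCorr z x = (m.A z x - m.hess x)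
      + applyKernel m.p (fun y => m.mulCorr y x) z := by
    have h0 : ∑ y, m.d y • (m.A y x - m.hess x) = 0 := by
      have := sum_smul_sub_mean hm.d_sum (fun y => m.A y x)
      simpa [hess] using this
    simp only [mulCorr_apply]
    exact hm.poisson.applyKernel_eq h0 z
  have p2 : m.addCorr z = m.bias z + applyKernel m.p m.addCorr z :=
    hm.poisson.applyKernel_eq hm.bias_mean z
  have p3 : m.crossCorr z = (m.cross z - m.crossMean) + applyKernel m.p m.crossCorr z :=
    hm.poisson.applyKernel_eq (sum_smul_sub_mean hm.d_sum m.cross) z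
  have p4 : m.noiseCorr z = (m.noiseAvg z - m.noiseMean) + applyKernel m.p m.noiseCorr z :=
    hm.poisson.applyKernel_eq (sum_smul_sub_mean hm.d_sum m.noiseAvg) z
  have p5 : ⟪m.hess (m.A z x), applyKernel m.p m.addCorr z⟫_ℝ = ⟪x, m.cross z⟫_ℝ := by
    rw [hm.hess_symm, hm.symm, cross]
  have p6 := mul_le_mul_of_nonneg_left (hm.inner_crossMean_le x) hα2
  have e : m.lyap x z = 1 / 2 * ⟪m.hess x, x⟫_ℝ
      - m.α * (⟪m.hess x, m.A z x⟫_ℝ - ‖m.hess x‖ ^ 2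
        + ⟪m.hess x, applyKernel m.p (fun y => m.mulCorr y x) z⟫_ℝ
        + ⟪m.hess x, m.bias z⟫_ℝ + ⟪m.hess x, applyKernel m.p m.addCorr z⟫_ℝ)
      + m.α ^ 2 * (⟪x, m.cross z⟫_ℝ - ⟪x, m.crossMean⟫_ℝ + ⟪x, applyKernel m.p m.crossCorr z⟫_ℝ)
      + m.α ^ 2 * (m.noiseAvg z - m.noiseMean + applyKernel m.p m.noiseCorr z) := by
    rw [lyap, p1, p2, p3, p4]
    simp only [inner_add_right, inner_sub_right, real_inner_self_eq_norm_sq]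
    ring
  rw [p5] at havg
  rw [e]
  linarith

end Valid

end LinearSA

end Drift

/-! ### The Hessian of the inner loss -/

namespace RegQ

variable {S A : Type*} {h : ℕ}

theorem val_apply (M : RegQ S A h) (θ : EuclideanSpace ℝ (Fin h)) (z : S × A) :
    M.val θ z = ⟪M.feat z, θ⟫_ℝ := by
  simp [val, feat, Matrix.mulVec, dotProduct, PiLp.inner_apply, mul_comm]

theorem val_sub (M : RegQ S A h) (θ θ' : EuclideanSpace ℝ (Fin h)) :
    M.val (θ - θ') = M.val θ - M.val θ' := by
  ext z; simp [val_apply, inner_sub_right]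

/-- The Hessian of the squared temporal-difference error at one sample, with regularization. -/
def sampleHess (M : RegQ S A h) (z : S × A) :
    EuclideanSpace ℝ (Fin h) →ₗ[ℝ] EuclideanSpace ℝ (Fin h) where
  toFun x := ⟪M.feat z, x⟫_ℝ • M.feat z + M.η • x
  map_add' x y := by rw [inner_add_right, add_smul, smul_add]; abel
  map_smul' c x := by
    rw [inner_smul_right, smul_add, mul_smul, smul_comm M.η c x]; rfl

theorem sampleHess_apply (M : RegQ S A h) (z : S × A) (x : EuclideanSpace ℝ (Fin h)) :
    M.sampleHess z x = ⟪M.feat z, x⟫_ℝ • M.feat z + M.η • x := rfl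

theorem sampleHess_symm (M : RegQ S A h) (z : S × A) (x y : EuclideanSpace ℝ (Fin h)) :
    ⟪M.sampleHess z x, y⟫_ℝ = ⟪x, M.sampleHess z y⟫_ℝ := by
  simp only [sampleHess_apply, inner_add_left, inner_add_right, inner_smul_left, inner_smul_right,
    RCLike.conj_to_real, real_inner_comm x (M.feat z)]
  ring

theorem inner_sampleHess_self (M : RegQ S A h) (z : S × A) (x : EuclideanSpace ℝ (Fin h)) :
    ⟪M.sampleHess z x, x⟫_ℝ = ⟪M.feat z, x⟫_ℝ ^ 2 + M.η * ‖x‖ ^ 2 := by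
  simp only [sampleHess_apply, inner_add_left, inner_smul_left, RCLike.conj_to_real,
    real_inner_self_eq_norm_sq]
  ring

theorem abs_inner_feat_le (M : RegQ S A h) (hΦ : ∀ z, ‖M.feat z‖ ≤ 1) (z : S × A)
    (x : EuclideanSpace ℝ (Fin h)) : |⟪M.feat z, x⟫_ℝ| ≤ ‖x‖ :=
  (abs_real_inner_le_norm _ _).trans (mul_le_of_le_one_left (norm_nonneg _) (hΦ z))

theorem inner_feat_sq_le (M : RegQ S A h) (hΦ : ∀ z, ‖M.feat z‖ ≤ 1) (z : S × A)
    (x : EuclideanSpace ℝ (Fin h)) : ⟪M.feat z, x⟫_ℝ ^ 2 ≤ ‖x‖ ^ 2 :=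
  sq_le_sq' (abs_le.1 (M.abs_inner_feat_le hΦ z x)).1 (abs_le.1 (M.abs_inner_feat_le hΦ z x)).2

theorem norm_smul_feat_le (M : RegQ S A h) (hΦ : ∀ z, ‖M.feat z‖ ≤ 1) (z : S × A) (c : ℝ) :
    ‖c • M.feat z‖ ≤ |c| := by
  rw [norm_smul, Real.norm_eq_abs]
  exact mul_le_of_le_one_right (abs_nonneg _) (hΦ z)

theorem norm_sampleHess_le (M : RegQ S A h) (hη : 0 < M.η) (hΦ : ∀ z, ‖M.feat z‖ ≤ 1)
    (z : S × A) (x : EuclideanSpace ℝ (Fin h)) : ‖M.sampleHess z x‖ ≤ (1 + M.η) * ‖x‖ := by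
  rw [sampleHess_apply, add_mul, one_mul]
  refine (norm_add_le _ _).trans (add_le_add ((M.norm_smul_feat_le hΦ z _).trans
    (M.abs_inner_feat_le hΦ z x)) ?_)
  rw [norm_smul, Real.norm_of_nonneg hη.le]

theorem norm_sampleHess_sq_le (M : RegQ S A h) (hη : 0 < M.η) (hΦ : ∀ z, ‖M.feat z‖ ≤ 1)
    (z : S × A) (x : EuclideanSpace ℝ (Fin h)) :
    ‖M.sampleHess z x‖ ^ 2 ≤ (1 + M.η) * ⟪M.sampleHess z x, x⟫_ℝ := by
  rw [inner_sampleHess_self, sampleHess_apply, norm_add_sq_real, norm_smul, norm_smul,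
    inner_smul_left, inner_smul_right, mul_pow, mul_pow, Real.norm_eq_abs, sq_abs, Real.norm_eq_abs,
    sq_abs, RCLike.conj_to_real]
  have h1 := M.inner_feat_sq_le hΦ z x
  have h2 : ‖M.feat z‖ ^ 2 ≤ 1 := pow_le_one₀ (norm_nonneg _) (hΦ z)
  have h3 := mul_le_mul_of_nonneg_left h2 (sq_nonneg ⟪M.feat z, x⟫_ℝ)
  have h4 := mul_le_mul_of_nonneg_left h1 hη.le
  linarith

section Mean

variable [Fintype S] [Fintype A]

theorem norm_val_le (M : RegQ S A h) (hΦ : ∀ z, ‖M.feat z‖ ≤ 1)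
    (θ : EuclideanSpace ℝ (Fin h)) : ‖M.val θ‖ ≤ ‖θ‖ :=
  (pi_norm_le_iff_of_nonneg (norm_nonneg _)).2 fun z => by
    rw [val_apply]; exact M.abs_inner_feat_le hΦ z θ

/-- The operator `Φᵀ D Φ + η I`, the stationary mean of `sampleHess`. -/
def meanHess (M : RegQ S A h) : EuclideanSpace ℝ (Fin h) →ₗ[ℝ] EuclideanSpace ℝ (Fin h) :=
  ∑ z, (M.d z).toReal • M.sampleHess z

theorem sum_d (M : RegQ S A h) : ∑ z, (M.d z).toReal = 1 := sum_toReal_eq_one _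

theorem meanHess_apply (M : RegQ S A h) (x : EuclideanSpace ℝ (Fin h)) :
    M.meanHess x = ∑ z, (M.d z).toReal • M.sampleHess z x := by
  simp [meanHess]

theorem meanHess_apply' (M : RegQ S A h) (x : EuclideanSpace ℝ (Fin h)) :
    M.meanHess x = ∑ z, (M.d z).toReal • ⟪M.feat z, x⟫_ℝ • M.feat z + M.η • x := by
  simp only [meanHess_apply, sampleHess_apply, smul_add, Finset.sum_add_distrib, ← Finset.sum_smul,
    sum_d, one_smul]

theorem meanHess_symm (M : RegQ S A h) (x y : EuclideanSpace ℝ (Fin h)) :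
    ⟪M.meanHess x, y⟫_ℝ = ⟪x, M.meanHess y⟫_ℝ := by
  simp only [meanHess_apply, sum_inner, inner_sum, inner_smul_left, inner_smul_right,
    sampleHess_symm, RCLike.conj_to_real]

theorem inner_meanHess_self (M : RegQ S A h) (x : EuclideanSpace ℝ (Fin h)) :
    ⟪M.meanHess x, x⟫_ℝ = ∑ z, (M.d z).toReal * ⟪M.feat z, x⟫_ℝ ^ 2 + M.η * ‖x‖ ^ 2 := by
  simp only [meanHess_apply, sum_inner, inner_smul_left, RCLike.conj_to_real,
    inner_sampleHess_self, mul_add, Finset.sum_add_distrib, ← Finset.sum_mul, sum_d, one_mul]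

theorem norm_sampleHess_sub_le (M : RegQ S A h) (hΦ : ∀ z, ‖M.feat z‖ ≤ 1) (z : S × A)
    (x : EuclideanSpace ℝ (Fin h)) : ‖M.sampleHess z x - M.meanHess x‖ ≤ 2 * ‖x‖ := by
  have e : ∀ z, ‖⟪M.feat z, x⟫_ℝ • M.feat z‖ ≤ ‖x‖ := fun z =>
    (M.norm_smul_feat_le hΦ z _).trans (M.abs_inner_feat_le hΦ z x)
  rw [sampleHess_apply, meanHess_apply', add_sub_add_right_eq_sub, two_mul]
  exact (norm_sub_le _ _).trans (add_le_add (e z)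
    (LinearSA.norm_sum_smul_le (fun _ => ENNReal.toReal_nonneg) M.sum_d e))

theorem sum_norm_sampleHess_sq_le (M : RegQ S A h) (hη : 0 < M.η) (hΦ : ∀ z, ‖M.feat z‖ ≤ 1)
    (x : EuclideanSpace ℝ (Fin h)) :
    ∑ z, (M.d z).toReal * ‖M.sampleHess z x‖ ^ 2 ≤ (1 + M.η) * ⟪M.meanHess x, x⟫_ℝ := by
  simp only [meanHess_apply, sum_inner, inner_smul_left, RCLike.conj_to_real, Finset.mul_sum]
  refine Finset.sum_le_sum fun z _ => ?_
  rw [mul_left_comm]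
  exact mul_le_mul_of_nonneg_left (M.norm_sampleHess_sq_le hη hΦ z x) ENNReal.toReal_nonneg

/-- The first stationary moment of a nonnegative function on transitions is controlled by the
second one. -/
theorem sum_sum_mul_sq_le (M : RegQ S A h) (f : S × A → S × A → ℝ) :
    (∑ z, (M.d z).toReal * ∑ z', M.stepMatrix z z' * f z z') ^ 2
      ≤ ∑ z, (M.d z).toReal * ∑ z', M.stepMatrix z z' * f z z' ^ 2 := by
  have cs := Finset.sum_sq_le_sum_mul_sum_of_sq_le_mul (Finset.univ ×ˢ Finset.univ)
    (r := fun y : (S × A) × (S × A) => (M.d y.1).toReal * (M.stepMatrix y.1 y.2 * f y.1 y.2))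
    (f := fun y => (M.d y.1).toReal * M.stepMatrix y.1 y.2)
    (g := fun y => (M.d y.1).toReal * (M.stepMatrix y.1 y.2 * f y.1 y.2 ^ 2))
    (fun y _ => mul_nonneg ENNReal.toReal_nonneg (M.stepMatrix_nonneg _ _))
    (fun y _ => mul_nonneg ENNReal.toReal_nonneg
      (mul_nonneg (M.stepMatrix_nonneg _ _) (sq_nonneg _)))
    (fun y _ => le_of_eq (by ring))
  simp only [Finset.sum_product, ← Finset.mul_sum, sum_stepMatrix, mul_one, sum_d, one_mul] at cs
  exact cs

end Mean

section Spectral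

variable [Fintype S] [Fintype A] [DecidableEq S] [DecidableEq A]

theorem toLp_transpose_mulVec_weight (M : RegQ S A h) (q : S × A → ℝ) :
    (WithLp.toLp 2 (M.Φᵀ *ᵥ (M.weight *ᵥ q)) : EuclideanSpace ℝ (Fin h))
      = ∑ z, (M.d z).toReal • q z • M.feat z := by
  ext i
  simp only [weight, Matrix.mulVec, dotProduct, Matrix.diagonal_apply, ite_mul, zero_mul,
    Finset.sum_ite_eq, Finset.mem_univ, if_true, Matrix.transpose_apply, WithLp.ofLp_sum,
    Finset.sum_apply, feat, PiLp.smul_apply, smul_eq_mul]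
  exact Finset.sum_congr rfl fun z _ => by ring

theorem meanHess_eq (M : RegQ S A h) (x : EuclideanSpace ℝ (Fin h)) :
    M.meanHess x = WithLp.toLp 2 ((M.gram + M.η • (1 : Matrix (Fin h) (Fin h) ℝ)) *ᵥ x.ofLp) := by
  rw [Matrix.add_mulVec, Matrix.smul_mulVec, Matrix.one_mulVec, meanHess_apply', WithLp.toLp_add,
    WithLp.toLp_smul]
  congr 1
  rw [gram, ← Matrix.mulVec_mulVec, ← Matrix.mulVec_mulVec, toLp_transpose_mulVec_weight]
  simp only [← val_apply]
  rfl

theorem meanHess_eigenvectorBasis (M : RegQ S A h) (j : Fin h) :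
    M.meanHess (M.gram_isHermitian.eigenvectorBasis j)
      = (M.gram_isHermitian.eigenvalues j + M.η) • M.gram_isHermitian.eigenvectorBasis j := by
  rw [meanHess_eq, Matrix.add_mulVec, M.gram_isHermitian.mulVec_eigenvectorBasis,
    Matrix.smul_mulVec, Matrix.one_mulVec, add_smul]
  rfl

theorem eigenvalues_mem_Icc (M : RegQ S A h) (hΦ : ∀ z, ‖M.feat z‖ ≤ 1) (j : Fin h) :
    M.gram_isHermitian.eigenvalues j ∈ Set.Icc 0 1 := by
  set e := M.gram_isHermitian.eigenvectorBasis j with he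
  have h1 : ‖e‖ = 1 := M.gram_isHermitian.eigenvectorBasis.norm_eq_one j
  have h2 : ⟪M.meanHess e, e⟫_ℝ = M.gram_isHermitian.eigenvalues j + M.η := by
    rw [he, meanHess_eigenvectorBasis, inner_smul_left, ← he, real_inner_self_eq_norm_sq, h1]
    simp
  rw [inner_meanHess_self, h1, one_pow, mul_one] at h2
  have h3 : M.gram_isHermitian.eigenvalues j = ∑ z, (M.d z).toReal * ⟪M.feat z, e⟫_ℝ ^ 2 := by
    linarith
  rw [h3]
  refine ⟨Finset.sum_nonneg fun z _ => mul_nonneg ENNReal.toReal_nonneg (sq_nonneg _), ?_⟩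
  rw [← M.sum_d]
  refine Finset.sum_le_sum fun z _ => mul_le_of_le_one_right ENNReal.toReal_nonneg ?_
  have := M.inner_feat_sq_le hΦ z e
  rwa [h1, one_pow] at this

theorem eta_le_muEta (M : RegQ S A h) (hΦ : ∀ z, ‖M.feat z‖ ≤ 1) : M.η ≤ M.muEta := by
  have : 0 ≤ ⨅ i, M.gram_isHermitian.eigenvalues i :=
    Real.iInf_nonneg fun j => (M.eigenvalues_mem_Icc hΦ j).1
  rw [muEta]; linarith

theorem lEta_le (M : RegQ S A h) (hΦ : ∀ z, ‖M.feat z‖ ≤ 1) : M.lEta ≤ 1 + M.η := by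
  have : ⨆ i, M.gram_isHermitian.eigenvalues i ≤ 1 :=
    Real.iSup_le (fun j => (M.eigenvalues_mem_Icc hΦ j).2) zero_le_one
  rw [lEta]; linarith

theorem muEta_le_eigenvalues (M : RegQ S A h) (j : Fin h) :
    M.muEta ≤ M.gram_isHermitian.eigenvalues j + M.η := by
  have := ciInf_le (Set.finite_range M.gram_isHermitian.eigenvalues).bddBelow j
  rw [muEta]; linarith

theorem eigenvalues_le_lEta (M : RegQ S A h) (j : Fin h) :
    M.gram_isHermitian.eigenvalues j + M.η ≤ M.lEta := by
  have := le_ciSup (Set.finite_range M.gram_isHermitian.eigenvalues).bddAbove j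
  rw [lEta]; linarith

theorem muEta_le_lEta (M : RegQ S A h) : M.muEta ≤ M.lEta := by
  rcases isEmpty_or_nonempty (Fin h) with hE | ⟨⟨j⟩⟩
  · simp [muEta, lEta, Real.iInf_of_isEmpty, Real.iSup_of_isEmpty]
  · exact (M.muEta_le_eigenvalues j).trans (M.eigenvalues_le_lEta j)

theorem inner_eigenvectorBasis_meanHess (M : RegQ S A h) (x : EuclideanSpace ℝ (Fin h))
    (j : Fin h) : ⟪M.gram_isHermitian.eigenvectorBasis j, M.meanHess x⟫_ℝ
      = (M.gram_isHermitian.eigenvalues j + M.η)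
        * ⟪M.gram_isHermitian.eigenvectorBasis j, x⟫_ℝ := by
  rw [← meanHess_symm, meanHess_eigenvectorBasis, inner_smul_left, RCLike.conj_to_real]

theorem muEta_mul_le (M : RegQ S A h) (x : EuclideanSpace ℝ (Fin h)) :
    M.muEta * ‖x‖ ^ 2 ≤ ⟪M.meanHess x, x⟫_ℝ := by
  rw [real_inner_comm, ← real_inner_self_eq_norm_sq,
    ← M.gram_isHermitian.eigenvectorBasis.sum_inner_mul_inner x x,
    ← M.gram_isHermitian.eigenvectorBasis.sum_inner_mul_inner x (M.meanHess x), Finset.mul_sum]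
  refine Finset.sum_le_sum fun j _ => ?_
  rw [inner_eigenvectorBasis_meanHess, real_inner_comm _ x]
  have := mul_le_mul_of_nonneg_right (M.muEta_le_eigenvalues j)
    (mul_self_nonneg ⟪M.gram_isHermitian.eigenvectorBasis j, x⟫_ℝ)
  linarith

theorem norm_meanHess_le (M : RegQ S A h) (hη : 0 < M.η) (hΦ : ∀ z, ‖M.feat z‖ ≤ 1)
    (x : EuclideanSpace ℝ (Fin h)) : ‖M.meanHess x‖ ≤ M.lEta * ‖x‖ := by
  have hl : 0 ≤ M.lEta := hη.le.trans ((M.eta_le_muEta hΦ).trans M.muEta_le_lEta)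
  refine le_of_sq_le_sq ?_ (mul_nonneg hl (norm_nonneg _))
  rw [mul_pow, ← real_inner_self_eq_norm_sq, ← real_inner_self_eq_norm_sq,
    ← M.gram_isHermitian.eigenvectorBasis.sum_inner_mul_inner x x,
    ← M.gram_isHermitian.eigenvectorBasis.sum_inner_mul_inner (M.meanHess x) (M.meanHess x),
    Finset.mul_sum]
  refine Finset.sum_le_sum fun j _ => ?_
  rw [real_inner_comm _ (M.meanHess x), inner_eigenvectorBasis_meanHess, real_inner_comm _ x]
  have h1 := pow_le_pow_left₀ (by linarith [(M.eigenvalues_mem_Icc hΦ j).1])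
    (M.eigenvalues_le_lEta j) 2
  have := mul_le_mul_of_nonneg_right h1
    (mul_self_nonneg ⟪M.gram_isHermitian.eigenvectorBasis j, x⟫_ℝ)
  linarith

theorem muEta_mul_norm_le (M : RegQ S A h) (x : EuclideanSpace ℝ (Fin h)) :
    M.muEta * ‖x‖ ≤ ‖M.meanHess x‖ := by
  have h1 := M.muEta_mul_le x
  have h2 := real_inner_le_norm (M.meanHess x) x
  rcases (norm_nonneg x).eq_or_lt with h0 | h0
  · rw [← h0, mul_zero]; exact norm_nonneg _
  · refine le_of_mul_le_mul_right ?_ h0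
    linarith

/-- The Polyak-Łojasiewicz inequality for the quadratic form of `meanHess`. -/
theorem muEta_mul_inner_le (M : RegQ S A h) (hη : 0 < M.η) (hΦ : ∀ z, ‖M.feat z‖ ≤ 1)
    (x : EuclideanSpace ℝ (Fin h)) : M.muEta * ⟪M.meanHess x, x⟫_ℝ ≤ ‖M.meanHess x‖ ^ 2 := by
  have hμ : 0 < M.muEta := hη.trans_le (M.eta_le_muEta hΦ)
  calc _ ≤ M.muEta * (‖M.meanHess x‖ * ‖x‖) :=
        mul_le_mul_of_nonneg_left (real_inner_le_norm _ _) hμ.le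
    _ = ‖M.meanHess x‖ * (M.muEta * ‖x‖) := by ring
    _ ≤ ‖M.meanHess x‖ * ‖M.meanHess x‖ :=
        mul_le_mul_of_nonneg_left (M.muEta_mul_norm_le x) (norm_nonneg _)
    _ = _ := (sq _).symm

/-- Normal equations of the inner problem. -/
theorem meanHess_innerMin [Nonempty A] (M : RegQ S A h) (hη : 0 < M.η)
    (hΦ : ∀ z, ‖M.feat z‖ ≤ 1) (θ' : EuclideanSpace ℝ (Fin h)) :
    M.meanHess (M.innerMin θ')
      = ∑ z, (M.d z).toReal • M.bellman (M.val θ') z • M.feat z := by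
  have hunit : IsUnit (M.gram + M.η • (1 : Matrix (Fin h) (Fin h) ℝ)).det := by
    rw [← Matrix.isUnit_iff_isUnit_det, ← Matrix.mulVec_injective_iff_isUnit]
    intro x y hxy
    have h1 : M.meanHess (WithLp.toLp 2 (x - y)) = 0 := by
      rw [meanHess_eq, Matrix.mulVec_sub, hxy, sub_self, WithLp.toLp_zero]
    have h2 := M.muEta_mul_norm_le (WithLp.toLp 2 (x - y))
    rw [h1, norm_zero] at h2
    have hμ : 0 < M.muEta := hη.trans_le (M.eta_le_muEta hΦ)
    have h3 : ‖(WithLp.toLp 2 (x - y) : EuclideanSpace ℝ (Fin h))‖ = 0 :=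
      le_antisymm (by by_contra! hc; exact absurd h2 (not_le.2 (mul_pos hμ hc))) (norm_nonneg _)
    rw [norm_eq_zero, WithLp.toLp_eq_zero] at h3
    exact sub_eq_zero.1 h3
  rw [meanHess_eq, innerMin]
  rw [← toLp_transpose_mulVec_weight]
  simp only [Matrix.mulVec_mulVec, ← Matrix.mul_assoc, Matrix.mul_nonsing_inv _ hunit,
    Matrix.one_mul]

end Spectral

end RegQ

/-! ### The semi-gradient at the inner minimizer -/

namespace RegQ

variable {S A : Type*} {h : ℕ}

section Bellman

variable [Fintype A] [Nonempty A]

/-- The sampled Bellman target `r + γ max_u Q(s', u)`. -/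
def target (M : RegQ S A h) (Q : S × A → ℝ) (z : S × A) (s' : S) : ℝ :=
  M.r z.1 z.2 s' + M.γ * maxQ Q s'

theorem grad_eq (M : RegQ S A h) (θ θ' : EuclideanSpace ℝ (Fin h)) (z : S × A) (s' : S) :
    M.grad θ θ' z s' = M.sampleHess z θ - M.target (M.val θ') z s' • M.feat z := by
  rw [grad, sampleHess_apply, ← val_apply, target]
  module

theorem grad_eq_add (M : RegQ S A h) (θ θ₁ θ' : EuclideanSpace ℝ (Fin h)) (z : S × A) (s' : S) :
    M.grad θ θ' z s' = M.sampleHess z (θ - θ₁) + M.grad θ₁ θ' z s' := by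
  rw [grad_eq, grad_eq, map_sub]; abel

variable [Fintype S]

theorem abs_maxQ_sub_le (Q Q' : S × A → ℝ) (s : S) : |maxQ Q s - maxQ Q' s| ≤ ‖Q - Q'‖ := by
  have key : ∀ Q Q' : S × A → ℝ, maxQ Q s ≤ maxQ Q' s + ‖Q - Q'‖ := by
    intro Q Q'
    refine Finset.sup'_le _ _ fun u _ => ?_
    have h1 : Q' (s, u) ≤ maxQ Q' s :=
      Finset.le_sup' (fun u => Q' (s, u)) (Finset.mem_univ u)
    have h2 := (Real.le_norm_self _).trans (norm_le_pi_norm (Q - Q') (s, u))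
    rw [Pi.sub_apply] at h2
    linarith
  have h1 := key Q Q'
  have h2 := key Q' Q
  rw [norm_sub_rev] at h2
  rw [abs_le]
  constructor <;> linarith

theorem abs_maxQ_le (Q : S × A → ℝ) (s : S) : |maxQ Q s| ≤ ‖Q‖ := by
  have := abs_maxQ_sub_le Q 0 s
  simpa [maxQ] using this

theorem sum_stepMatrix_mul_target (M : RegQ S A h) (Q : S × A → ℝ) (z : S × A) :
    ∑ z', M.stepMatrix z z' * M.target Q z z'.1 = M.bellman Q z :=
  M.sum_stepMatrix_mul z fun s' => M.target Q z s'

theorem abs_target_le (M : RegQ S A h) (hγ0 : 0 ≤ M.γ) {R : ℝ} (hR : ∀ s a s', |M.r s a s'| ≤ R)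
    (Q : S × A → ℝ) (z : S × A) (s' : S) : |M.target Q z s'| ≤ R + M.γ * ‖Q‖ := by
  refine (abs_add_le _ _).trans (add_le_add (hR _ _ _) ?_)
  rw [abs_mul, abs_of_nonneg hγ0]
  exact mul_le_mul_of_nonneg_left (abs_maxQ_le Q s') hγ0

theorem abs_bellman_le (M : RegQ S A h) (hγ0 : 0 ≤ M.γ) {R : ℝ}
    (hR : ∀ s a s', |M.r s a s'| ≤ R) (Q : S × A → ℝ) (z : S × A) :
    |M.bellman Q z| ≤ R + M.γ * ‖Q‖ := by
  rw [← sum_stepMatrix_mul_target, ← Real.norm_eq_abs]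
  exact LinearSA.norm_sum_smul_le (M.stepMatrix_nonneg z) (M.sum_stepMatrix z)
    fun z' => M.abs_target_le hγ0 hR Q z z'.1

theorem abs_target_sub_le (M : RegQ S A h) (hγ0 : 0 ≤ M.γ) (Q Q' : S × A → ℝ) (z : S × A)
    (s' : S) : |M.target Q z s' - M.target Q' z s'| ≤ M.γ * ‖Q - Q'‖ := by
  rw [target, target, add_sub_add_left_eq_sub, ← mul_sub, abs_mul, abs_of_nonneg hγ0]
  exact mul_le_mul_of_nonneg_left (abs_maxQ_sub_le Q Q' s') hγ0

theorem abs_bellman_sub_le (M : RegQ S A h) (hγ0 : 0 ≤ M.γ) (Q Q' : S × A → ℝ) (z : S × A) :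
    |M.bellman Q z - M.bellman Q' z| ≤ M.γ * ‖Q - Q'‖ := by
  rw [← sum_stepMatrix_mul_target, ← sum_stepMatrix_mul_target, ← Finset.sum_sub_distrib,
    ← Real.norm_eq_abs]
  simp only [← mul_sub]
  exact LinearSA.norm_sum_smul_le (M.stepMatrix_nonneg z) (M.sum_stepMatrix z)
    fun z' => M.abs_target_sub_le hγ0 Q Q' z z'.1

theorem norm_grad_le (M : RegQ S A h) (hγ0 : 0 ≤ M.γ) (hη : 0 < M.η) (hΦ : ∀ z, ‖M.feat z‖ ≤ 1)
    {R : ℝ} (hR : ∀ s a s', |M.r s a s'| ≤ R) (θ θ' : EuclideanSpace ℝ (Fin h)) (z : S × A)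
    (s' : S) : ‖M.grad θ θ' z s'‖ ≤ (1 + M.η) * ‖θ‖ + (R + M.γ * ‖θ'‖) := by
  rw [grad_eq]
  refine (norm_sub_le _ _).trans (add_le_add (M.norm_sampleHess_le hη hΦ z θ)
    ((M.norm_smul_feat_le hΦ z _).trans ((M.abs_target_le hγ0 hR _ z s').trans ?_)))
  gcongr
  exact M.norm_val_le hΦ θ'

theorem sum_stepMatrix_smul_grad (M : RegQ S A h) (θ θ' : EuclideanSpace ℝ (Fin h)) (z : S × A) :
    ∑ z', M.stepMatrix z z' • M.grad θ θ' z z'.1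
      = M.sampleHess z θ - M.bellman (M.val θ') z • M.feat z := by
  simp only [grad_eq, smul_sub, Finset.sum_sub_distrib, ← Finset.sum_smul, smul_smul,
    sum_stepMatrix, one_smul, sum_stepMatrix_mul_target]

/-- Bias-variance decomposition of the semi-gradient at the fixed point, for one sample. -/
theorem sum_norm_grad_solution_sq_le (M : RegQ S A h) (θs : EuclideanSpace ℝ (Fin h))
    (z : S × A) :
    ∑ z', M.stepMatrix z z' * ‖M.grad θs θs z z'.1‖ ^ 2 ≤ M.sigmaSq θs
      + ‖M.η • θs - (M.bellman (M.val θs) z - M.val θs z) • M.feat z‖ ^ 2 := by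
  set v := M.η • θs - (M.bellman (M.val θs) z - M.val θs z) • M.feat z with hv
  set ξ : S → ℝ := fun s' => M.target (M.val θs) z s' - M.bellman (M.val θs) z with hξ
  have hσ : ∑ z', M.stepMatrix z z' * ‖ξ z'.1 • M.feat z‖ ^ 2 ≤ M.sigmaSq θs := by
    rw [M.sum_stepMatrix_mul z fun s' => ‖ξ s' • M.feat z‖ ^ 2]
    exact le_ciSup (f := fun z : S × A => ∑ s', (M.P z.1 z.2 s').toReal *
      ‖(M.r z.1 z.2 s' + M.γ * maxQ (M.val θs) s' - M.bellman (M.val θs) z) • M.feat z‖ ^ 2)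
      (Set.finite_range _).bddAbove z
  have h0 : ∑ z', M.stepMatrix z z' * ξ z'.1 = 0 := by
    simp only [hξ, mul_sub, Finset.sum_sub_distrib, sum_stepMatrix_mul_target, ← Finset.sum_mul,
      sum_stepMatrix, one_mul, sub_self]
  have e : ∀ s', ‖M.grad θs θs z s'‖ ^ 2
      = ‖v‖ ^ 2 - 2 * ⟪v, M.feat z⟫_ℝ * ξ s' + ‖ξ s' • M.feat z‖ ^ 2 := by
    intro s'
    have : M.grad θs θs z s' = v - ξ s' • M.feat z := by
      rw [grad_eq, sampleHess_apply, ← val_apply, hv, hξ]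
      module
    rw [this, norm_sub_sq_real, inner_smul_right]
    ring
  have e2 : ∑ z', M.stepMatrix z z' * ‖M.grad θs θs z z'.1‖ ^ 2
      = ‖v‖ ^ 2 - 2 * ⟪v, M.feat z⟫_ℝ * ∑ z', M.stepMatrix z z' * ξ z'.1
        + ∑ z', M.stepMatrix z z' * ‖ξ z'.1 • M.feat z‖ ^ 2 := by
    simp only [e, mul_add, mul_sub, Finset.sum_add_distrib, Finset.sum_sub_distrib,
      ← Finset.sum_mul, sum_stepMatrix, one_mul, Finset.mul_sum, mul_left_comm]
  rw [e2, h0]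
  linarith

end Bellman

section Noise

variable [Fintype S] [Fintype A] [Nonempty A] [DecidableEq S] [DecidableEq A]

/-- At the inner minimizer the semi-gradient is centred under the stationary law. -/
theorem sum_bias_grad_innerMin (M : RegQ S A h) (hη : 0 < M.η) (hΦ : ∀ z, ‖M.feat z‖ ≤ 1)
    (θ' : EuclideanSpace ℝ (Fin h)) :
    ∑ z, (M.d z).toReal • ∑ z', M.stepMatrix z z' • M.grad (M.innerMin θ') θ' z z'.1 = 0 := by
  simp only [sum_stepMatrix_smul_grad, smul_sub, Finset.sum_sub_distrib]
  rw [← meanHess_apply, M.meanHess_innerMin hη hΦ, sub_self]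

/-- The loss gap is the energy of the deviation from the inner minimizer. -/
theorem loss_sub_loss_innerMin (M : RegQ S A h) (hη : 0 < M.η) (hΦ : ∀ z, ‖M.feat z‖ ≤ 1)
    (θ θ' : EuclideanSpace ℝ (Fin h)) :
    M.loss θ θ' - M.loss (M.innerMin θ') θ'
      = 1 / 2 * ⟪M.meanHess (θ - M.innerMin θ'), θ - M.innerMin θ'⟫_ℝ := by
  set θm := M.innerMin θ' with hθm
  obtain ⟨x, rfl⟩ : ∃ x, θ = θm + x := ⟨θ - θm, by abel⟩
  rw [add_sub_cancel_left]
  have h1 : ⟪M.meanHess θm, x⟫_ℝ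
      = ∑ z, (M.d z).toReal * (M.bellman (M.val θ') z * ⟪M.feat z, x⟫_ℝ) := by
    rw [hθm, M.meanHess_innerMin hη hΦ]
    simp [sum_inner, inner_smul_left]
  have h2 : ⟪M.meanHess θm, x⟫_ℝ
      = ∑ z, (M.d z).toReal * (⟪M.feat z, θm⟫_ℝ * ⟪M.feat z, x⟫_ℝ) + M.η * ⟪θm, x⟫_ℝ := by
    rw [meanHess_apply']
    simp [sum_inner, inner_smul_left, inner_add_left]
  have h3 : ∑ z, (M.d z).toReal * (M.bellman (M.val θ') z - M.val (θm + x) z) ^ 2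
      = ∑ z, (M.d z).toReal * (M.bellman (M.val θ') z - M.val θm z) ^ 2
        - 2 * ∑ z, (M.d z).toReal * (M.bellman (M.val θ') z * ⟪M.feat z, x⟫_ℝ)
        + 2 * ∑ z, (M.d z).toReal * (⟪M.feat z, θm⟫_ℝ * ⟪M.feat z, x⟫_ℝ)
        + ∑ z, (M.d z).toReal * ⟪M.feat z, x⟫_ℝ ^ 2 := by
    simp only [Finset.mul_sum, ← Finset.sum_sub_distrib, ← Finset.sum_add_distrib]
    refine Finset.sum_congr rfl fun z _ => ?_
    rw [val_apply, val_apply, inner_add_right]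
    ring
  rw [loss, loss, h3, norm_add_sq_real, inner_meanHess_self]
  linarith

/-- Moving the target from `θs` to `θ'` moves the right-hand side of the normal equations by at
most `γ ‖Φ (θ' - θs)‖_∞` in every sample. -/
theorem meanHess_innerMin_sub (M : RegQ S A h) (hη : 0 < M.η) (hΦ : ∀ z, ‖M.feat z‖ ≤ 1)
    {θs : EuclideanSpace ℝ (Fin h)} (hθs : M.IsSolution θs) (θ' : EuclideanSpace ℝ (Fin h)) :
    M.meanHess (M.innerMin θ' - θs) = ∑ z, (M.d z).toReal •
      (M.bellman (M.val θ') z - M.bellman (M.val θs) z) • M.feat z := by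
  have e : M.meanHess θs = ∑ z, (M.d z).toReal • M.bellman (M.val θs) z • M.feat z := by
    rw [← M.meanHess_innerMin hη hΦ, show M.innerMin θs = θs from hθs]
  rw [map_sub, M.meanHess_innerMin hη hΦ, e, ← Finset.sum_sub_distrib]
  simp only [sub_smul, smul_sub]

theorem muEta_mul_norm_innerMin_sub_le (M : RegQ S A h) (hγ0 : 0 ≤ M.γ) (hη : 0 < M.η)
    (hΦ : ∀ z, ‖M.feat z‖ ≤ 1) {θs : EuclideanSpace ℝ (Fin h)} (hθs : M.IsSolution θs)
    (θ' : EuclideanSpace ℝ (Fin h)) :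
    M.muEta * ‖M.innerMin θ' - θs‖ ≤ M.γ * ‖M.val (θ' - θs)‖ := by
  refine (M.muEta_mul_norm_le _).trans ?_
  rw [M.meanHess_innerMin_sub hη hΦ hθs, val_sub]
  exact LinearSA.norm_sum_smul_le (fun _ => ENNReal.toReal_nonneg) M.sum_d fun z =>
    (M.norm_smul_feat_le hΦ z _).trans (M.abs_bellman_sub_le hγ0 _ _ z)

theorem inner_meanHess_innerMin_sub_le (M : RegQ S A h) (hγ0 : 0 ≤ M.γ) (hη : 0 < M.η)
    (hΦ : ∀ z, ‖M.feat z‖ ≤ 1) {θs : EuclideanSpace ℝ (Fin h)} (hθs : M.IsSolution θs)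
    (θ' : EuclideanSpace ℝ (Fin h)) :
    ⟪M.meanHess (M.innerMin θ' - θs), M.innerMin θ' - θs⟫_ℝ
      ≤ M.γ ^ 2 * ‖M.val (θ' - θs)‖ ^ 2 := by
  set u := M.innerMin θ' - θs with hu
  have h1 := M.inner_meanHess_self u
  have h2 : ⟪M.meanHess u, u⟫_ℝ ≤ ∑ z, (M.d z).toReal *
      (1 / 2 * (M.γ ^ 2 * ‖M.val (θ' - θs)‖ ^ 2) + 1 / 2 * ⟪M.feat z, u⟫_ℝ ^ 2) := by
    rw [hu, M.meanHess_innerMin_sub hη hΦ hθs, sum_inner, ← hu]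
    refine Finset.sum_le_sum fun z _ => ?_
    rw [inner_smul_left, inner_smul_left, RCLike.conj_to_real, RCLike.conj_to_real]
    refine mul_le_mul_of_nonneg_left ?_ ENNReal.toReal_nonneg
    have h3 := M.abs_bellman_sub_le hγ0 (M.val θ') (M.val θs) z
    rw [← val_sub] at h3
    have h4 := sq_le_sq' (abs_le.1 h3).1 (abs_le.1 h3).2
    rw [mul_pow] at h4
    linarith [two_mul_le_add_sq (M.bellman (M.val θ') z - M.bellman (M.val θs) z) ⟪M.feat z, u⟫_ℝ]
  simp only [mul_add, Finset.sum_add_distrib, ← Finset.sum_mul, sum_d, one_mul,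
    mul_left_comm _ (1 / 2 : ℝ), ← Finset.mul_sum] at h2
  have h5 : 0 ≤ M.η * ‖u‖ ^ 2 := by positivity
  linarith

/-- Pointwise bound on the semi-gradient at the inner minimizer. -/
theorem norm_grad_innerMin_le (M : RegQ S A h) (hγ0 : 0 ≤ M.γ) (hη : 0 < M.η)
    (hΦ : ∀ z, ‖M.feat z‖ ≤ 1) {R : ℝ} (hR : ∀ s a s', |M.r s a s'| ≤ R)
    {θs : EuclideanSpace ℝ (Fin h)} (hθs : M.IsSolution θs) (θ' : EuclideanSpace ℝ (Fin h))
    (z : S × A) (s' : S) :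
    ‖M.grad (M.innerMin θ') θ' z s'‖
      ≤ 2 * (1 + M.η) * M.γ * ‖M.val (θ' - θs)‖ / M.muEta
        + (R + (1 + M.γ + M.η) * ‖θs‖) := by
  have hμ : 0 < M.muEta := hη.trans_le (M.eta_le_muEta hΦ)
  have hμa : M.muEta ≤ 1 + M.η := M.muEta_le_lEta.trans (M.lEta_le hΦ)
  set Δ := ‖M.val (θ' - θs)‖ with hΔ
  have hΔ0 : 0 ≤ Δ := norm_nonneg _
  have e : M.grad (M.innerMin θ') θ' z s' = M.sampleHess z (M.innerMin θ' - θs)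
      - (M.target (M.val θ') z s' - M.target (M.val θs) z s') • M.feat z
      + M.grad θs θs z s' := by
    rw [grad_eq, grad_eq, map_sub, sub_smul]; abel
  have h1 := M.norm_sampleHess_le hη hΦ z (M.innerMin θ' - θs)
  have h2 : ‖(M.target (M.val θ') z s' - M.target (M.val θs) z s') • M.feat z‖ ≤ M.γ * Δ := by
    rw [hΔ, val_sub]
    exact (M.norm_smul_feat_le hΦ z _).trans (M.abs_target_sub_le hγ0 _ _ z s')
  have h3 := M.norm_grad_le hγ0 hη hΦ hR θs θs z s'
  have h4 : ‖M.innerMin θ' - θs‖ ≤ M.γ * Δ / M.muEta := by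
    rw [le_div_iff₀ hμ, mul_comm]
    exact M.muEta_mul_norm_innerMin_sub_le hγ0 hη hΦ hθs θ'
  have h5 : M.γ * Δ ≤ (1 + M.η) * (M.γ * Δ / M.muEta) := by
    rw [mul_div_left_comm]
    refine le_mul_of_one_le_right (by positivity) ?_
    rw [one_le_div hμ]
    exact hμa
  have h6 := mul_le_mul_of_nonneg_left h4 (by positivity : 0 ≤ 1 + M.η)
  rw [e]
  refine (norm_add_le _ _).trans ?_
  have h7 := norm_sub_le (M.sampleHess z (M.innerMin θ' - θs))
    ((M.target (M.val θ') z s' - M.target (M.val θs) z s') • M.feat z)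
  have h8 : 2 * (1 + M.η) * M.γ * Δ / M.muEta = 2 * ((1 + M.η) * (M.γ * Δ / M.muEta)) := by ring
  rw [h8]
  linarith

/-- Stationary second moment of the semi-gradient at the fixed point. The regularization term
`η θs` is the stationary mean of the residual direction, so subtracting it does not increase the
second moment, and the residual at the regularized fixed point is at most that of `θ = 0`. -/
theorem sum_sum_norm_grad_solution_sq_le (M : RegQ S A h) (hγ0 : 0 ≤ M.γ) (hη : 0 < M.η)
    (hΦ : ∀ z, ‖M.feat z‖ ≤ 1) {R : ℝ} (hR : ∀ s a s', |M.r s a s'| ≤ R)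
    {θs : EuclideanSpace ℝ (Fin h)} (hθs : M.IsSolution θs) :
    ∑ z, (M.d z).toReal * ∑ z', M.stepMatrix z z' * ‖M.grad θs θs z z'.1‖ ^ 2
      ≤ M.sigmaSq θs + 2 * R ^ 2 + 2 * M.γ ^ 2 * ‖M.val θs‖ ^ 2 := by
  set e : S × A → ℝ := fun z => M.bellman (M.val θs) z - M.val θs z with he
  have hmean : ∑ z, (M.d z).toReal • e z • M.feat z = M.η • θs := by
    have h1 := M.meanHess_innerMin hη hΦ θs
    rw [show M.innerMin θs = θs from hθs, meanHess_apply'] at h1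
    simp only [he, sub_smul, smul_sub, Finset.sum_sub_distrib, ← h1, val_apply]
    abel
  have hv : ∑ z, (M.d z).toReal * ‖M.η • θs - e z • M.feat z‖ ^ 2
      ≤ ∑ z, (M.d z).toReal * e z ^ 2 := by
    have e1 : ∑ z, (M.d z).toReal * ‖M.η • θs - e z • M.feat z‖ ^ 2
        = ‖M.η • θs‖ ^ 2 - 2 * ⟪M.η • θs, ∑ z, (M.d z).toReal • e z • M.feat z⟫_ℝ
          + ∑ z, (M.d z).toReal * ‖e z • M.feat z‖ ^ 2 := by
      simp only [norm_sub_sq_real, mul_add, mul_sub, Finset.sum_add_distrib,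
        Finset.sum_sub_distrib, ← Finset.sum_mul, sum_d, one_mul, inner_sum, Finset.mul_sum,
        inner_smul_right _ _ (M.d _).toReal, mul_left_comm]
    rw [e1, hmean, real_inner_self_eq_norm_sq]
    have e2 : ∑ z, (M.d z).toReal * ‖e z • M.feat z‖ ^ 2 ≤ ∑ z, (M.d z).toReal * e z ^ 2 := by
      refine Finset.sum_le_sum fun z _ => mul_le_mul_of_nonneg_left ?_ ENNReal.toReal_nonneg
      rw [← sq_abs (e z)]
      exact pow_le_pow_left₀ (norm_nonneg _) (M.norm_smul_feat_le hΦ z _) 2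
    nlinarith [sq_nonneg ‖M.η • θs‖]
  have hres : ∑ z, (M.d z).toReal * e z ^ 2
      ≤ ∑ z, (M.d z).toReal * M.bellman (M.val θs) z ^ 2 := by
    have e1 : ∑ z, (M.d z).toReal * M.bellman (M.val θs) z ^ 2
        = ∑ z, (M.d z).toReal * e z ^ 2
          + 2 * ⟪∑ z, (M.d z).toReal • e z • M.feat z, θs⟫_ℝ
          + ∑ z, (M.d z).toReal * M.val θs z ^ 2 := by
      rw [sum_inner, Finset.mul_sum, ← Finset.sum_add_distrib, ← Finset.sum_add_distrib]
      refine Finset.sum_congr rfl fun z _ => ?_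
      rw [inner_smul_left, inner_smul_left, RCLike.conj_to_real, RCLike.conj_to_real, ← val_apply,
        he]
      ring
    rw [e1, hmean, inner_smul_left, RCLike.conj_to_real, real_inner_self_eq_norm_sq]
    have e2 : 0 ≤ ∑ z, (M.d z).toReal * M.val θs z ^ 2 :=
      Finset.sum_nonneg fun z _ => mul_nonneg ENNReal.toReal_nonneg (sq_nonneg _)
    have e3 : 0 ≤ M.η * ‖θs‖ ^ 2 := by positivity
    linarith
  have hT : ∑ z, (M.d z).toReal * M.bellman (M.val θs) z ^ 2
      ≤ 2 * R ^ 2 + 2 * M.γ ^ 2 * ‖M.val θs‖ ^ 2 := by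
    calc ∑ z, (M.d z).toReal * M.bellman (M.val θs) z ^ 2
        ≤ ∑ z, (M.d z).toReal * (2 * R ^ 2 + 2 * M.γ ^ 2 * ‖M.val θs‖ ^ 2) := by
          refine Finset.sum_le_sum fun z _ => mul_le_mul_of_nonneg_left ?_ ENNReal.toReal_nonneg
          have h1 := M.abs_bellman_le hγ0 hR (M.val θs) z
          have h2 := sq_le_sq' (abs_le.1 h1).1 (abs_le.1 h1).2
          nlinarith [sq_nonneg (R - M.γ * ‖M.val θs‖)]
      _ = _ := by rw [← Finset.sum_mul, sum_d, one_mul]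
  have hall : ∑ z, (M.d z).toReal * ∑ z', M.stepMatrix z z' * ‖M.grad θs θs z z'.1‖ ^ 2
      ≤ ∑ z, (M.d z).toReal * (M.sigmaSq θs + ‖M.η • θs - e z • M.feat z‖ ^ 2) :=
    Finset.sum_le_sum fun z _ => mul_le_mul_of_nonneg_left
      (M.sum_norm_grad_solution_sq_le θs z) ENNReal.toReal_nonneg
  simp only [mul_add, Finset.sum_add_distrib, ← Finset.sum_mul, sum_d, one_mul] at hall
  linarith

/-- Stationary second moment of the semi-gradient at the inner minimizer. Unlike the pointwise
bound it does not involve `1 / muEta`. -/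
theorem sum_sum_norm_grad_innerMin_sq_le (M : RegQ S A h) (hγ0 : 0 ≤ M.γ) (hη : 0 < M.η)
    (hΦ : ∀ z, ‖M.feat z‖ ≤ 1) {R : ℝ} (hR : ∀ s a s', |M.r s a s'| ≤ R)
    {θs : EuclideanSpace ℝ (Fin h)} (hθs : M.IsSolution θs) (θ' : EuclideanSpace ℝ (Fin h)) :
    ∑ z, (M.d z).toReal * ∑ z', M.stepMatrix z z' * ‖M.grad (M.innerMin θ') θ' z z'.1‖ ^ 2
      ≤ 3 / 8 * (M.g2 * ‖M.val (θ' - θs)‖ ^ 2 + M.g3 R θs) := by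
  set Δ := ‖M.val (θ' - θs)‖ with hΔ
  set u := M.innerMin θ' - θs with hu
  have hpt : ∀ z s', ‖M.grad (M.innerMin θ') θ' z s'‖ ^ 2
      ≤ 3 * ‖M.sampleHess z u‖ ^ 2 + 3 * (M.γ ^ 2 * Δ ^ 2) + 3 * ‖M.grad θs θs z s'‖ ^ 2 := by
    intro z s'
    have e : M.grad (M.innerMin θ') θ' z s' = M.sampleHess z u
        - (M.target (M.val θ') z s' - M.target (M.val θs) z s') • M.feat z
        + M.grad θs θs z s' := by
      rw [grad_eq, grad_eq, hu, map_sub, sub_smul]; abel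
    have h2 : ‖(M.target (M.val θ') z s' - M.target (M.val θs) z s') • M.feat z‖ ≤ M.γ * Δ := by
      rw [hΔ, val_sub]
      exact (M.norm_smul_feat_le hΦ z _).trans (M.abs_target_sub_le hγ0 _ _ z s')
    have h3 : ‖M.grad (M.innerMin θ') θ' z s'‖
        ≤ ‖M.sampleHess z u‖ + M.γ * Δ + ‖M.grad θs θs z s'‖ := by
      rw [e]
      exact (norm_add_le _ _).trans (by
        gcongr
        exact (norm_sub_le _ _).trans (by gcongr))
    have h4 := pow_le_pow_left₀ (norm_nonneg _) h3 2
    nlinarith [sq_nonneg (‖M.sampleHess z u‖ - M.γ * Δ),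
      sq_nonneg (‖M.sampleHess z u‖ - ‖M.grad θs θs z s'‖),
      sq_nonneg (M.γ * Δ - ‖M.grad θs θs z s'‖)]
  have hsum : ∑ z, (M.d z).toReal * ∑ z', M.stepMatrix z z' *
        ‖M.grad (M.innerMin θ') θ' z z'.1‖ ^ 2
      ≤ 3 * ∑ z, (M.d z).toReal * ‖M.sampleHess z u‖ ^ 2 + 3 * (M.γ ^ 2 * Δ ^ 2)
        + 3 * ∑ z, (M.d z).toReal * ∑ z', M.stepMatrix z z' * ‖M.grad θs θs z z'.1‖ ^ 2 := by
    calc _ ≤ ∑ z, (M.d z).toReal * ∑ z', M.stepMatrix z z' *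
          (3 * ‖M.sampleHess z u‖ ^ 2 + 3 * (M.γ ^ 2 * Δ ^ 2)
            + 3 * ‖M.grad θs θs z z'.1‖ ^ 2) :=
          Finset.sum_le_sum fun z _ => mul_le_mul_of_nonneg_left
            (Finset.sum_le_sum fun z' _ => mul_le_mul_of_nonneg_left (hpt z z'.1)
              (M.stepMatrix_nonneg z z')) ENNReal.toReal_nonneg
      _ = _ := by
          simp only [mul_add, Finset.sum_add_distrib, ← Finset.sum_mul, sum_stepMatrix, sum_d,
            one_mul, mul_left_comm _ (3 : ℝ), ← Finset.mul_sum]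
  have h1 := M.sum_norm_sampleHess_sq_le hη hΦ u
  have h2 := mul_le_mul_of_nonneg_left (M.inner_meanHess_innerMin_sub_le hγ0 hη hΦ hθs θ')
    (by positivity : 0 ≤ 1 + M.η)
  have h3 := M.sum_sum_norm_grad_solution_sq_le hγ0 hη hΦ hR hθs
  rw [← hu, ← hΔ] at h2
  have k1 : 0 ≤ M.γ ^ 2 * Δ ^ 2 := by positivity
  have k2 : 0 ≤ M.η * (M.γ ^ 2 * Δ ^ 2) := by positivity
  have k3 : 0 ≤ M.η * R ^ 2 := by positivity
  have k4 : 0 ≤ M.γ ^ 2 * ‖M.val θs‖ ^ 2 := by positivity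
  have k5 : 0 ≤ M.η * (M.γ ^ 2 * ‖M.val θs‖ ^ 2) := by positivity
  rw [g2, g3]
  linarith

end Noise

end RegQ

/-! ### Consequences of the step-size conditions -/

/-- Step-size conditions, in the form in which they are used. Here `a = 1 + η`, `κ = l / μ`, and `ρ`
bounds the semi-gradient at the fixed point. The last four conditions single out summands of the
denominators of `alpha1` and `alpha2`. -/
structure StepBounds (α μ l κ τ a γ ρ : ℝ) : Prop where
  α_pos : 0 < α
  μ_pos : 0 < μ
  μ_le : μ ≤ l
  l_le : l ≤ a
  a_le : a ≤ 1 + l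
  one_le_a : 1 ≤ a
  κ_mul : κ * μ = l
  one_le_τ : 1 ≤ τ
  γ_nonneg : 0 ≤ γ
  γ_le : γ ≤ 1
  ρ_nonneg : 0 ≤ ρ
  noise_le : 16 * (α * l * τ * ρ * a) ≤ μ
  cond_le : 48 * (α * κ * τ * a ^ 2) ≤ μ
  cond_le' : 16 * (α * κ * τ * a * (1 + l)) ≤ μ
  curv_le : 192 * (α * l * τ * a ^ 2) ≤ μ

namespace StepBounds

variable {α μ l κ τ a γ ρ : ℝ}

theorem one_le_κ (h : StepBounds α μ l κ τ a γ ρ) : 1 ≤ κ := by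
  by_contra! hc
  have := h.κ_mul; have := h.μ_le; have := h.μ_pos
  nlinarith

theorem ατa_le (h : StepBounds α μ l κ τ a γ ρ) : α * τ * a ≤ 1 / 16 := by
  have hα := h.α_pos; have hμ := h.μ_pos; have hl := hμ.trans_le h.μ_le
  have hτ := h.one_le_τ; have ha := h.one_le_a; have hκ := h.one_le_κ
  have h1 : α * τ * a * (1 + l) ≤ α * κ * τ * a * (1 + l) := by
    have : α * τ * a * (1 + l) * 1 ≤ α * τ * a * (1 + l) * κ := by gcongr
    linarith
  have h2 : α * τ * a * (1 + l) ≤ 1 / 16 * (1 + l) := by linarith [h.cond_le', h.μ_le]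
  exact le_of_mul_le_mul_right h2 (by positivity)

theorem ατa_sq_le (h : StepBounds α μ l κ τ a γ ρ) : 48 * (α * τ * a ^ 2) ≤ μ := by
  have hα := h.α_pos; have hτ := h.one_le_τ; have ha := h.one_le_a; have hκ := h.one_le_κ
  have : α * τ * a ^ 2 * 1 ≤ α * τ * a ^ 2 * κ := by gcongr
  linarith [h.cond_le]

theorem αa_le (h : StepBounds α μ l κ τ a γ ρ) : α * a ≤ 1 / 8 := by
  have hα := h.α_pos; have hτ := h.one_le_τ; have ha := h.one_le_a
  have : α * a * 1 ≤ α * a * τ := by gcongr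
  linarith [h.ατa_le]

theorem αK_le (h : StepBounds α μ l κ τ a γ ρ) : 48 * (α * (κ * τ * a)) ≤ μ := by
  have hα := h.α_pos; have hτ := h.one_le_τ; have ha := h.one_le_a; have hκ := h.one_le_κ
  have : α * (κ * τ * a) * 1 ≤ α * (κ * τ * a) * a := by gcongr
  linarith [h.cond_le]

theorem αlτρ_le (h : StepBounds α μ l κ τ a γ ρ) : 16 * (α * l * τ * ρ) ≤ μ := by
  have hα := h.α_pos; have hτ := h.one_le_τ; have ha := h.one_le_a
  have hl := h.μ_pos.trans_le h.μ_le; have hρ := h.ρ_nonneg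
  have : α * l * τ * ρ * 1 ≤ α * l * τ * ρ * a := by gcongr
  linarith [h.noise_le]

/-- The correctors of the energy `G` are small compared with `G` itself, up to a term of the
order of the step size. -/
theorem corrector_le (h : StepBounds α μ l κ τ a γ ρ) {X G Δ : ℝ}
    (hG : μ * X ^ 2 ≤ 2 * G) :
    2 * α * l * τ * X ^ 2 + 9 / 8 * (α * l * τ * (2 * a * γ * Δ / μ + ρ) * X)
      + α ^ 2 * (37 / 8 * (l * τ ^ 2 * (2 * a * γ * Δ / μ + ρ) ^ 2))
    ≤ 1 / 4 * G + α * (4 * (κ * τ * a) * γ * Δ ^ 2 + 3 * (l * τ * ρ)) := by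
  have hα := h.α_pos; have hμ := h.μ_pos; have hl := hμ.trans_le h.μ_le
  have hτ := h.one_le_τ; have ha := h.one_le_a; have hκ := h.one_le_κ
  have hγ := h.γ_nonneg; have hρ := h.ρ_nonneg; have hμa := h.μ_le.trans h.l_le
  have hG0 : 0 ≤ G := by nlinarith [mul_nonneg hμ.le (sq_nonneg X)]
  set K := κ * τ * a with hK
  have hK0 : 0 < K := by positivity
  have hKe : l * τ * (2 * a * γ * Δ / μ) = 2 * K * γ * Δ := by
    rw [hK, ← h.κ_mul]; field_simp
  have t1 : 2 * α * l * τ * X ^ 2 ≤ 1 / 12 * G := by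
    have e1 : 2 * α * l * τ * X ^ 2 = 2 * α * κ * τ * (μ * X ^ 2) := by rw [← h.κ_mul]; ring
    have e2 : 2 * α * κ * τ * (μ * X ^ 2) ≤ 2 * α * κ * τ * (2 * G) := by gcongr
    have e3 : 48 * (α * κ * τ) ≤ 1 := by
      have : 48 * (α * κ * τ) * a ≤ 1 * a := by rw [hK] at hK0; linarith [h.αK_le]
      exact le_of_mul_le_mul_right this (by linarith)
    have e4 := mul_le_mul_of_nonneg_right e3 hG0
    linarith
  have t2 : α * l * τ * ρ * X ≤ 1 / 2 * (α * l * τ * ρ) + 1 / 16 * G := by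
    have e1 : α * l * τ * ρ * X ≤ α * l * τ * ρ * (1 / 2 * (1 + X ^ 2)) := by
      gcongr; nlinarith [sq_nonneg (X - 1)]
    have e2 := mul_le_mul_of_nonneg_right h.αlτρ_le (sq_nonneg X)
    linarith
  have t3 : α * (2 * K * γ * Δ) * X ≤ α * K * γ * Δ ^ 2 + 1 / 24 * G := by
    have e1 : α * K * γ * (2 * Δ * X) ≤ α * K * γ * (Δ ^ 2 + X ^ 2) := by
      gcongr; exact two_mul_le_add_sq Δ X
    have e2 : α * K * γ * X ^ 2 ≤ α * K * 1 * X ^ 2 := by gcongr; exact h.γ_le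
    have e3 := mul_le_mul_of_nonneg_right h.αK_le (sq_nonneg X)
    linarith
  have t4 : α ^ 2 * (l * τ ^ 2 * (2 * a * γ * Δ / μ + ρ) ^ 2)
      ≤ α * (1 / 2 * K * γ * Δ ^ 2 + 1 / 8 * (l * τ * ρ)) := by
    have e1 : l * τ ^ 2 * (2 * a * γ * Δ / μ + ρ) ^ 2
        ≤ l * τ ^ 2 * (2 * (2 * a * γ * Δ / μ) ^ 2 + 2 * ρ ^ 2) := by
      gcongr; nlinarith [sq_nonneg (2 * a * γ * Δ / μ - ρ)]
    have e2 : l * τ ^ 2 * (2 * (2 * a * γ * Δ / μ) ^ 2) = 8 * K * (τ * a) * γ ^ 2 * Δ ^ 2 / μ := by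
      rw [hK, ← h.κ_mul]; field_simp; ring
    have e3 : α * (8 * K * (τ * a) * γ ^ 2 * Δ ^ 2 / μ) ≤ 1 / 2 * K * γ * Δ ^ 2 := by
      have f1 : 16 * (α * K) ≤ μ := by
        have : α * K * 1 ≤ α * K * (1 + l) := by gcongr; linarith
        have := h.cond_le'
        rw [hK] at *
        linarith
      have f2 : τ * a ≤ K := by
        have : τ * a * 1 ≤ τ * a * κ := by gcongr
        rw [hK]; linarith
      have f3 : γ ^ 2 ≤ γ := by nlinarith [h.γ_le]
      calc α * (8 * K * (τ * a) * γ ^ 2 * Δ ^ 2 / μ)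
          = 1 / 2 * ((16 * (α * K)) * ((τ * a) * γ ^ 2 * Δ ^ 2)) / μ := by ring
        _ ≤ 1 / 2 * (μ * (K * γ * Δ ^ 2)) / μ := by gcongr
        _ = _ := by field_simp
    have e4 : α * (l * τ ^ 2 * (2 * ρ ^ 2)) ≤ 1 / 8 * (l * τ * ρ) := by
      have f1 := mul_le_mul_of_nonneg_right h.αlτρ_le (by positivity : 0 ≤ τ * ρ)
      have f2 : μ * (τ * ρ) ≤ l * (τ * ρ) := by gcongr; exact h.μ_le
      linarith
    calc α ^ 2 * (l * τ ^ 2 * (2 * a * γ * Δ / μ + ρ) ^ 2)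
        ≤ α ^ 2 * (l * τ ^ 2 * (2 * (2 * a * γ * Δ / μ) ^ 2 + 2 * ρ ^ 2)) := by gcongr
      _ = α * (α * (8 * K * (τ * a) * γ ^ 2 * Δ ^ 2 / μ) + α * (l * τ ^ 2 * (2 * ρ ^ 2))) := by
          rw [← e2]; ring
      _ ≤ _ := by gcongr
  have e5 : α * l * τ * (2 * a * γ * Δ / μ + ρ) * X
      = α * (2 * K * γ * Δ) * X + α * l * τ * ρ * X := by
    rw [← hKe]; ring
  rw [e5]
  have k1 : 0 ≤ α * K * γ * Δ ^ 2 := by positivity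
  have k2 : 0 ≤ α * (l * τ * ρ) := by positivity
  linarith

/-- The second-order terms of the drift are absorbed by the contraction, up to the constant
noise level. Here `s = √(2 a G)`, `b1` and `b2` stand for the first and second stationary moments
of the additive noise. -/
theorem drift_le (h : StepBounds α μ l κ τ a γ ρ) {X G Δ s b1 b2 Γ : ℝ}
    (hG : μ * X ^ 2 ≤ 2 * G) (hs : s ^ 2 = 2 * a * G) (hb : b1 ^ 2 ≤ b2)
    (hΓ : b2 ≤ 3 / 8 * Γ) :
    -(α * (2 * μ * G)) + α ^ 2 * (15 / 2 * (l * τ * a ^ 2 * X ^ 2)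
        + 2 * α * a ^ 2 * τ ^ 2 * l * (2 * a * γ * Δ / μ + ρ) * X
        + l * τ * (2 * a * γ * Δ / μ + ρ) * s
        + (9 / 8 * (l * τ * (2 * a * γ * Δ / μ + ρ)) * b1 + 7 / 2 * (l * τ) * b2))
    ≤ -(μ * α * G) + α ^ 2 * ((12 * l * τ * a + l * τ * ρ + 2 * (κ * τ * a) * γ) * Γ
        + 2 * (κ * τ * a) * Δ ^ 2 + 2 * (l * τ * ρ)) := by
  have hα := h.α_pos; have hμ := h.μ_pos; have hl := hμ.trans_le h.μ_le
  have hτ := h.one_le_τ; have ha := h.one_le_a; have hκ := h.one_le_κ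
  have hγ := h.γ_nonneg; have hρ := h.ρ_nonneg
  have hG0 : 0 ≤ G := by nlinarith [mul_nonneg hμ.le (sq_nonneg X)]
  have hb2 : 0 ≤ b2 := (sq_nonneg _).trans hb
  have hΓ0 : 0 ≤ Γ := by linarith
  set K := κ * τ * a with hK
  have hK0 : 0 < K := by positivity
  have hKe : l * τ * (2 * a * γ * Δ / μ) = 2 * K * γ * Δ := by
    rw [hK, ← h.κ_mul]; field_simp
  have hX2 : (α * τ * a ^ 2) * (α * τ * a) * X ^ 2 ≤ 1 / 384 * G := by
    have e1 : (48 * (α * τ * a ^ 2)) * (α * τ * a) * X ^ 2 ≤ μ * (1 / 16) * X ^ 2 := by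
      gcongr
      · exact h.ατa_sq_le
      · exact h.ατa_le
    linarith
  have t1 : α * (l * τ * a ^ 2 * X ^ 2) ≤ 1 / 24 * (μ * G) := by
    have e1 : α * (l * τ * a ^ 2 * X ^ 2) = α * κ * τ * a ^ 2 * (μ * X ^ 2) := by
      rw [← h.κ_mul]; ring
    have e2 : α * κ * τ * a ^ 2 * (μ * X ^ 2) ≤ α * κ * τ * a ^ 2 * (2 * G) := by gcongr
    have e3 := mul_le_mul_of_nonneg_right h.cond_le hG0
    linarith
  have t2 : α * (2 * α * a ^ 2 * τ ^ 2 * l * ρ * X)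
      ≤ α * (1 / 2 * (l * τ * ρ)) + 1 / 64 * (μ * G) := by
    have e1 : 2 * α * a ^ 2 * τ ^ 2 * l * ρ * X
        ≤ 1 / 2 * (l * τ * ρ) * (1 + (2 * α * a ^ 2 * τ * X) ^ 2) := by
      have : l * τ * ρ * (2 * (2 * α * a ^ 2 * τ * X) * 1)
          ≤ l * τ * ρ * ((2 * α * a ^ 2 * τ * X) ^ 2 + 1 ^ 2) := by
        gcongr; exact two_mul_le_add_sq _ _
      linarith
    have e2 : 16 * (α * l * τ * ρ * a) * ((α * τ * a ^ 2) * (α * τ * a) * X ^ 2)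
        ≤ μ * (1 / 384 * G) := by
      gcongr
      exact h.noise_le
    have e3 := mul_le_mul_of_nonneg_left e1 hα.le
    have e4 : 0 ≤ μ * G := by positivity
    linarith
  have t3 : α * (2 * α * a ^ 2 * τ ^ 2 * l * (2 * a * γ * Δ / μ) * X)
      ≤ α * (1 / 16 * (K * γ * Δ ^ 2)) + 1 / 64 * (μ * G) := by
    have e0 : 2 * α * a ^ 2 * τ ^ 2 * l * (2 * a * γ * Δ / μ) * X
        = K * γ * (2 * (1 / 4 * Δ) * (8 * α * a ^ 2 * τ * X)) := by
      have : 2 * α * a ^ 2 * τ ^ 2 * l * (2 * a * γ * Δ / μ) * X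
          = 2 * α * a ^ 2 * τ * X * (l * τ * (2 * a * γ * Δ / μ)) := by ring
      rw [this, hKe]; ring
    have e1 : K * γ * (2 * (1 / 4 * Δ) * (8 * α * a ^ 2 * τ * X))
        ≤ K * γ * ((1 / 4 * Δ) ^ 2 + (8 * α * a ^ 2 * τ * X) ^ 2) := by
      gcongr; exact two_mul_le_add_sq _ _
    have e2 : 48 * (α * κ * τ * a ^ 2) * γ * ((α * τ * a ^ 2) * (α * τ * a) * X ^ 2)
        ≤ μ * 1 * (1 / 384 * G) := by
      gcongr
      · exact h.cond_le
      · exact h.γ_le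
    have e3 := mul_le_mul_of_nonneg_left e1 hα.le
    have e4 : 0 ≤ μ * G := by positivity
    have e5 : α * (K * γ * (8 * α * a ^ 2 * τ * X) ^ 2)
        = 64 * (α * κ * τ * a ^ 2 * γ * ((α * τ * a ^ 2) * (α * τ * a) * X ^ 2)) := by
      rw [hK]; ring
    rw [e0]
    linarith
  have t4 : α * (l * τ * ρ * s) ≤ α * (1 / 2 * (l * τ * ρ)) + 1 / 16 * (μ * G) := by
    have e1 : l * τ * ρ * s ≤ l * τ * ρ * (1 / 2 * (1 + s ^ 2)) := by
      gcongr; nlinarith [sq_nonneg (s - 1)]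
    have e2 := mul_le_mul_of_nonneg_right h.noise_le hG0
    have e3 := mul_le_mul_of_nonneg_left e1 hα.le
    rw [hs] at e3
    linarith
  have t5 : α * (2 * K * γ * Δ * s) ≤ α * (1 / 2 * (K * γ * Δ ^ 2)) + 1 / 12 * (μ * G) := by
    have e1 : K * γ * (2 * Δ * s) ≤ K * γ * (1 / 2 * Δ ^ 2 + 2 * s ^ 2) := by
      gcongr; nlinarith [sq_nonneg (Δ - 2 * s)]
    have e2 : 48 * (α * κ * τ * a ^ 2) * γ * G ≤ μ * 1 * G := by
      gcongr
      · exact h.cond_le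
      · exact h.γ_le
    have e3 := mul_le_mul_of_nonneg_left e1 hα.le
    have e4 : α * (K * γ * (2 * (2 * a * G))) = 4 * (α * κ * τ * a ^ 2 * γ * G) := by
      rw [hK]; ring
    rw [hs] at e3
    linarith
  have t6 : l * τ * ρ * b1 ≤ l * τ * ρ * (1 / 2 * (1 + b2)) := by
    gcongr; nlinarith [sq_nonneg (b1 - 1)]
  have t7 : 2 * K * γ * Δ * b1 ≤ K * γ * (Δ ^ 2 + b2) := by
    have : K * γ * (2 * Δ * b1) ≤ K * γ * (Δ ^ 2 + b2) := by
      gcongr; linarith [two_mul_le_add_sq Δ b1]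
    linarith
  have u1 : l * τ * ρ * b2 ≤ l * τ * ρ * (3 / 8 * Γ) := by gcongr
  have u2 : K * γ * b2 ≤ K * γ * (3 / 8 * Γ) := by gcongr
  have u3 : l * τ * b2 ≤ l * τ * a * (3 / 8 * Γ) := by
    calc l * τ * b2 = l * τ * 1 * b2 := by ring
      _ ≤ l * τ * a * (3 / 8 * Γ) := by gcongr
  have u4 : K * γ * Δ ^ 2 ≤ K * Δ ^ 2 := by
    have : K * γ * Δ ^ 2 ≤ K * 1 * Δ ^ 2 := by gcongr; exact h.γ_le
    linarith
  have v1 : 0 ≤ l * τ * ρ * Γ := by positivity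
  have v2 : 0 ≤ K * γ * Γ := by positivity
  have v3 : 0 ≤ l * τ * a * Γ := by positivity
  have v4 : 0 ≤ K * Δ ^ 2 := by positivity
  have v5 : 0 ≤ l * τ * ρ := by positivity
  have v6 : 0 ≤ μ * G := by positivity
  have e : α * (15 / 2 * (l * τ * a ^ 2 * X ^ 2)
        + 2 * α * a ^ 2 * τ ^ 2 * l * (2 * a * γ * Δ / μ + ρ) * X
        + l * τ * (2 * a * γ * Δ / μ + ρ) * s
        + (9 / 8 * (l * τ * (2 * a * γ * Δ / μ + ρ)) * b1 + 7 / 2 * (l * τ) * b2))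
      = 15 / 2 * (α * (l * τ * a ^ 2 * X ^ 2))
        + α * (2 * α * a ^ 2 * τ ^ 2 * l * ρ * X)
        + α * (2 * α * a ^ 2 * τ ^ 2 * l * (2 * a * γ * Δ / μ) * X)
        + α * (l * τ * ρ * s) + α * (2 * K * γ * Δ * s)
        + α * (9 / 8 * (l * τ * ρ * b1) + 9 / 8 * (2 * K * γ * Δ * b1) + 7 / 2 * (l * τ * b2)) := by
    rw [← hKe]; ring
  have hfin : 9 / 8 * (l * τ * ρ * b1) + 9 / 8 * (2 * K * γ * Δ * b1) + 7 / 2 * (l * τ * b2)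
      + (l * τ * ρ) + 9 / 16 * (K * γ * Δ ^ 2)
      ≤ (12 * l * τ * a + l * τ * ρ + 2 * K * γ) * Γ + 2 * K * Δ ^ 2 + 2 * (l * τ * ρ) := by
    linarith
  have hfin' := mul_le_mul_of_nonneg_left hfin hα.le
  have main : α * (15 / 2 * (l * τ * a ^ 2 * X ^ 2)
        + 2 * α * a ^ 2 * τ ^ 2 * l * (2 * a * γ * Δ / μ + ρ) * X
        + l * τ * (2 * a * γ * Δ / μ + ρ) * s
        + (9 / 8 * (l * τ * (2 * a * γ * Δ / μ + ρ)) * b1 + 7 / 2 * (l * τ) * b2))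
      ≤ μ * G + α * ((12 * l * τ * a + l * τ * ρ + 2 * K * γ) * Γ + 2 * K * Δ ^ 2
        + 2 * (l * τ * ρ)) := by
    rw [e]
    linarith
  have main' := mul_le_mul_of_nonneg_left main hα.le
  linarith

end StepBounds

/-! ### The corrected loss gap -/

namespace RegQ

variable {S A : Type*} {h : ℕ}

section Lyapunov

variable [Fintype S] [Fintype A] [DecidableEq S] [DecidableEq A]

/-- The pointwise bound for the semi-gradient at the fixed point; `lV3 = τ * noiseBound`. -/
def noiseBound (M : RegQ S A h) (R : ℝ) (θs : EuclideanSpace ℝ (Fin h)) : ℝ :=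
  R + (1 + M.γ + M.η) * ‖θs‖

/-- The assumption on the step size implies all of `StepBounds`. -/
theorem stepBounds (M : RegQ S A h) (hγ0 : 0 ≤ M.γ) (hγ1 : M.γ < 1) (hη : 0 < M.η)
    (hΦ : ∀ z, ‖M.feat z‖ ≤ 1) {R τ α : ℝ} (hR0 : 0 ≤ R) (hτ : 1 ≤ τ)
    (θs : EuclideanSpace ℝ (Fin h)) (hα0 : 0 < α)
    (hα : α ≤ min (M.alpha1 τ R θs) (M.alpha2 τ R θs)) :
    StepBounds α M.muEta M.lEta M.kappa τ (1 + M.η) M.γ (M.noiseBound R θs) := by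
  have hμη := M.eta_le_muEta hΦ
  have hμ : 0 < M.muEta := hη.trans_le hμη
  have hμl := M.muEta_le_lEta
  have hl : 0 < M.lEta := hμ.trans_le hμl
  have hκ : 0 < M.kappa := div_pos hl hμ
  have hρ : 0 ≤ M.noiseBound R θs := by unfold noiseBound; positivity
  obtain ⟨hα1, hα2⟩ := le_min_iff.1 hα
  have e3 : M.lV3 τ R θs = τ * M.noiseBound R θs := rfl
  have p1 : 0 ≤ M.lEta * τ * (1 + M.η) ^ 2 := by positivity
  have p2 : 0 ≤ M.lEta * τ * M.noiseBound R θs * (1 + M.η) := by positivity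
  have p3 : 0 ≤ M.kappa * τ * M.γ * (1 + M.η) ^ 2 := by positivity
  have p4 : 0 < M.lEta * (1 + M.η) := by positivity
  have p5 : 0 < M.kappa * τ * (1 + M.η) * (1 + M.lEta) := by positivity
  have p6 : 0 < M.kappa * τ * (1 + M.η) ^ 2 := by positivity
  have d1 : (M.D1 τ R θs + M.lEta / 2) * M.g1 + 2 * M.D2 τ
      = 192 * (M.lEta * τ * (1 + M.η) ^ 2) + 16 * (M.lEta * τ * M.noiseBound R θs * (1 + M.η))
        + 32 * (M.kappa * τ * M.γ * (1 + M.η) ^ 2) + 8 * (M.lEta * (1 + M.η))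
        + 16 * (M.kappa * τ * (1 + M.η) * (1 + M.lEta)) := by
    rw [D1, D2, g1, e3, lV1]; ring
  have d2 : 16 * M.lEta * (6 * M.lV1 τ + M.lV3 τ R θs) * (1 + M.η)
        + 24 * M.kappa * M.lV1 τ * (1 + M.η)
      = 192 * (M.lEta * τ * (1 + M.η) ^ 2) + 16 * (M.lEta * τ * M.noiseBound R θs * (1 + M.η))
        + 48 * (M.kappa * τ * (1 + M.η) ^ 2) := by
    rw [e3, lV1]; ring
  rw [alpha1, d1, le_div_iff₀ (by positivity)] at hα1
  rw [alpha2, d2, le_div_iff₀ (by positivity)] at hα2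
  have q1 := mul_nonneg hα0.le p1
  have q2 := mul_nonneg hα0.le p2
  have q3 := mul_nonneg hα0.le p3
  have q4 := mul_nonneg hα0.le p4.le
  have q5 := mul_nonneg hα0.le p5.le
  have q6 := mul_nonneg hα0.le p6.le
  exact
    { α_pos := hα0
      μ_pos := hμ
      μ_le := hμl
      l_le := M.lEta_le hΦ
      a_le := by linarith
      one_le_a := by linarith
      κ_mul := div_mul_cancel₀ _ hμ.ne'
      one_le_τ := hτ
      γ_nonneg := hγ0
      γ_le := hγ1.le
      ρ_nonneg := hρ
      noise_le := by linarith
      cond_le := by linarith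
      cond_le' := by linarith
      curv_le := by linarith }

variable [Nonempty A]

/-- The inner loop with frozen target `θ'` as a linear stochastic approximation recursion for the
deviation from the inner minimizer. The additive noise is the semi-gradient at the inner minimizer,
and `B` is its pointwise bound from `norm_grad_innerMin_le`. -/
def innerSA (M : RegQ S A h) (N : S × A → S × A → ℝ) (τ R α : ℝ)
    (θs θ' : EuclideanSpace ℝ (Fin h)) : LinearSA (S × A) (EuclideanSpace ℝ (Fin h)) where
  p := M.stepMatrix
  d z := (M.d z).toReal
  N := N
  A := M.sampleHess
  b z z' := M.grad (M.innerMin θ') θ' z z'.1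
  τ := τ
  a := 1 + M.η
  l := M.lEta
  B := 2 * (1 + M.η) * M.γ * ‖M.val (θ' - θs)‖ / M.muEta + M.noiseBound R θs
  α := α

/-- The corrected loss gap of the parameter `θ` and target `θ'` at the state `z` of the chain. -/
def corrGap (M : RegQ S A h) (N : S × A → S × A → ℝ) (τ R α : ℝ)
    (θs θ' θ : EuclideanSpace ℝ (Fin h)) (z : S × A) : ℝ :=
  (M.innerSA N τ R α θs θ').lyap (θ - M.innerMin θ') z

/-- Size of the correctors relative to the step size, as an affine function of
`Δ2 = ‖Φ (θ' - θs)‖_∞ ^ 2`; affinity lets it commute with expectations. -/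
def corrBound (M : RegQ S A h) (τ R : ℝ) (θs : EuclideanSpace ℝ (Fin h)) (Δ2 : ℝ) : ℝ :=
  2 * (M.lV1 τ * M.γ * M.kappa + M.lEta * M.lV2 τ) * Δ2 + 3 * M.lEta * M.lV3 τ R θs

variable {M : RegQ S A h} {N : S × A → S × A → ℝ} {τ R α : ℝ} {θs : EuclideanSpace ℝ (Fin h)}

theorem innerSA_valid (hη : 0 < M.η) (hΦ : ∀ z, ‖M.feat z‖ ≤ 1)
    (hR : ∀ s a s', |M.r s a s'| ≤ R) (hθs : M.IsSolution θs)
    (hN : IsPoissonKernel M.stepMatrix (fun z => (M.d z).toReal) τ N)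
    (hsb : StepBounds α M.muEta M.lEta M.kappa τ (1 + M.η) M.γ (M.noiseBound R θs))
    (θ' : EuclideanSpace ℝ (Fin h)) : (M.innerSA N τ R α θs θ').Valid where
  p_nonneg := M.stepMatrix_nonneg
  p_sum := M.sum_stepMatrix
  d_nonneg _ := ENNReal.toReal_nonneg
  d_sum := M.sum_d
  poisson := hN
  symm := M.sampleHess_symm
  norm_A := M.norm_sampleHess_le hη hΦ
  norm_A_sub := M.norm_sampleHess_sub_le hΦ
  norm_hess := M.norm_meanHess_le hη hΦ
  sq_norm_A := M.sum_norm_sampleHess_sq_le hη hΦ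
  norm_b z z' := M.norm_grad_innerMin_le hsb.γ_nonneg hη hΦ hR hθs θ' z z'.1
  bias_mean := M.sum_bias_grad_innerMin hη hΦ θ'
  one_le_τ := hsb.one_le_τ
  one_le_a := hsb.one_le_a
  l_pos := hsb.μ_pos.trans_le hsb.μ_le
  B_nonneg := by
    have := hsb.μ_pos; have := hsb.γ_nonneg; have := hsb.ρ_nonneg
    simp only [innerSA]
    positivity
  α_pos := hsb.α_pos
  α_a := hsb.αa_le
  α_τ_a := hsb.ατa_le

theorem muEta_mul_norm_sq_le_gap (hη : 0 < M.η) (hΦ : ∀ z, ‖M.feat z‖ ≤ 1)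
    (θ θ' : EuclideanSpace ℝ (Fin h)) :
    M.muEta * ‖θ - M.innerMin θ'‖ ^ 2 ≤ 2 * (M.loss θ θ' - M.loss (M.innerMin θ') θ') := by
  rw [M.loss_sub_loss_innerMin hη hΦ]
  linarith [M.muEta_mul_le (θ - M.innerMin θ')]

theorem gap_nonneg (hη : 0 < M.η) (hΦ : ∀ z, ‖M.feat z‖ ≤ 1)
    (θ θ' : EuclideanSpace ℝ (Fin h)) : 0 ≤ M.loss θ θ' - M.loss (M.innerMin θ') θ' := by
  have h1 := muEta_mul_norm_sq_le_gap hη hΦ θ θ'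
  have h2 : 0 ≤ M.muEta * ‖θ - M.innerMin θ'‖ ^ 2 :=
    mul_nonneg (hη.le.trans (M.eta_le_muEta hΦ)) (sq_nonneg _)
  linarith

/-- The corrected gap differs from the gap by a quarter of it and a term of order `α`. -/
theorem abs_corrGap_sub_le (hη : 0 < M.η) (hΦ : ∀ z, ‖M.feat z‖ ≤ 1)
    (hR : ∀ s a s', |M.r s a s'| ≤ R) (hθs : M.IsSolution θs)
    (hN : IsPoissonKernel M.stepMatrix (fun z => (M.d z).toReal) τ N)
    (hsb : StepBounds α M.muEta M.lEta M.kappa τ (1 + M.η) M.γ (M.noiseBound R θs))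
    (θ' θ : EuclideanSpace ℝ (Fin h)) (z : S × A) :
    |M.corrGap N τ R α θs θ' θ z - (M.loss θ θ' - M.loss (M.innerMin θ') θ')|
      ≤ 1 / 4 * (M.loss θ θ' - M.loss (M.innerMin θ') θ')
        + α * M.corrBound τ R θs (‖M.val (θ' - θs)‖ ^ 2) := by
  have h1 := (innerSA_valid hη hΦ hR hθs hN hsb θ').abs_lyap_sub_le (θ - M.innerMin θ') z
  have h2 := hsb.corrector_le (Δ := ‖M.val (θ' - θs)‖) (muEta_mul_norm_sq_le_gap hη hΦ θ θ')
  have h3 : (M.innerSA N τ R α θs θ').hess = M.meanHess := rfl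
  rw [h3, ← M.loss_sub_loss_innerMin hη hΦ] at h1
  refine h1.trans (h2.trans ?_)
  have hα := hsb.α_pos
  have hl : 0 ≤ M.lEta := (hsb.μ_pos.trans_le hsb.μ_le).le
  have h4 : (4 * (M.kappa * τ * (1 + M.η)) * M.γ * ‖M.val (θ' - θs)‖ ^ 2
      + 3 * (M.lEta * τ * M.noiseBound R θs)) ≤ M.corrBound τ R θs (‖M.val (θ' - θs)‖ ^ 2) := by
    have e3 : M.lV3 τ R θs = τ * M.noiseBound R θs := rfl
    have h5 : 0 ≤ M.lV2 τ := zero_le_one.trans (le_max_right _ _)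
    have h6 : 0 ≤ M.lEta * M.lV2 τ * ‖M.val (θ' - θs)‖ ^ 2 := by positivity
    rw [corrBound, e3, lV1]
    linarith
  gcongr

/-- One-step drift of the corrected loss gap along the chain. -/
theorem sum_corrGap_le (hη : 0 < M.η) (hΦ : ∀ z, ‖M.feat z‖ ≤ 1)
    (hR : ∀ s a s', |M.r s a s'| ≤ R) (hθs : M.IsSolution θs)
    (hN : IsPoissonKernel M.stepMatrix (fun z => (M.d z).toReal) τ N)
    (hsb : StepBounds α M.muEta M.lEta M.kappa τ (1 + M.η) M.γ (M.noiseBound R θs))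
    (θ' θ : EuclideanSpace ℝ (Fin h)) (z : S × A) :
    ∑ z', M.stepMatrix z z' * M.corrGap N τ R α θs θ' (θ - α • M.grad θ θ' z z'.1) z'
      ≤ (1 - M.muEta / 2 * α) * M.corrGap N τ R α θs θ' θ z
        + α ^ 2 * (M.E1 τ R θs * ‖M.val (θ' - θs)‖ ^ 2 + M.E2 τ R θs
          + M.muEta / 2 * M.corrBound τ R θs (‖M.val (θ' - θs)‖ ^ 2)) := by
  set m := M.innerSA N τ R α θs θ' with hm
  set x := θ - M.innerMin θ' with hx
  set Δ := ‖M.val (θ' - θs)‖ with hΔ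
  set G := M.loss θ θ' - M.loss (M.innerMin θ') θ' with hG
  have hα := hsb.α_pos
  have hμ := hsb.μ_pos
  have hl : 0 ≤ M.lEta := (hμ.trans_le hsb.μ_le).le
  have hG2 : G = 1 / 2 * ⟪M.meanHess x, x⟫_ℝ := M.loss_sub_loss_innerMin hη hΦ θ θ'
  have h1 := (innerSA_valid hη hΦ hR hθs hN hsb θ').sum_lyap_next_le x z
  have hnext : ∀ z', M.corrGap N τ R α θs θ' (θ - α • M.grad θ θ' z z'.1) z'
      = m.lyap (m.next x z z') z' := by
    intro z'
    rw [corrGap, ← hm]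
    congr 1
    simp only [LinearSA.next, hm, innerSA]
    rw [M.grad_eq_add θ (M.innerMin θ') θ' z z'.1, ← hx, sub_right_comm, ← hx]
  set b1 := ∑ z, (M.d z).toReal * ∑ z', M.stepMatrix z z' *
    ‖M.grad (M.innerMin θ') θ' z z'.1‖ with hb1
  set b2 := ∑ z, (M.d z).toReal * ∑ z', M.stepMatrix z z' *
    ‖M.grad (M.innerMin θ') θ' z z'.1‖ ^ 2 with hb2
  have hnm : m.noiseMean = 9 / 8 * (M.lEta * τ * (2 * (1 + M.η) * M.γ * Δ / M.muEta
      + M.noiseBound R θs)) * b1 + 7 / 2 * (M.lEta * τ) * b2 := by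
    rw [hb1, hb2]
    simp only [LinearSA.noiseMean, LinearSA.noiseAvg, LinearSA.noise, applyKernel, smul_eq_mul,
      mul_add, Finset.sum_add_distrib, Finset.mul_sum, hm, innerSA]
    rw [← hΔ]
    congr 1 <;> refine Finset.sum_congr rfl fun z _ => Finset.sum_congr rfl fun z' _ => ?_ <;> ring
  have hPL : 2 * M.muEta * G ≤ ‖M.meanHess x‖ ^ 2 := by
    rw [hG2]
    linarith [M.muEta_mul_inner_le hη hΦ x]
  have hG0 : 0 ≤ G := gap_nonneg hη hΦ θ θ'
  have hs : √((1 + M.η) * ⟪M.meanHess x, x⟫_ℝ) ^ 2 = 2 * (1 + M.η) * G := by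
    have : (1 + M.η) * ⟪M.meanHess x, x⟫_ℝ = 2 * (1 + M.η) * G := by rw [hG2]; ring
    rw [this, Real.sq_sqrt (by positivity)]
  have h2 := hsb.drift_le (Δ := Δ) (muEta_mul_norm_sq_le_gap hη hΦ θ θ') hs
    (M.sum_sum_mul_sq_le fun z z' => ‖M.grad (M.innerMin θ') θ' z z'.1‖)
    (M.sum_sum_norm_grad_innerMin_sq_le hsb.γ_nonneg hη hΦ hR hθs θ')
  have h3 := abs_corrGap_sub_le hη hΦ hR hθs hN hsb θ' θ z
  have h4 := (abs_le.1 h3).2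
  rw [← hG, ← hΔ] at h4
  have hΓ : 0 ≤ M.g2 * Δ ^ 2 + M.g3 R θs := by
    have h5 := M.sum_sum_norm_grad_innerMin_sq_le hsb.γ_nonneg hη hΦ hR hθs θ'
    have h6 := (sq_nonneg _).trans
      (M.sum_sum_mul_sq_le fun z z' => ‖M.grad (M.innerMin θ') θ' z z'.1‖)
    linarith
  have hE : (12 * M.lEta * τ * (1 + M.η) + M.lEta * τ * M.noiseBound R θs
        + 2 * (M.kappa * τ * (1 + M.η)) * M.γ) * (M.g2 * Δ ^ 2 + M.g3 R θs)
        + 2 * (M.kappa * τ * (1 + M.η)) * Δ ^ 2 + 2 * (M.lEta * τ * M.noiseBound R θs)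
      ≤ M.E1 τ R θs * Δ ^ 2 + M.E2 τ R θs := by
    have e3 : M.lV3 τ R θs = τ * M.noiseBound R θs := rfl
    have h5 : 0 ≤ M.lV2 τ := zero_le_one.trans (le_max_right _ _)
    have h6 : 0 ≤ M.lEta * M.lV2 τ * Δ ^ 2 := by positivity
    have h7 := mul_nonneg hl hΓ
    rw [E1, E2, D1, D3, e3, lV1]
    linarith
  have hE' := mul_le_mul_of_nonneg_left hE (sq_nonneg α)
  have h8 : m.hess = M.meanHess := rfl
  have h9 : M.corrGap N τ R α θs θ' θ z = m.lyap x z := rfl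
  simp only [hnext]
  rw [h9] at h4 ⊢
  have h10 : ∑ z', M.stepMatrix z z' * m.lyap (m.next x z z') z' ≤ m.lyap x z
      - α * ‖M.meanHess x‖ ^ 2 + α ^ 2 * (15 / 2 * (M.lEta * τ * (1 + M.η) ^ 2 * ‖x‖ ^ 2)
        + 2 * α * (1 + M.η) ^ 2 * τ ^ 2 * M.lEta * (2 * (1 + M.η) * M.γ * Δ / M.muEta
          + M.noiseBound R θs) * ‖x‖
        + M.lEta * τ * (2 * (1 + M.η) * M.γ * Δ / M.muEta + M.noiseBound R θs)
          * √((1 + M.η) * ⟪M.meanHess x, x⟫_ℝ) + m.noiseMean) := h1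
  rw [hnm] at h10
  have h11 := mul_le_mul_of_nonneg_left hPL hα.le
  have h12 := mul_le_mul_of_nonneg_left h4 (by positivity : 0 ≤ M.muEta / 2 * α)
  have h13 : 0 ≤ M.muEta * α * G := by positivity
  linarith

end Lyapunov

end RegQ

/-! ### Measurability and integrability of the iterates -/

theorem stronglyMeasurable_apply_of_finite {Ω ι E : Type*} [Fintype ι] [NormedAddCommGroup E]
    [MeasurableSpace ι] [MeasurableSingletonClass ι] {m : MeasurableSpace Ω} {Z : Ω → ι}
    {f : ι → Ω → E} (hZ : Measurable Z) (hf : ∀ i, StronglyMeasurable (f i)) :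
    StronglyMeasurable fun ω => f (Z ω) ω := by
  classical
  have e : (fun ω => f (Z ω) ω) = fun ω => ∑ i, (Z ⁻¹' {i}).indicator (f i) ω := by
    ext ω
    rw [Finset.sum_eq_single (Z ω)]
    · simp
    · intro i _ hi
      exact Set.indicator_of_notMem (by simpa using hi.symm) _
    · simp
  rw [e]
  exact Finset.stronglyMeasurable_fun_sum _ fun i _ =>
    (hf i).indicator (hZ (measurableSet_singleton i))

theorem continuous_applyKernel {X ι E : Type*} [TopologicalSpace X] [Fintype ι]
    [NormedAddCommGroup E] [NormedSpace ℝ E] (K : ι → ι → ℝ) {f : X → ι → E}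
    (hf : ∀ y, Continuous fun q => f q y) (z : ι) : Continuous fun q => applyKernel K (f q) z :=
  continuous_finsetSum _ fun y _ => continuous_const.smul (hf y)

/-- The corrected energy depends continuously on the state, on the additive noise `b` and on its
bound `B`, the other data being fixed. -/
theorem LinearSA.continuous_lyap {X ι E : Type*} [TopologicalSpace X] [Fintype ι]
    [NormedAddCommGroup E] [InnerProductSpace ℝ E] [FiniteDimensional ℝ E]
    {m : X → LinearSA ι E} (m₀ : LinearSA ι E)
    (hm : ∀ q, (m q).p = m₀.p ∧ (m q).d = m₀.d ∧ (m q).N = m₀.N ∧ (m q).A = m₀.A ∧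
      (m q).τ = m₀.τ ∧ (m q).l = m₀.l ∧ (m q).α = m₀.α)
    (hb : ∀ z z', Continuous fun q => (m q).b z z') (hB : Continuous fun q => (m q).B)
    {x : X → E} (hx : Continuous x) (z : ι) : Continuous fun q => (m q).lyap (x q) z := by
  have hp := fun q => (hm q).1
  have hd := fun q => (hm q).2.1
  have hN := fun q => (hm q).2.2.1
  have hA := fun q => (hm q).2.2.2.1
  have hτ := fun q => (hm q).2.2.2.2.1
  have hl := fun q => (hm q).2.2.2.2.2.1
  have hα := fun q => (hm q).2.2.2.2.2.2
  have hhess : ∀ q, (m q).hess = m₀.hess := fun q => by simp only [hess, hd, hA]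
  have hHc : Continuous m₀.hess := m₀.hess.continuous_of_finiteDimensional
  have hbias : ∀ z, Continuous fun q => (m q).bias z := fun z => by
    simp only [bias, hp]
    exact continuous_applyKernel _ (hb z) z
  have hadd : ∀ z, Continuous fun q => (m q).addCorr z := fun z => by
    simp only [addCorr, hN]
    exact continuous_applyKernel _ hbias z
  have hcross : ∀ z, Continuous fun q => (m q).cross z := fun z => by
    simp only [cross, hp, hA, hhess]
    exact (m₀.A z).continuous_of_finiteDimensional.comp
      (hHc.comp (continuous_applyKernel _ hadd z))
  have hcrossMean : Continuous fun q => (m q).crossMean := by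
    simp only [crossMean, hd]
    exact continuous_finsetSum _ fun z _ => continuous_const.smul (hcross z)
  have hcrossCorr : Continuous fun q => (m q).crossCorr z := by
    simp only [crossCorr, hN]
    exact continuous_applyKernel _ (fun y => (hcross y).sub hcrossMean) z
  have hnoise : ∀ z z', Continuous fun q => (m q).noise z z' := fun z z' => by
    simp only [noise, hτ, hl]
    exact ((continuous_const.mul (continuous_const.mul hB)).mul (hb z z').norm).add
      (continuous_const.mul ((hb z z').norm.pow 2))
  have hnoiseAvg : ∀ z, Continuous fun q => (m q).noiseAvg z := fun z => by
    simp only [noiseAvg, hp]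
    exact continuous_applyKernel _ (hnoise z) z
  have hnoiseMean : Continuous fun q => (m q).noiseMean := by
    simp only [noiseMean, hd, smul_eq_mul]
    exact continuous_finsetSum _ fun z _ => continuous_const.mul (hnoiseAvg z)
  have hnoiseCorr : Continuous fun q => (m q).noiseCorr z := by
    simp only [noiseCorr, hN]
    exact continuous_applyKernel _ (fun y => (hnoiseAvg y).sub hnoiseMean) z
  have hmul : ∀ q, (m q).mulCorr z = m₀.mulCorr z := fun q => by
    simp only [mulCorr, hN, hA, hhess]
  simp only [lyap, hhess, hmul, hα]
  have k1 := hHc.comp hx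
  have k2 := ((m₀.mulCorr z).continuous_of_finiteDimensional.comp hx).add (hadd z)
  exact (((continuous_const.mul (k1.inner hx)).sub (continuous_const.mul (k1.inner k2))).add
    (continuous_const.mul (hx.inner hcrossCorr))).add (continuous_const.mul hnoiseCorr)

namespace RegQ

variable {S A : Type*} {h : ℕ}

section Continuity

theorem continuous_val (M : RegQ S A h) : Continuous M.val :=
  continuous_pi fun z => by simp only [val_apply]; fun_prop

variable [Fintype A] [Nonempty A]

theorem continuous_maxQ (s : S) : Continuous fun Q : S × A → ℝ => maxQ Q s := by
  unfold maxQ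
  exact Continuous.finset_sup'_apply _ fun u _ => continuous_apply (s, u)

theorem continuous_target (M : RegQ S A h) (z : S × A) (s' : S) :
    Continuous fun θ => M.target (M.val θ) z s' :=
  continuous_const.add (continuous_const.mul ((continuous_maxQ s').comp M.continuous_val))

theorem continuous_grad (M : RegQ S A h) (z : S × A) (s' : S) :
    Continuous fun q : EuclideanSpace ℝ (Fin h) × EuclideanSpace ℝ (Fin h) =>
      M.grad q.1 q.2 z s' := by
  simp only [grad_eq]
  exact ((M.sampleHess z).continuous_of_finiteDimensional.comp continuous_fst).sub
    (((M.continuous_target z s').comp continuous_snd).smul continuous_const)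

variable [Fintype S]

theorem continuous_bellman (M : RegQ S A h) :
    Continuous fun θ => M.bellman (M.val θ) :=
  continuous_pi fun z => continuous_finsetSum _ fun s' _ =>
    continuous_const.mul (M.continuous_target z s')

variable [DecidableEq S] [DecidableEq A]

theorem continuous_innerMin (M : RegQ S A h) : Continuous M.innerMin := by
  unfold innerMin
  exact (PiLp.continuous_toLp 2 _).comp (Continuous.matrix_mulVec continuous_const
    M.continuous_bellman)

theorem continuous_corrGap (M : RegQ S A h) (N : S × A → S × A → ℝ) (τ R α : ℝ)
    (θs : EuclideanSpace ℝ (Fin h)) (z : S × A) :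
    Continuous fun q : EuclideanSpace ℝ (Fin h) × EuclideanSpace ℝ (Fin h) =>
      M.corrGap N τ R α θs q.2 q.1 z := by
  have hx : Continuous fun q : EuclideanSpace ℝ (Fin h) × EuclideanSpace ℝ (Fin h) =>
      q.1 - M.innerMin q.2 := continuous_fst.sub (M.continuous_innerMin.comp continuous_snd)
  have hv : Continuous fun q : EuclideanSpace ℝ (Fin h) × EuclideanSpace ℝ (Fin h) =>
      ‖M.val (q.2 - θs)‖ :=
    (M.continuous_val.comp (continuous_snd.sub continuous_const)).norm
  refine LinearSA.continuous_lyap 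
    (m := fun q : EuclideanSpace ℝ (Fin h) × EuclideanSpace ℝ (Fin h) => M.innerSA N τ R α θs q.2)
    (M.innerSA N τ R α θs θs) (fun _ => ⟨rfl, rfl, rfl, rfl, rfl, rfl, rfl⟩)
    (fun z z' => ?_) ?_ hx z
  · have h1 := (M.continuous_grad z z'.1).comp ((M.continuous_innerMin.comp
      (continuous_snd (X := EuclideanSpace ℝ (Fin h)))).prodMk continuous_snd)
    exact h1
  · exact ((continuous_const.mul hv).div_const _).add continuous_const

end Continuity

section Integrability

variable [Fintype S] [Fintype A] {M : RegQ S A h} {Ω : Type*} {mΩ : MeasurableSpace Ω}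
  {ρ : Measure Ω}

theorem integrable_norm_val_sub_sq [IsFiniteMeasure ρ] (hΦ : ∀ z, ‖M.feat z‖ ≤ 1)
    (θs : EuclideanSpace ℝ (Fin h)) {θ' : Ω → EuclideanSpace ℝ (Fin h)} (hθ2 : MemLp θ' 2 ρ) :
    Integrable (fun ω => ‖M.val (θ' ω - θs)‖ ^ 2) ρ := by
  have h1 : MemLp (fun ω => θ' ω - θs) 2 ρ := hθ2.sub (memLp_const θs)
  have h2 : MemLp (fun ω => M.val (θ' ω - θs)) 2 ρ :=
    h1.mono (M.continuous_val.comp_aestronglyMeasurable h1.aestronglyMeasurable)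
      (Filter.Eventually.of_forall fun ω => M.norm_val_le hΦ _)
  exact h2.integrable_norm_pow (by norm_num)

variable [Nonempty A] [DecidableEq S] [DecidableEq A]

theorem integrable_gap [IsFiniteMeasure ρ] (hγ0 : 0 ≤ M.γ) (hη : 0 < M.η)
    (hΦ : ∀ z, ‖M.feat z‖ ≤ 1) {R : ℝ} (hR : ∀ s a s', |M.r s a s'| ≤ R)
    {θ θ' : Ω → EuclideanSpace ℝ (Fin h)} (hθ : MemLp θ 2 ρ) (hθ' : MemLp θ' 2 ρ) :
    Integrable (fun ω => M.loss (θ ω) (θ' ω) - M.loss (M.innerMin (θ' ω)) (θ' ω)) ρ := by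
  have hμ : 0 < M.muEta := hη.trans_le (M.eta_le_muEta hΦ)
  have h1 : MemLp (fun ω => M.innerMin (θ' ω)) 2 ρ := by
    have h2 : MemLp (fun ω => (R + M.γ * ‖θ' ω‖) * M.muEta⁻¹) 2 ρ :=
      ((memLp_const R).add (hθ'.norm.const_mul _)).mul_const _
    refine h2.mono (M.continuous_innerMin.comp_aestronglyMeasurable hθ'.aestronglyMeasurable)
      (Filter.Eventually.of_forall fun ω => (le_trans ?_ (Real.le_norm_self _)))
    rw [← div_eq_mul_inv, le_div_iff₀ hμ, mul_comm]
    refine (M.muEta_mul_norm_le _).trans ?_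
    rw [M.meanHess_innerMin hη hΦ]
    refine LinearSA.norm_sum_smul_le (fun _ => ENNReal.toReal_nonneg) M.sum_d fun z =>
      (M.norm_smul_feat_le hΦ z _).trans ((M.abs_bellman_le hγ0 hR _ z).trans ?_)
    gcongr
    exact M.norm_val_le hΦ _
  have h3 : MemLp (fun ω => θ ω - M.innerMin (θ' ω)) 2 ρ := hθ.sub h1
  simp only [M.loss_sub_loss_innerMin hη hΦ]
  have hc : Continuous M.meanHess := M.meanHess.continuous_of_finiteDimensional
  refine ((h3.integrable_norm_pow (by norm_num)).const_mul M.lEta).mono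
    (((hc.comp_aestronglyMeasurable h3.aestronglyMeasurable).inner
      h3.aestronglyMeasurable).const_mul _) (Filter.Eventually.of_forall fun ω => ?_)
  refine le_trans ?_ (Real.le_norm_self _)
  set x := θ ω - M.innerMin (θ' ω)
  have h4 := (abs_real_inner_le_norm (M.meanHess x) x).trans
    (mul_le_mul_of_nonneg_right (M.norm_meanHess_le hη hΦ x) (norm_nonneg x))
  rw [norm_mul, Real.norm_eq_abs ⟪M.meanHess x, x⟫_ℝ]
  norm_num
  have := abs_nonneg ⟪M.meanHess x, x⟫_ℝ
  nlinarith

end Integrability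

section Trajectory

variable [Fintype S] [Fintype A]
  [MeasurableSpace S] [MeasurableSpace A] [DiscreteMeasurableSpace S] [DiscreteMeasurableSpace A]
  {M : RegQ S A h} {Ω : Type*} {mΩ : MeasurableSpace Ω} {ρ : Measure Ω}

/-- Averaging over the next state: a functional of the present and of the next state has the
same expectation as its mean under the transition law. -/
theorem IsTrajectory.integral_succ [IsProbabilityMeasure ρ] {ℱ : Filtration ℕ mΩ}
    {Z : ℕ → Ω → S × A} (hZ : M.IsTrajectory ρ ℱ Z) (n : ℕ) {F : S × A → Ω → ℝ}
    (hF : ∀ z', StronglyMeasurable[ℱ n] (F z')) (hFi : ∀ z', Integrable (F z') ρ) :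
    ∫ ω, F (Z (n + 1) ω) ω ∂ρ
      = ∫ ω, ∑ z', M.stepMatrix (Z n ω) z' * F z' ω ∂ρ
    ∧ Integrable (fun ω => ∑ z', M.stepMatrix (Z n ω) z' * F z' ω) ρ := by
  have hZm : ∀ n, Measurable (Z n) := fun n => (hZ.adapted n).mono (ℱ.le n) le_rfl
  set ind : S × A → Ω → ℝ := fun z' => (Z (n + 1) ⁻¹' {z'}).indicator fun _ => (1 : ℝ) with hind
  have hset : ∀ z', MeasurableSet (Z (n + 1) ⁻¹' {z'}) := fun z' =>
    hZm (n + 1) (measurableSet_singleton z')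
  have hmul : ∀ z', (fun ω => F z' ω * ind z' ω) = (Z (n + 1) ⁻¹' {z'}).indicator (F z') := by
    intro z'
    ext ω
    by_cases hω : Z (n + 1) ω = z' <;> simp [hind, Set.indicator, hω]
  have hint : ∀ z', Integrable (fun ω => F z' ω * ind z' ω) ρ := fun z' => by
    rw [hmul]; exact (hFi z').indicator (hset z')
  have hind_int : ∀ z', Integrable (ind z') ρ := fun z' =>
    (integrable_const (1 : ℝ)).indicator (hset z')
  have hstep : ∀ z', Integrable (fun ω => M.stepMatrix (Z n ω) z' * F z' ω) ρ := by
    intro z'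
    refine (hFi z').mono ?_ (Filter.Eventually.of_forall fun ω => ?_)
    · exact ((measurable_of_finite fun z => M.stepMatrix z z').comp
        (hZm n)).aestronglyMeasurable.mul (hFi z').aestronglyMeasurable
    · rw [norm_mul, Real.norm_of_nonneg (M.stepMatrix_nonneg _ _)]
      refine mul_le_of_le_one_left (norm_nonneg _) ?_
      rw [← M.sum_stepMatrix (Z n ω)]
      exact Finset.single_le_sum (f := fun z' => M.stepMatrix (Z n ω) z')
        (fun y _ => M.stepMatrix_nonneg _ y) (Finset.mem_univ z')
  have hone : ∀ z', ∫ ω, F z' ω * ind z' ω ∂ρ = ∫ ω, M.stepMatrix (Z n ω) z' * F z' ω ∂ρ := by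
    intro z'
    have h1 := condExp_mul_of_stronglyMeasurable_left (m := ℱ n) (hF z') (hint z') (hind_int z')
    rw [← integral_condExp (ℱ.le n)]
    refine integral_congr_ae ?_
    filter_upwards [h1, hZ.markov n z'] with ω hω1 hω2
    rw [show (fun ω => F z' ω * ind z' ω) = F z' * ind z' from rfl, hω1, Pi.mul_apply, hω2,
      mul_comm]
    rfl
  refine ⟨?_, integrable_finsetSum _ fun z' _ => hstep z'⟩
  have e : ∀ ω, F (Z (n + 1) ω) ω = ∑ z', F z' ω * ind z' ω := by
    intro ω
    rw [Finset.sum_eq_single (Z (n + 1) ω)]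
    · simp [hind]
    · intro i _ hi
      have : ω ∉ Z (n + 1) ⁻¹' {i} := by simpa using hi.symm
      simp only [hind, Set.indicator_of_notMem this, mul_zero]
    · simp
  simp_rw [e]
  rw [integral_finsetSum _ fun z' _ => hint z', integral_finsetSum _ fun z' _ => hstep z']
  exact Finset.sum_congr rfl fun z' _ => hone z'

variable [Nonempty A]

theorem stronglyMeasurable_grad {m : MeasurableSpace Ω} {θ θ' : Ω → EuclideanSpace ℝ (Fin h)}
    {Z Z' : Ω → S × A} (hθ : StronglyMeasurable θ) (hθ' : StronglyMeasurable θ')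
    (hZ : Measurable Z) (hZ' : Measurable Z') :
    StronglyMeasurable fun ω => M.grad (θ ω) (θ' ω) (Z ω) (Z' ω).1 := by
  have h1 : ∀ z z' : S × A, StronglyMeasurable fun ω => M.grad (θ ω) (θ' ω) z z'.1 :=
    fun z z' => by
      have h0 := (M.continuous_grad z z'.1).comp_stronglyMeasurable (hθ.prodMk hθ')
      exact h0
  have h2 : ∀ z, StronglyMeasurable fun ω => M.grad (θ ω) (θ' ω) z (Z' ω).1 := fun z =>
    stronglyMeasurable_apply_of_finite (f := fun (z' : S × A) ω => M.grad (θ ω) (θ' ω) z z'.1)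
      hZ' (h1 z)
  exact stronglyMeasurable_apply_of_finite
    (f := fun (z : S × A) ω => M.grad (θ ω) (θ' ω) z (Z' ω).1) hZ h2

theorem memLp_grad [IsFiniteMeasure ρ] (hγ0 : 0 ≤ M.γ) (hη : 0 < M.η)
    (hΦ : ∀ z, ‖M.feat z‖ ≤ 1) {R : ℝ} (hR : ∀ s a s', |M.r s a s'| ≤ R)
    {θ θ' : Ω → EuclideanSpace ℝ (Fin h)} {Z Z' : Ω → S × A}
    (hθ : StronglyMeasurable θ) (hθ' : StronglyMeasurable θ')
    (hZ : Measurable Z) (hZ' : Measurable Z') (hθ2 : MemLp θ 2 ρ) (hθ2' : MemLp θ' 2 ρ) :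
    MemLp (fun ω => M.grad (θ ω) (θ' ω) (Z ω) (Z' ω).1) 2 ρ := by
  have h1 : MemLp (fun ω => (1 + M.η) * ‖θ ω‖ + (R + M.γ * ‖θ' ω‖)) 2 ρ :=
    (hθ2.norm.const_mul _).add ((memLp_const R).add (hθ2'.norm.const_mul _))
  refine h1.mono (stronglyMeasurable_grad hθ hθ' hZ hZ').aestronglyMeasurable
    (Filter.Eventually.of_forall fun ω => ?_)
  exact (M.norm_grad_le hγ0 hη hΦ hR _ _ _ _).trans (Real.le_norm_self _)

section Iterates

variable {ℱ : Filtration ℕ mΩ} {Z : ℕ → Ω → S × A}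

theorem stronglyMeasurable_inner (hZ : M.IsTrajectory ρ ℱ Z) (α : ℝ) {n : ℕ}
    {θ' : Ω → EuclideanSpace ℝ (Fin h)} (hθ' : StronglyMeasurable[ℱ n] θ') (k : ℕ) :
    StronglyMeasurable[ℱ (n + k)] fun ω => M.inner α (fun i => Z i ω) n (θ' ω) k := by
  induction k with
  | zero => exact hθ'
  | succ k ih =>
    have hle : ℱ (n + k) ≤ ℱ (n + (k + 1)) := ℱ.mono (by omega)
    have ih' := ih.mono hle
    exact ih'.sub ((stronglyMeasurable_grad ih' (hθ'.mono (ℱ.mono (by omega)))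
      ((hZ.adapted (n + k)).mono hle le_rfl) (hZ.adapted (n + k + 1))).const_smul α)

theorem memLp_inner [IsFiniteMeasure ρ] (hZ : M.IsTrajectory ρ ℱ Z) (hγ0 : 0 ≤ M.γ)
    (hη : 0 < M.η) (hΦ : ∀ z, ‖M.feat z‖ ≤ 1) {R : ℝ} (hR : ∀ s a s', |M.r s a s'| ≤ R) (α : ℝ)
    {n : ℕ} {θ' : Ω → EuclideanSpace ℝ (Fin h)} (hθ' : StronglyMeasurable[ℱ n] θ')
    (hθ2 : MemLp θ' 2 ρ) (k : ℕ) :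
    MemLp (fun ω => M.inner α (fun i => Z i ω) n (θ' ω) k) 2 ρ := by
  induction k with
  | zero => exact hθ2
  | succ k ih =>
    have hZm : ∀ n, Measurable (Z n) := fun n => (hZ.adapted n).mono (ℱ.le n) le_rfl
    exact ih.sub ((memLp_grad hγ0 hη hΦ hR ((stronglyMeasurable_inner hZ α hθ' k).mono (ℱ.le _))
      (hθ'.mono (ℱ.le _)) (hZm (n + k)) (hZm (n + k + 1)) ih hθ2).const_smul α)

theorem stronglyMeasurable_outer (hZ : M.IsTrajectory ρ ℱ Z) (α : ℝ) (K : ℕ)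
    {θ0 : Ω → EuclideanSpace ℝ (Fin h)} (hθ0 : StronglyMeasurable[ℱ 0] θ0) (t : ℕ) :
    StronglyMeasurable[ℱ (t * K)] fun ω => M.outer α K (fun i => Z i ω) (θ0 ω) t := by
  induction t with
  | zero => rw [zero_mul]; exact hθ0
  | succ t ih =>
    rw [add_mul, one_mul]
    exact stronglyMeasurable_inner hZ α ih K

theorem memLp_outer [IsFiniteMeasure ρ] (hZ : M.IsTrajectory ρ ℱ Z) (hγ0 : 0 ≤ M.γ)
    (hη : 0 < M.η) (hΦ : ∀ z, ‖M.feat z‖ ≤ 1) {R : ℝ} (hR : ∀ s a s', |M.r s a s'| ≤ R) (α : ℝ)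
    (K : ℕ) {θ0 : Ω → EuclideanSpace ℝ (Fin h)} (hθ0 : StronglyMeasurable[ℱ 0] θ0)
    (hθ2 : MemLp θ0 2 ρ) (t : ℕ) :
    MemLp (fun ω => M.outer α K (fun i => Z i ω) (θ0 ω) t) 2 ρ := by
  induction t with
  | zero => exact hθ2
  | succ t ih =>
    exact memLp_inner hZ hγ0 hη hΦ hR α (stronglyMeasurable_outer hZ α K hθ0 t) ih K

end Iterates

end Trajectory

end RegQ

/-! ### The loss gap in expectation -/

namespace RegQ

variable {S A : Type*} {h : ℕ} {M : RegQ S A h} {N : S × A → S × A → ℝ} {τ R α : ℝ}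
  {θs : EuclideanSpace ℝ (Fin h)} {Ω : Type*} {mΩ : MeasurableSpace Ω} {ρ : Measure Ω}

section Constants

variable [Fintype S] [Fintype A] [DecidableEq S] [DecidableEq A]

theorem corrBound_nonneg (hη : 0 ≤ M.η)
    (hsb : StepBounds α M.muEta M.lEta M.kappa τ (1 + M.η) M.γ (M.noiseBound R θs))
    {Δ2 : ℝ} (hΔ : 0 ≤ Δ2) : 0 ≤ M.corrBound τ R θs Δ2 := by
  have hγ := hsb.γ_nonneg; have hρ := hsb.ρ_nonneg; have hτ := hsb.one_le_τ; have hκ := hsb.one_le_κ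
  have hl : 0 ≤ M.lEta := (hsb.μ_pos.trans_le hsb.μ_le).le
  have h3 : M.lV3 τ R θs = τ * M.noiseBound R θs := rfl
  have h2 : 0 ≤ M.lV2 τ := zero_le_one.trans (le_max_right _ _)
  rw [corrBound, h3, lV1]
  positivity

theorem D1_nonneg (hη : 0 ≤ M.η)
    (hsb : StepBounds α M.muEta M.lEta M.kappa τ (1 + M.η) M.γ (M.noiseBound R θs)) :
    0 ≤ M.D1 τ R θs := by
  have hγ := hsb.γ_nonneg; have hρ := hsb.ρ_nonneg; have hτ := hsb.one_le_τ; have hκ := hsb.one_le_κ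
  have hl : 0 ≤ M.lEta := (hsb.μ_pos.trans_le hsb.μ_le).le
  have h3 : M.lV3 τ R θs = τ * M.noiseBound R θs := rfl
  rw [D1, h3, lV1]
  positivity

theorem E1_nonneg (hη : 0 ≤ M.η)
    (hsb : StepBounds α M.muEta M.lEta M.kappa τ (1 + M.η) M.γ (M.noiseBound R θs)) :
    0 ≤ M.E1 τ R θs := by
  have hτ := hsb.one_le_τ; have hκ := hsb.one_le_κ
  have hl : 0 ≤ M.lEta := (hsb.μ_pos.trans_le hsb.μ_le).le
  have h1 := D1_nonneg hη hsb
  have h2 : 0 ≤ M.lV2 τ := zero_le_one.trans (le_max_right _ _)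
  rw [E1, D3, g2, lV1]
  positivity

variable [Nonempty A]

theorem E2_nonneg (hη : 0 ≤ M.η)
    (hsb : StepBounds α M.muEta M.lEta M.kappa τ (1 + M.η) M.γ (M.noiseBound R θs)) :
    0 ≤ M.E2 τ R θs := by
  have hρ := hsb.ρ_nonneg; have hτ := hsb.one_le_τ
  have hl : 0 ≤ M.lEta := (hsb.μ_pos.trans_le hsb.μ_le).le
  have h1 := D1_nonneg hη hsb
  have h3 : M.lV3 τ R θs = τ * M.noiseBound R θs := rfl
  have h2 : 0 ≤ M.sigmaSq θs := Real.iSup_nonneg fun z => Finset.sum_nonneg fun s' _ =>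
    mul_nonneg ENNReal.toReal_nonneg (sq_nonneg _)
  rw [E2, h3, g3]
  positivity

end Constants

section CorrBound

variable [Fintype S] [Fintype A] [DecidableEq S] [DecidableEq A]

theorem integrable_corrBound [IsFiniteMeasure ρ] (hΦ : ∀ z, ‖M.feat z‖ ≤ 1)
    {θ' : Ω → EuclideanSpace ℝ (Fin h)} (hθ2' : MemLp θ' 2 ρ) :
    Integrable (fun ω => M.corrBound τ R θs (‖M.val (θ' ω - θs)‖ ^ 2)) ρ :=
  ((integrable_norm_val_sub_sq hΦ θs hθ2').const_mul _).add (integrable_const _)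

theorem integral_corrBound [IsProbabilityMeasure ρ] (hΦ : ∀ z, ‖M.feat z‖ ≤ 1)
    {θ' : Ω → EuclideanSpace ℝ (Fin h)} (hθ2' : MemLp θ' 2 ρ) :
    ∫ ω, M.corrBound τ R θs (‖M.val (θ' ω - θs)‖ ^ 2) ∂ρ
      = M.corrBound τ R θs (∫ ω, ‖M.val (θ' ω - θs)‖ ^ 2 ∂ρ) := by
  simp only [corrBound]
  rw [integral_add ((integrable_norm_val_sub_sq hΦ θs hθ2').const_mul _) (integrable_const _),
    integral_const_mul, integral_const]
  simp

end CorrBound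

variable [Fintype S] [Fintype A] [Nonempty A] [DecidableEq S] [DecidableEq A]
  [MeasurableSpace S] [MeasurableSpace A] [DiscreteMeasurableSpace S] [DiscreteMeasurableSpace A]

theorem stronglyMeasurable_corrGap {m : MeasurableSpace Ω} {θ θ' : Ω → EuclideanSpace ℝ (Fin h)}
    {Z : Ω → S × A} (hθ : StronglyMeasurable θ) (hθ' : StronglyMeasurable θ')
    (hZ : Measurable Z) :
    StronglyMeasurable fun ω => M.corrGap N τ R α θs (θ' ω) (θ ω) (Z ω) := by
  refine stronglyMeasurable_apply_of_finite
    (f := fun (z : S × A) ω => M.corrGap N τ R α θs (θ' ω) (θ ω) z) hZ fun z => ?_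
  have h0 := (M.continuous_corrGap N τ R α θs z).comp_stronglyMeasurable (hθ.prodMk hθ')
  exact h0

theorem integrable_corrGap [IsFiniteMeasure ρ] (hη : 0 < M.η) (hΦ : ∀ z, ‖M.feat z‖ ≤ 1)
    (hR : ∀ s a s', |M.r s a s'| ≤ R) (hθs : M.IsSolution θs)
    (hN : IsPoissonKernel M.stepMatrix (fun z => (M.d z).toReal) τ N)
    (hsb : StepBounds α M.muEta M.lEta M.kappa τ (1 + M.η) M.γ (M.noiseBound R θs))
    {θ θ' : Ω → EuclideanSpace ℝ (Fin h)} {Z : Ω → S × A} (hθ : StronglyMeasurable θ)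
    (hθ' : StronglyMeasurable θ') (hZ : Measurable Z) (hθ2 : MemLp θ 2 ρ) (hθ2' : MemLp θ' 2 ρ) :
    Integrable (fun ω => M.corrGap N τ R α θs (θ' ω) (θ ω) (Z ω)) ρ := by
  have h1 := integrable_gap hsb.γ_nonneg hη hΦ hR hθ2 hθ2'
  refine ((h1.const_mul (5 / 4)).add
    ((integrable_corrBound (τ := τ) (R := R) (θs := θs) hΦ hθ2').const_mul α)).mono
    (stronglyMeasurable_corrGap hθ hθ' hZ).aestronglyMeasurable
    (Filter.Eventually.of_forall fun ω => le_trans ?_ (Real.le_norm_self _))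
  have h2 := abs_le.1 (abs_corrGap_sub_le hη hΦ hR hθs hN hsb (θ' ω) (θ ω) (Z ω))
  have h3 := gap_nonneg hη hΦ (θ ω) (θ' ω)
  rw [Real.norm_eq_abs, abs_le]
  simp only [Pi.add_apply]
  constructor <;> linarith

/-- One inner step in expectation: the one-step drift of the corrected gap, averaged over the
trajectory. -/
theorem integral_corrGap_inner_succ_le [IsProbabilityMeasure ρ] {ℱ : Filtration ℕ mΩ}
    {Z : ℕ → Ω → S × A} (hZ : M.IsTrajectory ρ ℱ Z)
    (hη : 0 < M.η) (hΦ : ∀ z, ‖M.feat z‖ ≤ 1)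
    (hR : ∀ s a s', |M.r s a s'| ≤ R) (hθs : M.IsSolution θs)
    (hN : IsPoissonKernel M.stepMatrix (fun z => (M.d z).toReal) τ N)
    (hsb : StepBounds α M.muEta M.lEta M.kappa τ (1 + M.η) M.γ (M.noiseBound R θs))
    {n : ℕ} {θ' : Ω → EuclideanSpace ℝ (Fin h)} (hθ' : StronglyMeasurable[ℱ n] θ')
    (hθ2' : MemLp θ' 2 ρ) (k : ℕ) :
    ∫ ω, M.corrGap N τ R α θs (θ' ω) (M.inner α (fun i => Z i ω) n (θ' ω) (k + 1))
        (Z (n + (k + 1)) ω) ∂ρ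
      ≤ (1 - M.muEta / 2 * α) * ∫ ω, M.corrGap N τ R α θs (θ' ω)
          (M.inner α (fun i => Z i ω) n (θ' ω) k) (Z (n + k) ω) ∂ρ
        + α ^ 2 * (M.E1 τ R θs * ∫ ω, ‖M.val (θ' ω - θs)‖ ^ 2 ∂ρ + M.E2 τ R θs
          + M.muEta / 2 * M.corrBound τ R θs (∫ ω, ‖M.val (θ' ω - θs)‖ ^ 2 ∂ρ)) := by
  set θ : Ω → EuclideanSpace ℝ (Fin h) := fun ω => M.inner α (fun i => Z i ω) n (θ' ω) k with hθdef
  have hγ0 := hsb.γ_nonneg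
  have hθ : StronglyMeasurable[ℱ (n + k)] θ := stronglyMeasurable_inner hZ α hθ' k
  have hθ2 : MemLp θ 2 ρ := memLp_inner hZ hγ0 hη hΦ hR α hθ' hθ2' k
  have hθk : StronglyMeasurable[ℱ (n + k)] θ' := hθ'.mono (ℱ.mono (Nat.le_add_right n k))
  have hZm : ∀ n, Measurable (Z n) := fun n => (hZ.adapted n).mono (ℱ.le n) le_rfl
  have hgm : ∀ z' : S × A, StronglyMeasurable[ℱ (n + k)] fun ω =>
      θ ω - α • M.grad (θ ω) (θ' ω) (Z (n + k) ω) z'.1 := fun z' =>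
    hθ.sub ((stronglyMeasurable_grad (Z' := fun _ => z') hθ hθk (hZ.adapted (n + k))
      measurable_const).const_smul α)
  have hgL : ∀ z' : S × A, MemLp (fun ω =>
      θ ω - α • M.grad (θ ω) (θ' ω) (Z (n + k) ω) z'.1) 2 ρ := fun z' =>
    hθ2.sub ((memLp_grad (Z' := fun _ => z') hγ0 hη hΦ hR (hθ.mono (ℱ.le _)) (hθ'.mono (ℱ.le _))
      (hZm _) measurable_const hθ2 hθ2').const_smul α)
  have hs := hZ.integral_succ (n + k)
    (F := fun z' ω => M.corrGap N τ R α θs (θ' ω)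
      (θ ω - α • M.grad (θ ω) (θ' ω) (Z (n + k) ω) z'.1) z')
    (fun z' => stronglyMeasurable_corrGap (Z := fun _ => z') (hgm z') hθk measurable_const)
    (fun z' => integrable_corrGap (Z := fun _ => z') hη hΦ hR hθs hN hsb ((hgm z').mono (ℱ.le _))
      (hθ'.mono (ℱ.le _)) measurable_const (hgL z') hθ2')
  -- The iterate of time `k + 1` depends on the future only through the next state `Z (n + k + 1)`.
  have e : ∫ ω, M.corrGap N τ R α θs (θ' ω) (M.inner α (fun i => Z i ω) n (θ' ω) (k + 1))
      (Z (n + (k + 1)) ω) ∂ρ = ∫ ω, M.corrGap N τ R α θs (θ' ω)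
        (θ ω - α • M.grad (θ ω) (θ' ω) (Z (n + k) ω) (Z (n + k + 1) ω).1) (Z (n + k + 1) ω) ∂ρ :=
    rfl
  rw [e, hs.1]
  have hcg : Integrable (fun ω => M.corrGap N τ R α θs (θ' ω) (θ ω) (Z (n + k) ω)) ρ :=
    integrable_corrGap hη hΦ hR hθs hN hsb (hθ.mono (ℱ.le _)) (hθ'.mono (ℱ.le _)) (hZm _) hθ2 hθ2'
  have hΔ := integrable_norm_val_sub_sq hΦ θs hθ2'
  have hJ := integrable_corrBound (τ := τ) (R := R) (θs := θs) hΦ hθ2'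
  have hA := (hΔ.const_mul (M.E1 τ R θs)).add (integrable_const (μ := ρ) (M.E2 τ R θs))
  have hrhs := (hcg.const_mul (1 - M.muEta / 2 * α)).add
    ((hA.add (hJ.const_mul (M.muEta / 2))).const_mul (α ^ 2))
  refine (integral_mono hs.2 hrhs fun ω =>
    sum_corrGap_le hη hΦ hR hθs hN hsb (θ' ω) (θ ω) (Z (n + k) ω)).trans_eq ?_
  rw [integral_add' (hcg.const_mul _) ((hA.add (hJ.const_mul (M.muEta / 2))).const_mul _),
    integral_const_mul, integral_const_mul, integral_add' hA (hJ.const_mul _),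
    integral_add' (hΔ.const_mul _) (integrable_const _), integral_const_mul, integral_const_mul,
    integral_corrBound hΦ hθ2', integral_const, probReal_univ, one_smul]

/-- The linear recursion `x (k + 1) ≤ (1 - μ / 2 * α) x k + α² q` iterated, with the geometric
series summed. -/
theorem le_pow_mul_add_of_succ_le {x : ℕ → ℝ} {μ α q : ℝ} (hμ : 0 < μ) (hα : 0 ≤ α)
    (hr : μ / 2 * α ≤ 1) (hq : 0 ≤ q)
    (hx : ∀ k, x (k + 1) ≤ (1 - μ / 2 * α) * x k + α ^ 2 * q) (k : ℕ) :
    x k ≤ (1 - μ / 2 * α) ^ k * x 0 + 2 * α / μ * q := by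
  induction k with
  | zero =>
    simp only [pow_zero, one_mul]
    have : 0 ≤ 2 * α / μ * q := by positivity
    linarith
  | succ k ih =>
    refine (hx k).trans ?_
    have h1 := mul_le_mul_of_nonneg_left ih (by linarith : 0 ≤ 1 - μ / 2 * α)
    have h2 : μ / 2 * α * (2 * α / μ * q) = α ^ 2 * q := by field_simp
    rw [pow_succ (1 - μ / 2 * α)]
    linarith

/-- The loss gap along one inner loop with a random frozen target `θ'`, by iterating the drift of
the corrected gap and comparing it with the gap at both ends. -/
theorem integral_gap_inner_le [IsProbabilityMeasure ρ] {ℱ : Filtration ℕ mΩ}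
    {Z : ℕ → Ω → S × A} (hZ : M.IsTrajectory ρ ℱ Z)
    (hη : 0 < M.η) (hΦ : ∀ z, ‖M.feat z‖ ≤ 1)
    (hR : ∀ s a s', |M.r s a s'| ≤ R) (hθs : M.IsSolution θs)
    (hN : IsPoissonKernel M.stepMatrix (fun z => (M.d z).toReal) τ N)
    (hsb : StepBounds α M.muEta M.lEta M.kappa τ (1 + M.η) M.γ (M.noiseBound R θs))
    {n : ℕ} {θ' : Ω → EuclideanSpace ℝ (Fin h)} (hθ' : StronglyMeasurable[ℱ n] θ')
    (hθ2' : MemLp θ' 2 ρ) (k : ℕ) :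
    ∫ ω, (M.loss (M.inner α (fun i => Z i ω) n (θ' ω) k) (θ' ω)
        - M.loss (M.innerMin (θ' ω)) (θ' ω)) ∂ρ
      ≤ 2 * (1 - M.muEta / 2 * α) ^ k * ∫ ω, (M.loss (θ' ω) (θ' ω)
          - M.loss (M.innerMin (θ' ω)) (θ' ω)) ∂ρ
        + 2 * α * ((2 / M.muEta * M.E1 τ R θs
            + 4 * (M.lV1 τ * M.γ * M.kappa + M.lEta * M.lV2 τ))
          * ∫ ω, ‖M.val (θ' ω - θs)‖ ^ 2 ∂ρ
        + 2 / M.muEta * M.E2 τ R θs + 6 * M.lEta * M.lV3 τ R θs) := by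
  have hγ0 := hsb.γ_nonneg
  have hμ := hsb.μ_pos
  have hα := hsb.α_pos
  have hZm : ∀ n, Measurable (Z n) := fun n => (hZ.adapted n).mono (ℱ.le n) le_rfl
  set Δ2 := ∫ ω, ‖M.val (θ' ω - θs)‖ ^ 2 ∂ρ with hΔ2
  set J := M.corrBound τ R θs Δ2 with hJ
  set P := M.E1 τ R θs * Δ2 + M.E2 τ R θs with hP
  set x : ℕ → ℝ := fun k => ∫ ω, M.corrGap N τ R α θs (θ' ω)
    (M.inner α (fun i => Z i ω) n (θ' ω) k) (Z (n + k) ω) ∂ρ with hx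
  set G : ℕ → ℝ := fun k => ∫ ω, (M.loss (M.inner α (fun i => Z i ω) n (θ' ω) k) (θ' ω)
        - M.loss (M.innerMin (θ' ω)) (θ' ω)) ∂ρ with hG
  have hΔ0 : 0 ≤ Δ2 := integral_nonneg fun ω => sq_nonneg _
  have hG0 : ∀ k, 0 ≤ G k := fun k => integral_nonneg fun ω => gap_nonneg hη hΦ _ _
  have hcmp : ∀ k, |x k - G k| ≤ 1 / 4 * G k + α * J := by
    intro k
    have hL := memLp_inner hZ hγ0 hη hΦ hR α hθ' hθ2' k
    have hgi := integrable_gap hγ0 hη hΦ hR hL hθ2'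
    have hci := integrable_corrGap (Z := Z (n + k)) hη hΦ hR hθs hN hsb
      ((stronglyMeasurable_inner hZ α hθ' k).mono (ℱ.le _)) (hθ'.mono (ℱ.le _)) (hZm _) hL hθ2'
    have hbi := integrable_corrBound (τ := τ) (R := R) (θs := θs) hΦ hθ2'
    simp only [hx, hG]
    rw [← integral_sub hci hgi, hJ, ← integral_corrBound hΦ hθ2', ← integral_const_mul,
      ← integral_const_mul, ← integral_add (hgi.const_mul _) (hbi.const_mul _)]
    refine abs_integral_le_integral_abs.trans (integral_mono (hci.sub hgi).abs
      ((hgi.const_mul _).add (hbi.const_mul _)) fun ω => ?_)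
    exact abs_corrGap_sub_le hη hΦ hR hθs hN hsb _ _ _
  have hJ0 : 0 ≤ J := corrBound_nonneg hη.le hsb hΔ0
  have hP0 : 0 ≤ P :=
    add_nonneg (mul_nonneg (E1_nonneg hη.le hsb) hΔ0) (E2_nonneg hη.le hsb)
  have hr : M.muEta / 2 * α ≤ 1 := by
    have h1 : M.muEta * α ≤ (1 + M.η) * α := by gcongr; exact hsb.μ_le.trans hsb.l_le
    linarith [hsb.αa_le]
  have hxk := le_pow_mul_add_of_succ_le (x := x) hμ hα.le hr (q := P + M.muEta / 2 * J)
    (by positivity)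
    (fun k => integral_corrGap_inner_succ_le hZ hη hΦ hR hθs hN hsb hθ' hθ2' k) k
  have h0 := (abs_le.1 (hcmp 0)).2
  have hk := (abs_le.1 (hcmp k)).1
  have hr0 : 0 ≤ 1 - M.muEta / 2 * α := by linarith
  have hr1 : (1 - M.muEta / 2 * α) ^ k ≤ 1 := pow_le_one₀ hr0 (by
    have : 0 ≤ M.muEta / 2 * α := by positivity
    linarith)
  have hrk := pow_nonneg hr0 k
  set rk := (1 - M.muEta / 2 * α) ^ k
  have h1 : 2 * α / M.muEta * (P + M.muEta / 2 * J) = 2 * α / M.muEta * P + α * J := by field_simp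
  rw [h1] at hxk
  have h2 : rk * x 0 ≤ 5 / 4 * (rk * G 0) + α * J := by
    have := mul_le_mul_of_nonneg_left h0 hrk
    have := mul_le_mul_of_nonneg_right hr1 (by positivity : 0 ≤ α * J)
    linarith
  have h3 : 0 ≤ rk * G 0 := mul_nonneg hrk (hG0 0)
  have h4 : 0 ≤ 2 * α / M.muEta * P := by positivity
  -- The corrector size enters three times: at step `k`, at the start, and in the drift.
  have h5 : 2 * α * ((2 / M.muEta * M.E1 τ R θs
            + 4 * (M.lV1 τ * M.γ * M.kappa + M.lEta * M.lV2 τ)) * Δ2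
        + 2 / M.muEta * M.E2 τ R θs + 6 * M.lEta * M.lV3 τ R θs)
      = 2 * (2 * α / M.muEta * P) + 4 * (α * J) := by
    rw [hP, hJ, corrBound]; ring
  rw [h5, mul_assoc]
  change G k ≤ 2 * (rk * G 0) + _
  linarith

end RegQ
end

theorem mainTheorem6 {S A : Type*} [Fintype S] [Fintype A] [Nonempty A]
    [DecidableEq S] [DecidableEq A] [MeasurableSpace S] [MeasurableSpace A]
    [DiscreteMeasurableSpace S] [DiscreteMeasurableSpace A] {h : ℕ}
    (M : RegQ S A h) (hγ0 : 0 ≤ M.γ) (hγ1 : M.γ < 1) (hη : 0 < M.η)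
    (Rmax : ℝ) (hR : ∀ s a s', |M.r s a s'| ≤ Rmax)
    (hΦ : ∀ z, ‖M.feat z‖ ≤ 1)
    (hirr : M.stepMatrix.IsIrreducible) (hd : M.IsStationary)
    (θs : EuclideanSpace ℝ (Fin h)) (hθs : M.IsSolution θs)
    (w : S × A)
    {Ω : Type*} {mΩ : MeasurableSpace Ω} (ρ : Measure Ω) [IsProbabilityMeasure ρ]
    (ℱ : Filtration ℕ mΩ) (Z : ℕ → Ω → S × A) (hZ : M.IsTrajectory ρ ℱ Z)
    (θ0 : Ω → EuclideanSpace ℝ (Fin h)) (hθ0 : StronglyMeasurable[ℱ 0] θ0)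
    (hθ0' : MemLp θ0 2 ρ)
    (α : ℝ) (hα0 : 0 < α)
    (hα : α ≤ min (M.alpha1 (M.tauMax w) Rmax θs) (M.alpha2 (M.tauMax w) Rmax θs))
    (K t k : ℕ) (ht : 1 ≤ t) (hk : k ≤ K) :
    Integrable (fun ω => M.gap α K (fun n => Z n ω) (θ0 ω) t k) ρ ∧
    Integrable (fun ω => ‖M.val (M.outer α K (fun n => Z n ω) (θ0 ω) (t - 1) - θs)‖ ^ 2) ρ ∧
    ∫ ω, M.gap α K (fun n => Z n ω) (θ0 ω) t k ∂ρ ≤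
      2 * (1 - M.muEta / 2 * α) ^ k * ∫ ω, M.gap α K (fun n => Z n ω) (θ0 ω) t 0 ∂ρ
      + 2 * α * ((2 / M.muEta * M.E1 (M.tauMax w) Rmax θs
            + 4 * (M.lV1 (M.tauMax w) * M.γ * M.kappa + M.lEta * M.lV2 (M.tauMax w)))
          * ∫ ω, ‖M.val (M.outer α K (fun n => Z n ω) (θ0 ω) (t - 1) - θs)‖ ^ 2 ∂ρ
        + 2 / M.muEta * M.E2 (M.tauMax w) Rmax θs
        + 6 * M.lEta * M.lV3 (M.tauMax w) Rmax θs) := by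
  have hR0 : 0 ≤ Rmax := (abs_nonneg _).trans (hR w.1 w.2 w.1)
  have hτ := M.one_le_tauMax hirr w
  obtain ⟨N, hN⟩ := exists_isPoissonKernel w M.sum_stepMatrix hirr hd.sum_mul_stepMatrix
    (hd.pos hirr w).ne' fun z => M.tsum_survival_le_tauMax hirr z w
  have hsb := M.stepBounds hγ0 hγ1 hη hΦ hR0 hτ θs hα0 hα
  have hθ := RegQ.stronglyMeasurable_outer hZ α K hθ0 (t - 1)
  have hθ2 := RegQ.memLp_outer hZ hγ0 hη hΦ hR α K hθ0 hθ0' (t - 1)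
  exact ⟨RegQ.integrable_gap hγ0 hη hΦ hR (RegQ.memLp_inner hZ hγ0 hη hΦ hR α hθ hθ2 k) hθ2,
    RegQ.integrable_norm_val_sub_sq hΦ θs hθ2,
    RegQ.integral_gap_inner_le hZ hη hΦ hR hθs hN hsb hθ hθ2 k⟩
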